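/- **Definitions.** Graphs are finite, undirected and simple. For a graph $G=(V,E)$ and $X\subseteq V$, two vertices are *connected in $G-X$* if they both lie outside $X$ and some path of $G$ joins them and avoids $X$ (every vertex outside $X$ is connected to itself in $G-X$). For a set $\mathbf T\subseteq V\times V$, a set $X\subseteq V$ is a *vertex multicut* of $(G,\mathbf T)$ if for no $(s,t)\in\mathbf T$ the vertices $s,t$ are connected in $G-X$. For $W\subseteq V$, a set $X\subseteq V\setminus W$ is a *vertex multiway cut* of $(G,W)$ if no two distinct vertices of $W$ are connected in $G-X$. An *instance* of VMC-Compression (Vertex Multicut Compression) is a tuple $I=(G,\mathbf T,W,k)$ with $G=(V,E)$ a graph, $\mathbf T\subseteq V\times V$, $k\ge 0$ an integer, and $W\subseteq V$ a vertex multicut of $(G,\mathbf T)$ with $|W|\le k+1$. A *solution* of $I$ is a set $X\subseteq V\setminus W$ with $|X|\le k$ that is a vertex multicut of $(G,\mathbf T)$ and a vertex multiway cut of $(G,W)$; $I$ is a *yes-instance* if it has a solution and a *no-instance* otherwise. A solution $X$ is *shadowless* if every vertex of $G-X$ is connected in $G-X$ to some vertex of $W$. We write $n=|V|$, and $|I|$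 for the size of $I$. A *partial branching algorithm* is an algorithm that takes an instance $I=(G,\mathbf T,W,k)$ of VMC-Compression and outputs a finite set $\mathcal I$ of instances of VMC-Compression such that (a) every $I'=(G',\mathbf T',W',k')\in\mathcal I$ satisfies $|I'|\le |I|^{O(1)}$ and $k'\le k$, and (b) if $I$ is a no-instance, then every instance in $\mathcal I$ is a no-instance. **Theorem.** There is a deterministic partial branching algorithm for VMC-Compression with running time $k^{O(k)}n^{O(1)}$ (on a random access machine whose arithmetic operations are addition and subtraction, each instruction counting as one step) that reduces every instance $I$ to a set $\mathcal I$ of at most $k^{O(k)}\log n$ instances such that, if $I$ is a yes-instance, then some instance in $\mathcal I$ admits a shadowless solution. Here $k^{O(k)}$, $\log n$ and $n^{O(1)}$ are read with the usual conventions for very small $k$ and $n$: there is an absolute constant $c$ such that the running time is at most $c\cdot\max(k,2)^{ck}(n+1)^c$ and $|\mathcal I|\le c\cdot\max(k,2)^{ck}\,(1+\lfloor\log_2 n\rfloor)$ for all instances (with $\lfloor\log_2 n\rfloor$ read as $0$ for $n=0$). -/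

import Mathlib

/-! ### Cuts in graphs -/

namespace VMC

/-- `u` and `v` are connected in `G - X`: there is a walk from `u` to `v` in `G` none of whose
vertices (end points included) lies in `X`. -/
def ConnectedOff {V : Type*} (G : SimpleGraph V) (X : Finset V) (u v : V) : Prop :=
  ∃ p : G.Walk u v, ∀ x ∈ p.support, x ∉ X

/-- `X` is a vertex multicut of `(G, T)`. -/
def IsMulticut {V : Type*} (G : SimpleGraph V) (T : Finset (V × V)) (X : Finset V) : Prop :=
  ∀ st ∈ T, ¬ ConnectedOff G X st.1 st.2

/-- `X` is a vertex multiway cut of `(G, W)`: it is disjoint from `W`, and every component of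
`G - X` contains at most one vertex of `W`. -/
def IsMultiwayCut {V : Type*} (G : SimpleGraph V) (W X : Finset V) : Prop :=
  Disjoint X W ∧ ∀ w₁ ∈ W, ∀ w₂ ∈ W, ConnectedOff G X w₁ w₂ → w₁ = w₂

/-- The shadow of `Y` with respect to `W`: the vertices of `G - Y` outside `W` that are not
connected to `W` in `G - Y`. -/
def shadow {V : Type*} (G : SimpleGraph V) (W Y : Finset V) : Set V :=
  {v | v ∉ W ∧ v ∉ Y ∧ ∀ w ∈ W, ¬ ConnectedOff G Y v w}

/-- An instance `(G, T, W, k)` of Vertex Multicut Compression, on the vertex set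
`{0, ..., n - 1}`. -/
structure Instance where
  n : ℕ
  G : SimpleGraph (Fin n)
  T : Finset (Fin n × Fin n)
  W : Finset (Fin n)
  k : ℕ
  multicut : IsMulticut G T W
  card_le : W.card ≤ k + 1

namespace Instance

/-- `X` is a solution of the instance (of size at most `k`). -/
structure IsSolution (I : Instance) (X : Finset (Fin I.n)) : Prop where
  card_le : X.card ≤ I.k
  multicut : IsMulticut I.G I.T X
  disjoint : Disjoint X I.W
  multiwayCut : IsMultiwayCut I.G I.W X

/-- The instance is a yes-instance. -/
def IsYes (I : Instance) : Prop := ∃ X, I.IsSolution X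

/-- `X` is a shadowless solution of the instance. -/
def IsShadowlessSolution (I : Instance) (X : Finset (Fin I.n)) : Prop :=
  I.IsSolution X ∧ shadow I.G I.W X = ∅

open Classical in
/-- The representation of an instance as a sequence of numbers: `n`, then `k`, then (row by row)
the `0/1`-adjacency matrix of `G`, the `0/1`-matrix of `T` and the `0/1`-indicator of `W`.
It is self-delimiting. -/
noncomputable def encode (I : Instance) : List ℕ :=
  [I.n, I.k]
    ++ List.ofFn (fun i : Fin (I.n * I.n) => if I.G.Adj i.divNat i.modNat then 1 else 0)
    ++ List.ofFn (fun i : Fin (I.n * I.n) => if (i.divNat, i.modNat) ∈ I.T then 1 else 0)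
    ++ List.ofFn (fun v : Fin I.n => if v ∈ I.W then 1 else 0)

/-- The size `|I|` of an instance: the number of machine words of its representation. -/
noncomputable def size (I : Instance) : ℕ := I.encode.length

end Instance

/-- The map `A`, sending an instance to the (listed) set of the instances to which it is reduced,
has the properties required of a partial branching algorithm: sizes grow at most polynomially,
the parameter does not grow, and no-instances are reduced to no-instances only. -/
def IsPartialBranching (A : Instance → List Instance) : Prop :=
  (∃ c : ℕ, ∀ I, ∀ I' ∈ A I, I'.size ≤ I.size ^ c) ∧
  (∀ I, ∀ I' ∈ A I, I'.k ≤ I.k) ∧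
  (∀ I, ¬ I.IsYes → ∀ I' ∈ A I, ¬ I'.IsYes)

end VMC

/-! ### A random access machine with a step count

Programs have registers and an indirectly addressed memory that hold natural numbers, and an
output tape. The only arithmetic is addition and truncated subtraction, so that after `t` steps
all numbers have at most `t` more bits than the input and the constants of the program: counting
every instruction as one step is polynomially equivalent to Turing machine time. -/

namespace RAM

structure State where
  reg : ℕ → ℕ
  mem : ℕ → ℕ
  out : List ℕ

/-- Programs; `x`, `y`, `z` are names of registers. -/
inductive Program where
  /-- do nothing -/
  | skip
  /-- `x := a` for a constant `a` -/
  | const (x a : ℕ)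
  /-- `x := y + z` -/
  | add (x y z : ℕ)
  /-- `x := y - z` (which is `0` if `y < z`) -/
  | sub (x y z : ℕ)
  /-- `x := mem[y]` -/
  | load (x y : ℕ)
  /-- `mem[x] := y` -/
  | store (x y : ℕ)
  /-- append the content of `x` to the output -/
  | write (x : ℕ)
  /-- first `p`, then `q` -/
  | seq (p q : Program)
  /-- if `x ≠ 0` then `p` else `q` -/
  | branch (x : ℕ) (p q : Program)
  /-- while `x ≠ 0` do `p` -/
  | loop (x : ℕ) (p : Program)

/-- `Runs p s t s'`: started in the state `s`, the program `p` halts after exactly `t` steps, in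
the state `s'`. Each elementary instruction and each test of a register is one step. -/
inductive Runs : Program → State → ℕ → State → Prop
  | skip (s : State) : Runs .skip s 1 s
  | const (x a : ℕ) (s : State) :
      Runs (.const x a) s 1 { s with reg := Function.update s.reg x a }
  | add (x y z : ℕ) (s : State) :
      Runs (.add x y z) s 1 { s with reg := Function.update s.reg x (s.reg y + s.reg z) }
  | sub (x y z : ℕ) (s : State) :
      Runs (.sub x y z) s 1 { s with reg := Function.update s.reg x (s.reg y - s.reg z) }
  | load (x y : ℕ) (s : State) :
      Runs (.load x y) s 1 { s with reg := Function.update s.reg x (s.mem (s.reg y)) }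
  | store (x y : ℕ) (s : State) :
      Runs (.store x y) s 1 { s with mem := Function.update s.mem (s.reg x) (s.reg y) }
  | write (x : ℕ) (s : State) :
      Runs (.write x) s 1 { s with out := s.out ++ [s.reg x] }
  | seq {p q : Program} {s s' s'' : State} {t t' : ℕ} :
      Runs p s t s' → Runs q s' t' s'' → Runs (.seq p q) s (t + t') s''
  | branch_true {x : ℕ} {p q : Program} {s s' : State} {t : ℕ} :
      s.reg x ≠ 0 → Runs p s t s' → Runs (.branch x p q) s (t + 1) s'
  | branch_false {x : ℕ} {p q : Program} {s s' : State} {t : ℕ} :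
      s.reg x = 0 → Runs q s t s' → Runs (.branch x p q) s (t + 1) s'
  | loop_true {x : ℕ} {p : Program} {s s' s'' : State} {t t' : ℕ} :
      s.reg x ≠ 0 → Runs p s t s' → Runs (.loop x p) s' t' s'' →
        Runs (.loop x p) s (t + 1 + t') s''
  | loop_false {x : ℕ} {p : Program} {s : State} :
      s.reg x = 0 → Runs (.loop x p) s 1 s

/-- The initial state: the input stands at the beginning of the memory; everything else is `0`,
and the output is empty. -/
def init (input : List ℕ) : State where
  reg := fun _ => 0
  mem := fun i => input.getD i 0
  out := []

/-- On the given input, `p` halts within `t` steps with the given output. -/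
def OutputsWithin (p : Program) (input output : List ℕ) (t : ℕ) : Prop :=
  ∃ t' ≤ t, ∃ s, Runs p (init input) t' s ∧ s.out = output

end RAM

/-! Let `Z` be a set of vertices disjoint from `W`. Bypass `Z`: vertices outside `Z` that are joined
through `Z` become adjacent, terminal pairs are carried along walks through `Z`, and each vertex of
`Z` is attached to a vertex of `W`. Every solution of the new instance solves the old one
(`IsSolution.of_torso`), so no choice of `Z` turns a no-instance into a yes-instance. Conversely, a
solution that is disjoint from `Z` and whose shadow lies in `Z` becomes shadowless
(`IsSolution.torso`). Hence it suffices to list few sets `Z`, one of which fits some solution.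

The solution to aim at is `X = boundary G B`, where `B` is a maximal set disjoint from `W` whose
boundary is a solution (`IsYes.exists_isExtremal`). Its shadow lies in `B \ X`, and in the network
with split vertices `B` is an important set: every admissible larger set has a larger cut. For a set
`U` of vertices, let `Z` consist of the vertices inside an important set of cut at most `k` whose
boundary lies in `U` (`Covered`). If `U` contains `X`, then `Z` contains `B \ X`. To keep a vertex
`x` of `X` out of `Z`, it is enough that `U` avoids a certain set of at most `k + 1` vertices
outside `X` (`exists_hitting`); there is no need to treat the exponentially many important cuts
around `x` one by one. So `U` has to contain the at most `k` vertices of `X` and to avoid at most `k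
* (k + 1)` others.

A suitable `U` is found among the unions of at most `k` colour classes of a short list of
colourings. These are made greedily, by the method of conditional expectations: with `q = 4 * p + 1`
colours and `q * m` colourings, `n < 2 ^ m`, every pair of vertices collides in fewer than `4 * m`
colourings, so some colouring separates any `p` given pairs (`exists_separating`). Here `p` is cubic
in `k`, and the number of sets `U` is `q * m * q ^ k`.

Whether a vertex is covered is decided by augmenting paths: the largest minimum cut around it is
computed, and whenever a vertex outside `U` lies on its boundary, that vertex is pulled inside; this
stops after `2 * k + 2` steps (`covered_iff`). The programs are not written out by hand: closure
properties of the computable functions over a context (`View`) build them together with time bounds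
polynomial in `max k 2 ^ k * (n + 2)`. -/

/-! ### Verified programs for the random access machine -/

namespace RAM

/-- The state in which register `r` holds `a`. -/
def State.set (s : State) (r a : ℕ) : State := { s with reg := Function.update s.reg r a }

/-- The state in which memory cell `i` holds `a`. -/
def State.put (s : State) (i a : ℕ) : State := { s with mem := Function.update s.mem i a }

@[simp] theorem State.set_reg_same (s : State) (r a : ℕ) : (s.set r a).reg r = a := by
  simp [State.set]

theorem State.set_reg (s : State) (r a r' : ℕ) :
    (s.set r a).reg r' = if r' = r then a else s.reg r' := by
  simp [State.set, Function.update_apply]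

@[simp] theorem State.set_mem (s : State) (r a : ℕ) : (s.set r a).mem = s.mem := rfl
@[simp] theorem State.set_out (s : State) (r a : ℕ) : (s.set r a).out = s.out := rfl
@[simp] theorem State.put_reg (s : State) (r a : ℕ) : (s.put r a).reg = s.reg := rfl
@[simp] theorem State.put_out (s : State) (r a : ℕ) : (s.put r a).out = s.out := rfl

theorem State.put_mem (s : State) (i a j : ℕ) :
    (s.put i a).mem j = if j = i then a else s.mem j := by
  simp [State.put, Function.update_apply]

theorem runs_const (x a : ℕ) (s : State) : Runs (.const x a) s 1 (s.set x a) := .const x a s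
theorem runs_add (x y z : ℕ) (s : State) :
    Runs (.add x y z) s 1 (s.set x (s.reg y + s.reg z)) := .add x y z s
theorem runs_sub (x y z : ℕ) (s : State) :
    Runs (.sub x y z) s 1 (s.set x (s.reg y - s.reg z)) := .sub x y z s
theorem runs_load (x y : ℕ) (s : State) :
    Runs (.load x y) s 1 (s.set x (s.mem (s.reg y))) := .load x y s
theorem runs_store (x y : ℕ) (s : State) :
    Runs (.store x y) s 1 (s.put (s.reg x) (s.reg y)) := .store x y s

/-- `x := y`, for `x ≠ y`. -/
def copy (x y : ℕ) : Program := .seq (.const x 0) (.add x x y)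

theorem runs_copy {x y : ℕ} (h : x ≠ y) (s : State) :
    Runs (copy x y) s 2 (s.set x (s.reg y)) := by
  have := (runs_const x 0 s).seq (runs_add x x y (s.set x 0))
  rw [State.set_reg_same, State.set_reg, if_neg h.symm, zero_add] at this
  simpa [State.set, copy] using this

/-- A loop that decreases towards the end of an invariant. -/
theorem loop_rule {c : ℕ} {P : Program} {Inv : ℕ → State → Prop} {N T : ℕ}
    (h : ∀ i < N, ∀ s, Inv i s →
      s.reg c ≠ 0 ∧ ∃ t ≤ T, ∃ s', Runs P s t s' ∧ Inv (i + 1) s')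
    (hN : ∀ s, Inv N s → s.reg c = 0) (s : State) (hs : Inv 0 s) :
    ∃ t ≤ N * (T + 1) + 1, ∃ s', Runs (.loop c P) s t s' ∧ Inv N s' := by
  suffices H : ∀ m i s, i + m = N → Inv i s →
      ∃ t ≤ m * (T + 1) + 1, ∃ s', Runs (.loop c P) s t s' ∧ Inv N s' from
    H N 0 s (by simp) hs
  intro m
  induction m with
  | zero =>
    intro i s hi hs
    obtain rfl : i = N := by simpa using hi
    exact ⟨1, by simp, s, .loop_false (hN s hs), hs⟩
  | succ m ih =>
    intro i s hi hs
    obtain ⟨h0, t, ht, s', hr, hs'⟩ := h i (by omega) s hs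
    obtain ⟨t', ht', s'', hr', hs''⟩ := ih (i + 1) s' (by omega) hs'
    refine ⟨t + 1 + t', ?_, s'', .loop_true h0 hr hr', hs''⟩
    rw [Nat.succ_mul]
    omega

/-- The changes that a subprogram is allowed to make: to the registers from `fr` on, to the
memory from the stack pointer (register `0`) on, and increasing the stack pointer. -/
structure Agree (fr : ℕ) (s s' : State) : Prop where
  reg : ∀ r, r ≠ 0 → r < fr → s'.reg r = s.reg r
  sp : s.reg 0 ≤ s'.reg 0
  mem : ∀ a, a < s.reg 0 → s'.mem a = s.mem a

theorem Agree.refl (fr : ℕ) (s : State) : Agree fr s s := ⟨fun _ _ _ => rfl, le_rfl, fun _ _ => rfl⟩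

theorem Agree.trans {fr : ℕ} {s s' s'' : State} (h : Agree fr s s') (h' : Agree fr s' s'') :
    Agree fr s s'' :=
  ⟨fun r h0 hr => (h'.reg r h0 hr).trans (h.reg r h0 hr), h.sp.trans h'.sp,
    fun a ha => (h'.mem a (ha.trans_le h.sp)).trans (h.mem a ha)⟩

theorem Agree.mono {fr fr' : ℕ} {s s' : State} (h : Agree fr' s s') (hf : fr ≤ fr') :
    Agree fr s s' :=
  ⟨fun r h0 hr => h.reg r h0 (hr.trans_le hf), h.sp, h.mem⟩

theorem Agree.set {fr r : ℕ} (hr : fr ≤ r) (h0 : 0 < fr) (s : State) (a : ℕ) :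
    Agree fr s (s.set r a) := by
  refine ⟨fun r' _ h' => ?_, ?_, fun _ _ => rfl⟩
  · rw [State.set_reg, if_neg (by omega)]
  · rw [State.set_reg, if_neg (by omega)]

theorem Agree.set_right {fr r : ℕ} {s s' : State} (h : Agree fr s s') (hr : fr ≤ r) (h0 : 0 < fr)
    (a : ℕ) : Agree fr s (s'.set r a) := h.trans (.set hr h0 s' a)

theorem Agree.put_right {fr i : ℕ} {s s' : State} (h : Agree fr s s') (hi : s.reg 0 ≤ i)
    (a : ℕ) : Agree fr s (s'.put i a) := by
  refine ⟨h.reg, h.sp, fun b hb => ?_⟩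
  rw [State.put_mem, if_neg (by omega), h.mem b hb]

/-- The registers `r`, `r + 1`, `r + 2` describe the base, the number of rows and the number of
columns of a matrix that stands in the memory below the stack pointer and has the entries `A`;
beyond its dimensions, `A` is `0`. -/
structure ArrAt (s : State) (r : ℕ) (A : ℕ → ℕ → ℕ) : Prop where
  top : s.reg r + s.reg (r + 1) * s.reg (r + 2) ≤ s.reg 0
  val : ∀ i j, i < s.reg (r + 1) → j < s.reg (r + 2) →
    s.mem (s.reg r + (i * s.reg (r + 2) + j)) = A i j
  zero : ∀ i j, ¬(i < s.reg (r + 1) ∧ j < s.reg (r + 2)) → A i j = 0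

theorem index_lt {i j m n : ℕ} (hi : i < m) (hj : j < n) : i * n + j < m * n := by
  calc i * n + j < i * n + n := by omega
    _ = (i + 1) * n := by ring
    _ ≤ m * n := Nat.mul_le_mul_right _ hi

theorem ArrAt.congr {s s' : State} {r r' : ℕ} {A : ℕ → ℕ → ℕ} (h : ArrAt s r A)
    (h0 : s'.reg r' = s.reg r) (h1 : s'.reg (r' + 1) = s.reg (r + 1))
    (h2 : s'.reg (r' + 2) = s.reg (r + 2)) (sp : s.reg 0 ≤ s'.reg 0)
    (mem : ∀ a, a < s.reg 0 → s'.mem a = s.mem a) : ArrAt s' r' A := by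
  refine ⟨?_, ?_, ?_⟩
  · rw [h0, h1, h2]; exact h.top.trans sp
  · intro i j hi hj
    rw [h1] at hi
    rw [h2] at hj
    rw [h0, h2, mem _ (lt_of_lt_of_le (by have := index_lt hi hj; omega) h.top), h.val i j hi hj]
  · rw [h1, h2]; exact h.zero

/-- The matrix lies below the stack pointer and its description below `fr`, which a subprogram
leaves alone. -/
theorem ArrAt.agree {fr : ℕ} {s s' : State} {r : ℕ} {A : ℕ → ℕ → ℕ} (h : ArrAt s r A)
    (ha : Agree fr s s') (h0 : r ≠ 0) (hr : r + 3 ≤ fr) : ArrAt s' r A :=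
  h.congr (ha.reg _ h0 (by omega)) (ha.reg _ (by omega) (by omega))
    (ha.reg _ (by omega) (by omega)) ha.sp ha.mem

/-- A context: how the elements of `Γ` (tuples of numbers and matrices) are represented in the
registers below `fr` and in the memory, and the quantity `scale` in which running times are
measured. -/
structure View (Γ : Type) where
  rel : Γ → State → Prop
  fr : ℕ
  pos : 0 < fr
  scale : Γ → ℕ
  two_le : ∀ γ, 2 ≤ scale γ
  frame : ∀ γ s s', rel γ s → Agree fr s s' → rel γ s'

/-! ### Contexts and polynomial-time computations in them -/

variable {Γ : Type}

namespace View

/-- `N` is polynomially bounded. -/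
def Bd (v : View Γ) (N : Γ → ℕ) : Prop := ∃ c, ∀ γ s, v.rel γ s → N γ ≤ v.scale γ ^ c

/-- The exponent `m` serves because `m < 2 ^ m` and the scale is at least `2`. -/
theorem Bd.const {v : View Γ} (m : ℕ) : v.Bd fun _ => m :=
  ⟨m, fun γ _ _ => (Nat.lt_pow_self (v.two_le γ)).le⟩

theorem Bd.pow_scale {v : View Γ} (c : ℕ) : v.Bd fun γ => v.scale γ ^ c := ⟨c, fun _ _ _ => le_rfl⟩

theorem Bd.mono {v : View Γ} {N N' : Γ → ℕ} (h : v.Bd N) (h' : ∀ γ, N' γ ≤ N γ) : v.Bd N' :=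
  let ⟨c, hc⟩ := h
  ⟨c, fun γ s hs => (h' γ).trans (hc γ s hs)⟩

theorem Bd.mul {v : View Γ} {N N' : Γ → ℕ} (h : v.Bd N) (h' : v.Bd N') :
    v.Bd fun γ => N γ * N' γ := by
  obtain ⟨c, hc⟩ := h
  obtain ⟨c', hc'⟩ := h'
  refine ⟨c + c', fun γ s hs => ?_⟩
  rw [pow_add]
  exact Nat.mul_le_mul (hc γ s hs) (hc' γ s hs)

theorem Bd.add {v : View Γ} {N N' : Γ → ℕ} (h : v.Bd N) (h' : v.Bd N') :
    v.Bd fun γ => N γ + N' γ := by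
  obtain ⟨c, hc⟩ := h
  obtain ⟨c', hc'⟩ := h'
  refine ⟨c + c' + 1, fun γ s hs => ?_⟩
  -- The additional `1` in the exponent absorbs the factor `2` of the sum.
  have h2 := v.two_le γ
  have h3 := hc γ s hs
  have h4 := hc' γ s hs
  have h5 : v.scale γ ^ c ≤ v.scale γ ^ (c + c') := Nat.pow_le_pow_right (by omega) (by omega)
  have h6 : v.scale γ ^ c' ≤ v.scale γ ^ (c + c') := Nat.pow_le_pow_right (by omega) (by omega)
  calc N γ + N' γ ≤ v.scale γ ^ (c + c') * 2 := by omega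
    _ ≤ _ := by rw [pow_succ]; exact Nat.mul_le_mul_left _ h2

theorem Bd.pow {v : View Γ} {N : Γ → ℕ} (h : v.Bd N) (m : ℕ) : v.Bd fun γ => N γ ^ m := by
  obtain ⟨c, hc⟩ := h
  refine ⟨c * m, fun γ s hs => ?_⟩
  rw [pow_mul]
  exact Nat.pow_le_pow_left (hc γ s hs) m

/-- The context extended by a number in register `r`. -/
def num (v : View Γ) (r : ℕ) (hr : v.fr ≤ r) : View (Γ × ℕ) where
  rel p s := v.rel p.1 s ∧ s.reg r = p.2
  fr := r + 1
  pos := by omega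
  scale p := v.scale p.1
  two_le p := v.two_le p.1
  frame := by
    have := v.pos
    exact fun p s s' h ha => ⟨v.frame _ _ _ h.1 (ha.mono (by omega)),
      (ha.reg r (by omega) (by omega)).trans h.2⟩

/-- The context extended by a matrix with `R` rows and `C` columns, described in the registers
`r`, `r + 1`, `r + 2`. -/
def arr (v : View Γ) (R C : Γ → ℕ) (r : ℕ) (hr : v.fr ≤ r) : View (Γ × (ℕ → ℕ → ℕ)) where
  rel p s := v.rel p.1 s ∧ ArrAt s r p.2 ∧ s.reg (r + 1) = R p.1 ∧ s.reg (r + 2) = C p.1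
  fr := r + 3
  pos := by omega
  scale p := v.scale p.1
  two_le p := v.two_le p.1
  frame := by
    have := v.pos
    exact fun p s s' h ha => ⟨v.frame _ _ _ h.1 (ha.mono (by omega)),
      h.2.1.agree ha (by omega) (by omega), (ha.reg _ (by omega) (by omega)).trans h.2.2.1,
      (ha.reg _ (by omega) (by omega)).trans h.2.2.2⟩

theorem Bd.num {v : View Γ} {N : Γ → ℕ} (h : v.Bd N) {r : ℕ} {hr : v.fr ≤ r} :
    (v.num r hr).Bd fun p => N p.1 :=
  let ⟨c, hc⟩ := h
  ⟨c, fun p s hs => hc p.1 s hs.1⟩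

theorem Bd.arr {v : View Γ} {N : Γ → ℕ} (h : v.Bd N) {R C : Γ → ℕ} {r : ℕ} {hr : v.fr ≤ r} :
    (v.arr R C r hr).Bd fun p => N p.1 :=
  let ⟨c, hc⟩ := h
  ⟨c, fun p s hs => hc p.1 s hs.1⟩

/-- There is a program that leads in polynomial time from every state that represents an element
of the context to a state as described by `Q`, without affecting the context. -/
def Does (v : View Γ) (fr : ℕ) (Q : Γ → State → State → Prop) : Prop :=
  ∃ T, v.Bd T ∧ ∃ p, ∀ γ s, v.rel γ s →
    ∃ t ≤ T γ, ∃ s', Runs p s t s' ∧ Agree fr s s' ∧ Q γ s s'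

/-- The second program also sees the original state `s₀`, so that its postcondition can compare the
final output with the original one. The context still holds at that point, by `View.frame`. -/
theorem Does.seq {v : View Γ} {fr : ℕ} (hf : v.fr ≤ fr) {Q Q' : Γ → State → State → Prop}
    (h : v.Does fr Q) (h' : ∃ T, v.Bd T ∧ ∃ p, ∀ γ s₀ s, v.rel γ s₀ → v.rel γ s →
      Agree fr s₀ s → Q γ s₀ s → ∃ t ≤ T γ, ∃ s', Runs p s t s' ∧ Agree fr s s' ∧ Q' γ s₀ s') :
    v.Does fr Q' := by
  obtain ⟨T, hT, p, hp⟩ := h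
  obtain ⟨T', hT', p', hp'⟩ := h'
  refine ⟨_, hT.add hT', .seq p p', fun γ s hs => ?_⟩
  obtain ⟨t, ht, s', hr, ha, hq⟩ := hp γ s hs
  obtain ⟨t', ht', s'', hr', ha', hq'⟩ :=
    hp' γ s s' hs (v.frame _ _ _ hs (ha.mono hf)) ha hq
  exact ⟨t + t', add_le_add ht ht', s'', hr.seq hr', ha.trans ha', hq'⟩

/-- The number `f γ` can be computed in polynomial time. -/
def Comp (v : View Γ) (f : Γ → ℕ) : Prop :=
  ∀ fr, v.fr ≤ fr → v.Does fr fun γ s s' => s'.reg fr = f γ ∧ s'.out = s.out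

/-- The matrix `A γ` with `R γ` rows and `C γ` columns can be computed in polynomial time. -/
def Tab (v : View Γ) (R C : Γ → ℕ) (A : Γ → ℕ → ℕ → ℕ) : Prop :=
  ∀ fr, v.fr ≤ fr → v.Does fr fun γ s s' =>
    (ArrAt s' fr (A γ) ∧ s'.reg (fr + 1) = R γ ∧ s'.reg (fr + 2) = C γ) ∧ s'.out = s.out

/-- The list `g γ` can be put out in polynomial time. -/
def Emit (v : View Γ) (g : Γ → List ℕ) : Prop :=
  ∀ fr, v.fr ≤ fr → v.Does fr fun γ s s' => s'.out = s.out ++ g γ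

/-- The matrix `A γ` is part of the context. -/
def Var (v : View Γ) (A : Γ → ℕ → ℕ → ℕ) : Prop :=
  ∃ r, r ≠ 0 ∧ r + 3 ≤ v.fr ∧ ∃ R, v.Bd R ∧ ∀ γ s, v.rel γ s → ArrAt s r (A γ) ∧ s.reg (r + 1) ≤ R γ

theorem Var.num {v : View Γ} {A : Γ → ℕ → ℕ → ℕ} (h : v.Var A) {r : ℕ} {hr : v.fr ≤ r} :
    (v.num r hr).Var fun p => A p.1 := by
  obtain ⟨r', h0, h1, R, hR, h2⟩ := h
  exact ⟨r', h0, by simp only [View.num]; omega, _, hR.num, fun p s hs => h2 p.1 s hs.1⟩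

theorem Var.arr {v : View Γ} {A : Γ → ℕ → ℕ → ℕ} (h : v.Var A) {R C : Γ → ℕ} {r : ℕ}
    {hr : v.fr ≤ r} : (v.arr R C r hr).Var fun p => A p.1 := by
  obtain ⟨r', h0, h1, R, hR, h2⟩ := h
  exact ⟨r', h0, by simp only [View.arr]; omega, _, hR.arr, fun p s hs => h2 p.1 s hs.1⟩

theorem Var.last {v : View Γ} {R C : Γ → ℕ} (hR : v.Bd R) {r : ℕ} {hr : v.fr ≤ r} :
    (v.arr R C r hr).Var fun p => p.2 := by
  have := v.pos
  exact ⟨r, by omega, le_rfl, _, hR.arr, fun p s hs => ⟨hs.2.1, hs.2.2.1.le⟩⟩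

theorem Comp.num {v : View Γ} {f : Γ → ℕ} (h : v.Comp f) {r : ℕ} {hr : v.fr ≤ r} :
    (v.num r hr).Comp fun p => f p.1 := by
  intro fr hfr
  obtain ⟨T, hT, p, hp⟩ := h fr (by simp only [View.num] at hfr; omega)
  exact ⟨_, hT.num, p, fun p s hs => hp p.1 s hs.1⟩

theorem Comp.arr {v : View Γ} {f : Γ → ℕ} (h : v.Comp f) {R C : Γ → ℕ} {r : ℕ} {hr : v.fr ≤ r} :
    (v.arr R C r hr).Comp fun p => f p.1 := by
  intro fr hfr
  obtain ⟨T, hT, p, hp⟩ := h fr (by simp only [View.arr] at hfr; omega)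
  exact ⟨_, hT.arr, p, fun p s hs => hp p.1 s hs.1⟩

theorem Comp.last {v : View Γ} {r : ℕ} {hr : v.fr ≤ r} : (v.num r hr).Comp fun p => p.2 := by
  intro fr hfr
  have := v.pos
  simp only [View.num] at hfr
  refine ⟨_, Bd.const 2, copy fr r, fun p s hs => ⟨2, le_rfl, _, runs_copy (by omega) s,
    .set le_rfl (by omega) _ _, ?_, rfl⟩⟩
  rw [State.set_reg_same, hs.2]

theorem Comp.const {v : View Γ} (m : ℕ) : v.Comp fun _ => m := fun fr hfr =>
  have := v.pos
  ⟨_, Bd.const 1, .const fr m, fun _ s _ => ⟨1, le_rfl, _, runs_const fr m s,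
    .set le_rfl (by omega) _ _, State.set_reg_same _ _ _, rfl⟩⟩

/-- Computing two numbers in consecutive registers, followed by a program. -/
theorem Comp.bind₂ {v : View Γ} {f g : Γ → ℕ} (hf : v.Comp f) (hg : v.Comp g) {fr : ℕ}
    (hfr : v.fr ≤ fr) {Q : Γ → State → State → Prop}
    (h : ∃ T, v.Bd T ∧ ∃ p, ∀ γ s₀ s, v.rel γ s₀ → v.rel γ s → Agree fr s₀ s →
      s.reg fr = f γ → s.reg (fr + 1) = g γ → s.out = s₀.out →
      ∃ t ≤ T γ, ∃ s', Runs p s t s' ∧ Agree fr s s' ∧ Q γ s₀ s') : v.Does fr Q := by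
  have := v.pos
  have h1 : v.Does fr fun γ s s' =>
      s'.reg fr = f γ ∧ s'.reg (fr + 1) = g γ ∧ s'.out = s.out := by
    refine (hf fr hfr).seq hfr ?_
    obtain ⟨T, hT, p, hp⟩ := hg (fr + 1) (by omega)
    refine ⟨T, hT, p, fun γ s₀ s _ hs _ hq => ?_⟩
    obtain ⟨t, ht, s', hr, ha, h1, h2⟩ := hp γ s hs
    exact ⟨t, ht, s', hr, ha.mono (by omega),
      (ha.reg fr (by omega) (by omega)).trans hq.1, h1, h2.trans hq.2⟩
  refine h1.seq hfr ?_
  obtain ⟨T, hT, p, hp⟩ := h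
  exact ⟨T, hT, p, fun γ s₀ s h0 hs ha hq => hp γ s₀ s h0 hs ha hq.1 hq.2.1 hq.2.2⟩

theorem Comp.add {v : View Γ} {f g : Γ → ℕ} (hf : v.Comp f) (hg : v.Comp g) :
    v.Comp fun γ => f γ + g γ := by
  intro fr hfr
  have := v.pos
  refine hf.bind₂ hg hfr ⟨_, .const 1, .add fr fr (fr + 1), fun γ s₀ s _ _ _ h1 h2 h3 =>
    ⟨1, le_rfl, _, runs_add _ _ _ s, .set le_rfl (by omega) _ _, ?_, h3⟩⟩
  simp [h1, h2]

theorem Comp.sub {v : View Γ} {f g : Γ → ℕ} (hf : v.Comp f) (hg : v.Comp g) :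
    v.Comp fun γ => f γ - g γ := by
  intro fr hfr
  have := v.pos
  refine hf.bind₂ hg hfr ⟨_, .const 1, .sub fr fr (fr + 1), fun γ s₀ s _ _ _ h1 h2 h3 =>
    ⟨1, le_rfl, _, runs_sub _ _ _ s, .set le_rfl (by omega) _ _, ?_, h3⟩⟩
  simp [h1, h2]

/-- A case distinction between two programs. -/
theorem Does.branch {v : View Γ} {f : Γ → ℕ} (hf : v.Comp f) {fr : ℕ} (hfr : v.fr ≤ fr)
    {Q Q' : Γ → State → State → Prop} (h : v.Does fr Q) (h' : v.Does fr Q')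
    (hout : ∀ γ s₀ s s', s.out = s₀.out → Q γ s s' → Q γ s₀ s')
    (hout' : ∀ γ s₀ s s', s.out = s₀.out → Q' γ s s' → Q' γ s₀ s') :
    v.Does fr fun γ s s' => if f γ ≠ 0 then Q γ s s' else Q' γ s s' := by
  refine (hf fr hfr).seq hfr ?_
  obtain ⟨T, hT, p, hp⟩ := h
  obtain ⟨T', hT', p', hp'⟩ := h'
  refine ⟨_, (hT.add hT').add (.const 1), .branch fr p p', fun γ s₀ s _ hs ha hq => ?_⟩
  by_cases h0 : f γ ≠ 0
  · obtain ⟨t, ht, s', hr, ha', h1⟩ := hp γ s hs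
    refine ⟨t + 1, by omega, s', .branch_true (by rwa [hq.1]) hr, ha', ?_⟩
    rw [if_pos h0]
    exact hout _ _ _ _ hq.2 h1
  · obtain ⟨t, ht, s', hr, ha', h1⟩ := hp' γ s hs
    refine ⟨t + 1, by omega, s', .branch_false (by rw [hq.1]; simpa using h0) hr, ha', ?_⟩
    rw [if_neg h0]
    exact hout' _ _ _ _ hq.2 h1

theorem Does.imp {v : View Γ} {fr : ℕ} {Q Q' : Γ → State → State → Prop} (h : v.Does fr Q)
    (hq : ∀ γ s s', Q γ s s' → Q' γ s s') : v.Does fr Q' := by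
  obtain ⟨T, hT, p, hp⟩ := h
  refine ⟨T, hT, p, fun γ s hs => ?_⟩
  obtain ⟨t, ht, s', hr, ha, h1⟩ := hp γ s hs
  exact ⟨t, ht, s', hr, ha, hq _ _ _ h1⟩

theorem Comp.congr {v : View Γ} {f g : Γ → ℕ} (hf : v.Comp f) (h : ∀ γ, f γ = g γ) : v.Comp g := by
  rwa [← funext h]

theorem Comp.cond {v : View Γ} {b f g : Γ → ℕ} (hb : v.Comp b) (hf : v.Comp f) (hg : v.Comp g) :
    v.Comp fun γ => if b γ ≠ 0 then f γ else g γ := by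
  intro fr hfr
  refine (Does.branch hb hfr (hf fr hfr) (hg fr hfr) ?_ ?_).imp ?_
  · exact fun γ s₀ s s' h h' => ⟨h'.1, h'.2.trans h⟩
  · exact fun γ s₀ s s' h h' => ⟨h'.1, h'.2.trans h⟩
  · intro γ s s' h
    by_cases h0 : b γ ≠ 0
    · simpa only [if_pos h0] using h
    · simpa only [if_neg h0] using h

theorem Emit.cond {v : View Γ} {b : Γ → ℕ} {f g : Γ → List ℕ} (hb : v.Comp b) (hf : v.Emit f)
    (hg : v.Emit g) : v.Emit fun γ => if b γ ≠ 0 then f γ else g γ := by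
  intro fr hfr
  refine (Does.branch hb hfr (hf fr hfr) (hg fr hfr) ?_ ?_).imp ?_
  · exact fun γ s₀ s s' h h' => by rw [h', h]
  · exact fun γ s₀ s s' h h' => by rw [h', h]
  · intro γ s s' h
    by_cases h0 : b γ ≠ 0
    · simpa only [if_pos h0] using h
    · simpa only [if_neg h0] using h

theorem Emit.write {v : View Γ} {f : Γ → ℕ} (hf : v.Comp f) : v.Emit fun γ => [f γ] := by
  intro fr hfr
  refine (hf fr hfr).seq hfr ⟨_, Bd.const 1, .write fr, fun γ s₀ s _ hs ha hq => ?_⟩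
  refine ⟨1, le_rfl, _, .write fr s, ⟨fun _ _ _ => rfl, le_rfl, fun _ _ => rfl⟩, ?_⟩
  simp [hq.1, hq.2]

theorem Emit.append {v : View Γ} {f g : Γ → List ℕ} (hf : v.Emit f) (hg : v.Emit g) :
    v.Emit fun γ => f γ ++ g γ := by
  intro fr hfr
  refine (hf fr hfr).seq hfr ?_
  obtain ⟨T, hT, p, hp⟩ := hg fr hfr
  refine ⟨T, hT, p, fun γ s₀ s _ hs _ hq => ?_⟩
  obtain ⟨t, ht, s', hr, ha, h1⟩ := hp γ s hs
  exact ⟨t, ht, s', hr, ha, by rw [h1, hq, List.append_assoc]⟩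

end View

end RAM

/-! ### Loops: sums, tables and iteration -/

namespace RAM
variable {Γ : Type}

/-- The loop that runs `P` as often as register `c` says; register `c + 1` counts up from `0`. -/
def forLoop (c : ℕ) (P : Program) : Program :=
  .seq (.const (c + 1) 0) (.loop c (.seq P (.seq
    (.const (c + 2) 1) (.seq (.add (c + 1) (c + 1) (c + 2)) (.sub c c (c + 2))))))

/-- A loop in which register `c` counts down from `N` and register `c + 1` counts up from `0`. -/
theorem for_rule {c : ℕ} {P : Program} {J : ℕ → State → Prop} {N T : ℕ}
    (hJ : ∀ i s r a, c ≤ r → r < c + 3 → J i s → J i (s.set r a))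
    (h : ∀ i < N, ∀ s, J i s → s.reg (c + 1) = i →
      ∃ t ≤ T, ∃ s', Runs P s t s' ∧ s'.reg c = s.reg c ∧ s'.reg (c + 1) = s.reg (c + 1) ∧
        J (i + 1) s')
    (s : State) (hs : J 0 s) (hN : s.reg c = N) :
    ∃ t ≤ N * (T + 4) + 2, ∃ s', Runs (forLoop c P) s t s' ∧ J N s' := by
  obtain ⟨t, ht, s', hr, hs'⟩ := loop_rule (c := c) (N := N) (T := T + 3)
    (P := .seq P (.seq (.const (c + 2) 1) (.seq (.add (c + 1) (c + 1) (c + 2)) (.sub c c (c + 2)))))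
    (Inv := fun i s => J i s ∧ s.reg c = N - i ∧ s.reg (c + 1) = i) (by
      rintro i hi s ⟨h1, h2, h3⟩
      refine ⟨by omega, ?_⟩
      obtain ⟨t, ht, s', hr, e1, e2, h4⟩ := h i hi s h1 h3
      refine ⟨t + (1 + (1 + 1)), by omega, _, hr.seq ((runs_const _ _ _).seq
        ((runs_add _ _ _ _).seq (runs_sub _ _ _ _))), ?_, ?_, ?_⟩
      · exact hJ _ _ _ _ le_rfl (by omega) (hJ _ _ _ _ (by omega) (by omega)
          (hJ _ _ _ _ (by omega) (by omega) h4))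
      · simp [State.set_reg, e1, h2]; omega
      · simp [State.set_reg, e2, h3])
    (by rintro s ⟨_, h2, _⟩; omega) (s.set (c + 1) 0)
    ⟨hJ _ _ _ _ (by omega) (by omega) hs, by simp [State.set_reg, hN], by simp⟩
  refine ⟨1 + t, ?_, s', (runs_const _ _ _).seq hr, hs'.1⟩
  have : N * (T + 3 + 1) = N * (T + 4) := rfl
  omega

/-- The state of an iteration with a counter. -/
def iter {α : Type*} (step : ℕ → α → α) (a : α) : ℕ → α
  | 0 => a
  | t + 1 => step t (iter step a t)

/-- The matrix with `R` rows and `C` columns and the entries `f i j`. -/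
def tab (R C : ℕ) (f : ℕ → ℕ → ℕ) (i j : ℕ) : ℕ := if i < R ∧ j < C then f i j else 0

theorem tab_apply {R C i j : ℕ} (f : ℕ → ℕ → ℕ) (hi : i < R) (hj : j < C) :
    tab R C f i j = f i j := if_pos ⟨hi, hj⟩

namespace View

/-- The basic loop, to which multiplication, bounded quantifiers, minimization and division are
reduced. The summation index does not enter the scale, so a single power of the scale bounds the
time of all rounds. -/
theorem Comp.sum {v : View Γ} {N : Γ → ℕ} {f : Γ → ℕ → ℕ} (hN : v.Comp N) (hb : v.Bd N)
    (hf : ∀ r hr, (v.num r hr).Comp fun p => f p.1 p.2) :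
    v.Comp fun γ => ∑ i ∈ Finset.range (N γ), f γ i := by
  intro fr hfr
  have := v.pos
  refine (hN fr hfr).seq hfr ?_
  -- Registers: `fr` counts down, `fr + 1` is the index, `fr + 2` holds the constant one of
  -- `forLoop`, `fr + 3` accumulates, and the summand appears in `fr + 4`.
  obtain ⟨T, ⟨e, he⟩, p, hp⟩ := hf (fr + 1) (by omega) (fr + 4) (by simp only [View.num]; omega)
  refine ⟨_, (Bd.const 1).add (((hb.mul ((Bd.pow_scale e).add (.const 5))).add (.const 2)).add
    (.const 2)), .seq (.const (fr + 3) 0) (.seq (forLoop fr (.seq p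
      (.add (fr + 3) (fr + 3) (fr + 4))))
      (copy fr (fr + 3))), fun γ s₀ s _ hs ha hq => ?_⟩
  obtain ⟨t, ht, s', hr, h1, h2, h3⟩ := for_rule (c := fr) (N := N γ)
    (T := v.scale γ ^ e + 1) (P := .seq p (.add (fr + 3) (fr + 3) (fr + 4)))
    (J := fun i s' => Agree fr s s' ∧ s'.reg (fr + 3) = ∑ j ∈ Finset.range i, f γ j ∧
      s'.out = s.out)
    (by
      rintro i s' r a h1 h2 ⟨h3, h4, h5⟩
      exact ⟨h3.set_right h1 (by omega) a, by rw [State.set_reg, if_neg (by omega), h4], h5⟩)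
    (by
      rintro i hi s' ⟨h1, h2, h3⟩ h4
      have hrel : (v.num (fr + 1) (by omega)).rel (γ, i) s' := ⟨v.frame _ _ _ hs (h1.mono hfr), h4⟩
      obtain ⟨t, ht, s'', hr, ha', h5, h6⟩ := hp (γ, i) s' hrel
      refine ⟨t + 1, by have := ht.trans (he _ _ hrel); simp only [View.num] at this; omega,
        _, hr.seq (runs_add _ _ _ _), ?_, ?_, ?_, ?_, ?_⟩
      · rw [State.set_reg, if_neg (by omega), ha'.reg _ (by omega) (by omega)]
      · rw [State.set_reg, if_neg (by omega), ha'.reg _ (by omega) (by omega)]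
      · exact (h1.trans (ha'.mono (by omega))).set_right (by omega) (by omega) _
      · rw [State.set_reg_same, ha'.reg _ (by omega) (by omega), h2, h5, Finset.sum_range_succ]
      · exact h6.trans h3)
    (s.set (fr + 3) 0) ⟨.set (by omega) (by omega) _ _, by simp, rfl⟩
    (by rw [State.set_reg, if_neg (by omega), hq.1])
  have hT : N γ * (v.scale γ ^ e + 1 + 4) = N γ * (v.scale γ ^ e + 5) := rfl
  refine ⟨1 + (t + 2), by omega, _,
    (runs_const _ _ _).seq (hr.seq (runs_copy (by omega) _)), ?_, ?_, ?_⟩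
  · exact h1.set_right le_rfl (by omega) _
  · rw [State.set_reg_same, h2]
  · exact h3.trans hq.2

theorem Emit.for {v : View Γ} {N : Γ → ℕ} {g : Γ → ℕ → List ℕ} (hN : v.Comp N) (hb : v.Bd N)
    (hg : ∀ r hr, (v.num r hr).Emit fun p => g p.1 p.2) :
    v.Emit fun γ => (List.range (N γ)).flatMap (g γ) := by
  intro fr hfr
  have := v.pos
  refine (hN fr hfr).seq hfr ?_
  obtain ⟨T, ⟨e, he⟩, p, hp⟩ := hg (fr + 1) (by omega) (fr + 3) (by simp only [View.num]; omega)
  refine ⟨_, (hb.mul ((Bd.pow_scale e).add (.const 4))).add (.const 2), forLoop fr p,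
    fun γ s₀ s _ hs ha hq => ?_⟩
  obtain ⟨t, ht, s', hr, h1, h2⟩ := for_rule (c := fr) (N := N γ)
    (T := v.scale γ ^ e) (P := p)
    (J := fun i s' => Agree fr s s' ∧ s'.out = s.out ++ (List.range i).flatMap (g γ))
    (by
      rintro i s' r a h1 h2 ⟨h3, h4⟩
      exact ⟨h3.set_right h1 (by omega) a, h4⟩)
    (by
      rintro i hi s' ⟨h1, h2⟩ h4
      have hrel : (v.num (fr + 1) (by omega)).rel (γ, i) s' := ⟨v.frame _ _ _ hs (h1.mono hfr), h4⟩
      obtain ⟨t, ht, s'', hr, ha', h5⟩ := hp (γ, i) s' hrel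
      refine ⟨t, ht.trans (he _ _ hrel), _, hr, ?_, ?_, ?_, ?_⟩
      · rw [ha'.reg _ (by omega) (by omega)]
      · rw [ha'.reg _ (by omega) (by omega)]
      · exact h1.trans (ha'.mono (by omega))
      · simp [h5, h2, List.range_succ])
    s ⟨.refl _ _, by simp⟩ hq.1
  exact ⟨t, ht, _, hr, h1, by rw [h2, hq.2]⟩

/-- The row offset is obtained by adding the number of columns `f γ` times; this is fast because
`Var` bounds the number of rows. Indices beyond the matrix are detected by truncated subtraction and
give `0`, in agreement with `ArrAt.zero`. -/
theorem Comp.read {v : View Γ} {A : Γ → ℕ → ℕ → ℕ} {f g : Γ → ℕ} (hA : v.Var A) (hf : v.Comp f)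
    (hg : v.Comp g) : v.Comp fun γ => A γ (f γ) (g γ) := by
  intro fr hfr
  have := v.pos
  obtain ⟨r, hr0, hr, R, hR, hv⟩ := hA
  refine hf.bind₂ hg hfr ⟨_, (hR.mul (.const 3)).add (.const 10), .seq (.sub (fr + 2) (r + 1) fr)
    (.branch (fr + 2) (.seq (.sub (fr + 2) (r + 2) (fr + 1)) (.branch (fr + 2)
      (.seq (.const (fr + 2) 0) (.seq (.const (fr + 3) 1) (.seq
        (.loop fr (.seq (.add (fr + 2) (fr + 2) (r + 2)) (.sub fr fr (fr + 3))))
        (.seq (.add (fr + 2) (fr + 2) (fr + 1)) (.seq (.add (fr + 2) (fr + 2) r)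
          (.load fr (fr + 2)))))))
      (.const fr 0))) (.const fr 0)), fun γ s₀ s _ hs _ h1 h2 h3 => ?_⟩
  obtain ⟨ha, hle⟩ := hv γ s hs
  have hset : ∀ x a, Agree fr s (s.set (fr + x) a) := fun x a => .set (by omega) (by omega) _ _
  by_cases hi : f γ < s.reg (r + 1)
  swap
  · refine ⟨1 + (1 + 1), by omega, _, (runs_sub _ _ _ _).seq (.branch_false ?_
      (runs_const _ _ _)), ?_, ?_, ?_⟩
    · rw [State.set_reg_same, h1]; omega
    · exact (hset 2 _).set_right le_rfl (by omega) _
    · exact (State.set_reg_same _ _ _).trans (ha.zero _ _ (by tauto)).symm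
    · exact h3
  by_cases hj : g γ < s.reg (r + 2)
  swap
  · refine ⟨1 + ((1 + (1 + 1)) + 1), by omega, _, (runs_sub _ _ _ _).seq (.branch_true ?_
      ((runs_sub _ _ _ _).seq (.branch_false ?_ (runs_const _ _ _)))), ?_, ?_, ?_⟩
    · rw [State.set_reg_same, h1]; omega
    · simp only [State.set_reg]
      rw [if_pos trivial, if_neg (by omega), if_neg (by omega), h2]; omega
    · exact ((hset 2 _).set_right (by omega) (by omega) _).set_right le_rfl (by omega) _
    · exact (State.set_reg_same _ _ _).trans (ha.zero _ _ (by tauto)).symm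
    · exact h3
  set s1 := s.set (fr + 2) (s.reg (r + 1) - s.reg fr) with hs1
  set s2 := s1.set (fr + 2) (s1.reg (r + 2) - s1.reg (fr + 1)) with hs2
  set s3 := (s2.set (fr + 2) 0).set (fr + 3) 1 with hs3
  have a3 : Agree fr s s3 := (((hset 2 _).set_right (by omega) (by omega) _).set_right (by omega)
    (by omega) _).set_right (by omega) (by omega) _
  obtain ⟨t, ht, s', hrun, h5, h6, h7, h8, h9, h10⟩ := loop_rule (c := fr) (N := f γ) (T := 2)
    (P := .seq (.add (fr + 2) (fr + 2) (r + 2)) (.sub fr fr (fr + 3)))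
    (Inv := fun i s' => Agree fr s s' ∧ s'.reg fr = f γ - i ∧ s'.reg (fr + 2) = i * s.reg (r + 2) ∧
      s'.reg (fr + 1) = g γ ∧ s'.reg (fr + 3) = 1 ∧ s'.out = s₀.out)
    (by
      rintro i hi s' ⟨h5, h6, h7, h8, h9, h10⟩
      refine ⟨by omega, 1 + 1, le_rfl, _, (runs_add _ _ _ _).seq (runs_sub _ _ _ _),
        (h5.set_right (by omega) (by omega) _).set_right le_rfl (by omega) _, ?_, ?_, ?_, ?_, h10⟩
      · simp [State.set_reg, h6, h9]; omega
      · simp [State.set_reg, h7, h5.reg (r + 2) (by omega) (by omega), Nat.succ_mul]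
      · simp [State.set_reg, h8]
      · simp [State.set_reg, h9])
    (by rintro s' ⟨_, h6, _⟩; omega) s3
    ⟨a3, by simp [hs3, hs2, hs1, State.set_reg, h1], by simp [hs3, hs2, hs1, State.set_reg],
      by simp [hs3, hs2, hs1, State.set_reg, h2], by simp [hs3], by simpa [hs3, hs2, hs1] using h3⟩
  refine ⟨1 + ((1 + ((1 + (1 + (t + (1 + (1 + 1))))) + 1)) + 1), ?_, _, (runs_sub _ _ _ _).seq
    (.branch_true ?_ ((runs_sub _ _ _ _).seq (.branch_true ?_ ((runs_const _ _ _).seq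
    ((runs_const _ _ _).seq (hrun.seq ((runs_add _ _ _ _).seq ((runs_add _ _ _ _).seq
      (runs_load _ _ _))))))))), ?_, ?_, ?_⟩
  · have : f γ * 3 ≤ R γ * 3 := by omega
    omega
  · rw [State.set_reg_same, h1]; omega
  · simp only [State.set_reg]
    rw [if_pos trivial, if_neg (by omega), if_neg (by omega), h2]; omega
  · exact ((h5.set_right (by omega) (by omega) _).set_right (by omega) (by omega) _).set_right
      le_rfl (by omega) _
  · have e1 : s'.reg r = s.reg r := h5.reg r hr0 (by omega)
    rw [State.set_reg_same]
    refine Eq.trans ?_ (ha.val _ _ hi hj)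
    have e2 : r ≠ fr + 2 := by omega
    simp only [State.set_reg, State.set_mem, if_true, if_neg e2, e1, h7, h8]
    rw [add_comm (f γ * s.reg (r + 2) + g γ)]
    refine h5.mem _ (lt_of_lt_of_le ?_ ha.top)
    have := index_lt hi hj
    omega
  · exact h10

theorem Comp.mul {v : View Γ} {f g : Γ → ℕ} (hf : v.Comp f) (hb : v.Bd f) (hg : v.Comp g) :
    v.Comp fun γ => f γ * g γ :=
  (Comp.sum (f := fun γ _ => g γ) hf hb fun _ _ => hg.num).congr fun γ => by simp

/-- Room for the whole matrix is reserved by raising the stack pointer before any entry is computed.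
The programs for the entries may allocate memory themselves, but only above it. -/
theorem Tab.tab {v : View Γ} {R C : Γ → ℕ} {f : Γ → ℕ → ℕ → ℕ} (hR : v.Comp R) (bR : v.Bd R)
    (hC : v.Comp C) (bC : v.Bd C)
    (hf : ∀ r hr r' hr', ((v.num r hr).num r' hr').Comp fun p => f p.1.1 p.1.2 p.2) :
    v.Tab R C fun γ => tab (R γ) (C γ) (f γ) := by
  intro fr hfr
  have := v.pos
  have h1 : v.Does fr fun γ s s' => s'.reg (fr + 1) = R γ ∧ s'.reg (fr + 2) = C γ ∧
      s'.reg (fr + 3) = R γ * C γ ∧ s'.out = s.out := by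
    have h : v.Does fr fun γ s s' => s'.reg (fr + 1) = R γ ∧ s'.reg (fr + 2) = C γ ∧
        s'.out = s.out := by
      obtain ⟨T, hT, p, hp⟩ := hR.bind₂ hC (fr := fr + 1) (by omega)
        (Q := fun γ s s' => s'.reg (fr + 1) = R γ ∧ s'.reg (fr + 2) = C γ ∧ s'.out = s.out)
        ⟨_, .const 1, .skip, fun γ s₀ s _ _ _ e1 e2 e3 => ⟨1, le_rfl, s, .skip s, .refl _ _, e1, e2,
          e3⟩⟩
      refine ⟨T, hT, p, fun γ s hs => ?_⟩
      obtain ⟨t, ht, s', hr, ha, hq⟩ := hp γ s hs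
      exact ⟨t, ht, s', hr, ha.mono (by omega), hq⟩
    refine h.seq hfr ?_
    obtain ⟨T, hT, p, hp⟩ := (hR.mul bR hC) (fr + 3) (by omega)
    refine ⟨T, hT, p, fun γ s₀ s _ hs _ hq => ?_⟩
    obtain ⟨t, ht, s', hr, ha, e1, e2⟩ := hp γ s hs
    exact ⟨t, ht, s', hr, ha.mono (by omega), (ha.reg _ (by omega) (by omega)).trans hq.1,
      (ha.reg _ (by omega) (by omega)).trans hq.2.1, e1, e2.trans hq.2.2⟩
  refine h1.seq hfr ?_
  -- Registers: `fr`, `fr + 1`, `fr + 2` describe the matrix, `fr + 3` is the writing position, `fr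
  -- + 5` the row and `fr + 8` the column that the two loops count, and the entry appears in `fr +
  -- 10`.
  obtain ⟨T, ⟨e, he⟩, p, hp⟩ := hf (fr + 5) (by omega) (fr + 8) (by simp only [View.num]; omega)
    (fr + 10) (by simp only [View.num]; omega)
  -- the inner loop
  let inner : Program := forLoop (fr + 7) (.seq p (.seq (.store (fr + 3) (fr + 10))
    (.seq (.const (fr + 10) 1) (.add (fr + 3) (fr + 3) (fr + 10)))))
  let outer : Program := forLoop (fr + 4) (.seq (copy (fr + 7) (fr + 2)) inner)
  refine ⟨_, (bR.mul ((bC.mul ((Bd.pow_scale e).add (.const 7))).add (.const 8))).add (.const 9),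
    .seq (copy fr 0) (.seq (.add 0 0 (fr + 3)) (.seq (copy (fr + 3) fr)
      (.seq (copy (fr + 4) (fr + 1)) outer))), fun γ s₀ s _ hs ha hq => ?_⟩
  obtain ⟨q1, q2, q3, q4⟩ := hq
  set b := s.reg 0 with hb
  let F : ℕ → ℕ := fun m => f γ (m / C γ) (m % C γ)
  -- The first `m` cells, in row-major order, have been filled.
  let K : ℕ → State → Prop := fun m s' => (Agree fr s s' ∧ s'.reg fr = b ∧ s'.reg (fr + 1) = R γ ∧
    s'.reg (fr + 2) = C γ ∧ b + R γ * C γ ≤ s'.reg 0 ∧ s'.out = s.out) ∧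
    s'.reg (fr + 3) = b + m ∧ ∀ m' < m, s'.mem (b + m') = F m'
  have hK : ∀ m s' r a, fr + 4 ≤ r → K m s' → K m (s'.set r a) := by
    rintro m s' r a hr ⟨⟨k1, k2, k3, k4, k5, k6⟩, k7, k8⟩
    refine ⟨⟨k1.set_right (by omega) (by omega) _, ?_, ?_, ?_, ?_, k6⟩, ?_, k8⟩ <;>
      rwa [State.set_reg, if_neg (by omega)]
  have hinner : ∀ i < R γ, ∀ s', K (i * C γ) s' → s'.reg (fr + 5) = i → s'.reg (fr + 7) = C γ →
      ∃ t ≤ C γ * (v.scale γ ^ e + 3 + 4) + 2, ∃ s'', Runs inner s' t s'' ∧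
        K (i * C γ + C γ) s'' ∧ s''.reg (fr + 4) = s'.reg (fr + 4) ∧
        s''.reg (fr + 5) = s'.reg (fr + 5) := by
    intro i hi s' k0 k1 k2
    refine for_rule (c := fr + 7) (N := C γ) (T := v.scale γ ^ e + 3)
      (J := fun j s'' => K (i * C γ + j) s'' ∧ s''.reg (fr + 4) = s'.reg (fr + 4) ∧
        s''.reg (fr + 5) = s'.reg (fr + 5)) ?_ ?_ s' ⟨k0, rfl, rfl⟩ k2
    · rintro j s'' r a h1 h2 ⟨h3, h4, h5⟩
      refine ⟨hK _ _ _ _ (by omega) h3, ?_, ?_⟩ <;> rwa [State.set_reg, if_neg (by omega)]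
    · rintro j hj s'' ⟨⟨⟨l1, l2, l3, l4, l5, l6⟩, l7, l8⟩, h4, h5⟩ h6
      have hrel : ((v.num (fr + 5) (by omega)).num (fr + 8) (by simp only [View.num]; omega)).rel
        ((γ, i), j) s'' := ⟨⟨v.frame _ _ _ hs (l1.mono hfr), h5.trans k1⟩, h6⟩
      obtain ⟨t, ht, s3, hr, ha', e1, e2⟩ := hp _ _ hrel
      have ht' := ht.trans (he _ _ hrel)
      simp only [View.num] at ht'
      have er : ∀ x, x < fr + 10 → x ≠ 0 → s3.reg x = s''.reg x := fun x hx hx0 => ha'.reg x hx0 hx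
      have hlt := index_lt hi hj
      refine ⟨t + (1 + (1 + 1)), by omega, _, hr.seq ((runs_store _ _ _).seq
        ((runs_const _ _ _).seq (runs_add _ _ _ _))), ?_, ?_, ⟨⟨?_, ?_, ?_, ?_, ?_, ?_⟩, ?_, ?_⟩,
        ?_, ?_⟩
      · simp [State.set_reg, er]
      · simp [State.set_reg, er]
      · refine Agree.set_right (Agree.set_right (Agree.put_right
          (l1.trans (ha'.mono (by omega))) ?_ _) (by omega) (by omega) _) (by omega) (by omega) _
        rw [er _ (by omega) (by omega), l7]; omega
      · simp [State.set_reg, er _ (show fr < fr + 10 by omega) (by omega), l2]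
      · simp [State.set_reg, er, l3]
      · simp [State.set_reg, er, l4]
      · rw [State.set_reg, if_neg (by omega), State.set_reg, if_neg (by omega)]
        exact l5.trans ha'.sp
      · exact e2.trans l6
      · simp [State.set_reg, er, l7, add_assoc]
      · intro m' hm'
        rw [State.set_mem, State.set_mem, State.put_mem, er _ (by omega) (by omega), l7]
        split_ifs with hm
        · obtain rfl : m' = i * C γ + j := by omega
          rw [e1]
          have hpos : 0 < C γ := by omega
          simp only [F]
          rw [mul_comm i, Nat.mul_add_div hpos, Nat.div_eq_of_lt hj, Nat.mul_add_mod,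
            Nat.mod_eq_of_lt hj, add_zero]
        · rw [ha'.mem _ (by omega), l8 _ (by omega)]
      · simp [State.set_reg, er, h4]
      · simp [State.set_reg, er, h5]
  set s1 := s.set fr b with hs1
  set s2 := s1.set 0 (s1.reg 0 + s1.reg (fr + 3)) with hs2
  set s3 := s2.set (fr + 3) (s2.reg fr) with hs3
  set s4 := s3.set (fr + 4) (s3.reg (fr + 1)) with hs4
  have a2 : Agree fr s s2 := by
    refine ⟨fun r hr0 hr => ?_, ?_, fun _ _ => rfl⟩
    · rw [State.set_reg, if_neg hr0, State.set_reg, if_neg (by omega)]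
    · simp only [hs2, hs1, State.set_reg]
      rw [if_pos trivial, if_neg (by omega)]; omega
  have z1 : (0 : ℕ) ≠ fr := by omega
  have z2 : fr ≠ 0 := by omega
  have hinit : K 0 s4 := by
    refine ⟨⟨(a2.set_right (by omega) (by omega) _).set_right (by omega) (by omega) _, ?_, ?_, ?_,
      ?_, rfl⟩, ?_, by simp⟩
    · simp [hs4, hs3, hs2, hs1, State.set_reg, z2]
    · simp [hs4, hs3, hs2, hs1, State.set_reg, q1]
    · simp [hs4, hs3, hs2, hs1, State.set_reg, q2]
    · simp [hs4, hs3, hs2, hs1, State.set_reg, q3, z1]; omega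
    · simp [hs4, hs3, hs2, hs1, State.set_reg, z2]
  obtain ⟨t, ht, s', hr, hfin⟩ := for_rule (c := fr + 4) (N := R γ)
    (T := C γ * (v.scale γ ^ e + 7) + 4) (P := .seq (copy (fr + 7) (fr + 2)) inner)
    (J := fun i s' => K (i * C γ) s') (fun i s' r a h1 h2 h3 => hK _ _ _ _ h1 h3)
    (by
      intro i hi s' k h5
      obtain ⟨t, ht, s'', hr, k', e1, e2⟩ := hinner i hi (s'.set (fr + 7) (s'.reg (fr + 2)))
        (hK _ _ _ _ (by omega) k) (by simp [State.set_reg, h5]) (by simp [k.1.2.2.2.1])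
      have hT : C γ * (v.scale γ ^ e + 3 + 4) = C γ * (v.scale γ ^ e + 7) := rfl
      refine ⟨2 + t, by omega, s'', (runs_copy (by omega) _).seq hr, ?_, ?_, ?_⟩
      · simpa [State.set_reg] using e1
      · simpa [State.set_reg] using e2
      · rwa [Nat.succ_mul]) s4 (by simpa using hinit)
    (by simp [hs4, hs3, hs2, hs1, State.set_reg, q1])
  obtain ⟨⟨k1, k2, k3, k4, k5, k6⟩, -, k8⟩ := hfin
  refine ⟨2 + (1 + (2 + (2 + t))), ?_, s', (runs_copy z2 _).seq ((runs_add _ _ _ _).seq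
    ((runs_copy (by omega) _).seq ((runs_copy (by omega) _).seq hr))), k1, ⟨⟨?_, ?_, ?_⟩, k3, k4⟩,
    k6.trans q4⟩
  · have : R γ * (C γ * (v.scale γ ^ e + 7) + 4 + 4) =
      R γ * (C γ * (v.scale γ ^ e + 7) + 8) := by ring
    omega
  · rw [k2, k3, k4]; exact k5
  · intro i j hi hj
    rw [k3] at hi
    rw [k4] at hj
    have hpos : 0 < C γ := by omega
    rw [k2, k4, k8 _ (index_lt hi hj)]
    refine Eq.trans ?_ (tab_apply _ hi hj).symm
    simp only [F]
    rw [mul_comm i, Nat.mul_add_div hpos, Nat.div_eq_of_lt hj, Nat.mul_add_mod,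
      Nat.mod_eq_of_lt hj, add_zero]
  · intro i j hij
    rw [k3, k4] at hij
    exact if_neg hij

/-- Every round builds a new matrix in fresh memory; only its three describing registers are copied
back. Memory is never released, which costs nothing in this machine. -/
theorem Tab.iter {v : View Γ} {R C N : Γ → ℕ} {a : Γ → ℕ → ℕ → ℕ}
    {step : Γ → ℕ → (ℕ → ℕ → ℕ) → ℕ → ℕ → ℕ} (hN : v.Comp N) (bN : v.Bd N) (ha : v.Tab R C a)
    (hs : ∀ r hr r' hr', ((v.arr R C r hr).num r' hr').Tab (fun p => R p.1.1) (fun p => C p.1.1)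
      fun p => step p.1.1 p.2 p.1.2) :
    v.Tab R C fun γ => iter (step γ) (a γ) (N γ) := by
  intro fr hfr
  have := v.pos
  have h1 : v.Does fr fun γ s s' => ((ArrAt s' fr (a γ) ∧ s'.reg (fr + 1) = R γ ∧
      s'.reg (fr + 2) = C γ) ∧ s'.out = s.out) ∧ s'.reg (fr + 3) = N γ := by
    refine (ha fr hfr).seq hfr ?_
    obtain ⟨T, hT, p, hp⟩ := hN (fr + 3) (by omega)
    refine ⟨T, hT, p, fun γ s₀ s _ hs _ hq => ?_⟩
    obtain ⟨t, ht, s', hr, hag, e1, e2⟩ := hp γ s hs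
    exact ⟨t, ht, s', hr, hag.mono (by omega), ⟨⟨hq.1.1.agree hag (by omega) le_rfl,
      (hag.reg _ (by omega) (by omega)).trans hq.1.2.1,
      (hag.reg _ (by omega) (by omega)).trans hq.1.2.2⟩, e2.trans hq.2⟩, e1⟩
  refine h1.seq hfr ?_
  obtain ⟨T, ⟨e, he⟩, p, hp⟩ := hs fr hfr (fr + 4) (by simp only [View.arr]; omega) (fr + 6)
    (by simp only [View.num]; omega)
  refine ⟨_, (bN.mul ((Bd.pow_scale e).add (.const 10))).add (.const 2), forLoop (fr + 3)
    (.seq p (.seq (copy fr (fr + 6)) (.seq (copy (fr + 1) (fr + 7)) (copy (fr + 2) (fr + 8))))),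
    fun γ s₀ s _ hs hag hq => ?_⟩
  obtain ⟨t, ht, s', hr, k1, k2, k3, k4, k5⟩ := for_rule (c := fr + 3) (N := N γ)
    (T := v.scale γ ^ e + 6)
    (P := .seq p (.seq (copy fr (fr + 6)) (.seq (copy (fr + 1) (fr + 7)) (copy (fr + 2) (fr + 8)))))
    (J := fun i s' => Agree fr s s' ∧ ArrAt s' fr (RAM.iter (step γ) (a γ) i) ∧
      s'.reg (fr + 1) = R γ ∧ s'.reg (fr + 2) = C γ ∧ s'.out = s₀.out)
    (by
      rintro i s' r b h1 h2 ⟨k1, k2, k3, k4, k5⟩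
      refine ⟨k1.set_right (by omega) (by omega) _,
        k2.agree (Agree.set (fr := fr + 3) h1 (by omega) _ _) (by omega) le_rfl, ?_, ?_, k5⟩ <;>
      rwa [State.set_reg, if_neg (by omega)])
    (by
      rintro i hi s' ⟨k1, k2, k3, k4, k5⟩ k6
      have hrel : ((v.arr R C fr hfr).num (fr + 4) (by simp only [View.arr]; omega)).rel
        ((γ, RAM.iter (step γ) (a γ) i), i) s' :=
        ⟨⟨v.frame _ _ _ hs (k1.mono hfr), k2, k3, k4⟩, k6⟩
      obtain ⟨t, ht, s3, hr, ha', ⟨e1, e2, e3⟩, e4⟩ := hp _ _ hrel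
      have ht' := ht.trans (he _ _ hrel)
      simp only [View.num, View.arr] at ht'
      refine ⟨t + (2 + (2 + 2)), by omega, _, hr.seq ((runs_copy (by omega) _).seq
        ((runs_copy (by omega) _).seq (runs_copy (by omega) _))), ?_, ?_, ?_, ?_, ?_, ?_, ?_⟩
      · rw [State.set_reg, if_neg (by omega), State.set_reg, if_neg (by omega), State.set_reg,
          if_neg (by omega), ha'.reg _ (by omega) (by omega)]
      · rw [State.set_reg, if_neg (by omega), State.set_reg, if_neg (by omega), State.set_reg,
          if_neg (by omega), ha'.reg _ (by omega) (by omega)]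
      · exact (((k1.trans (ha'.mono (by omega))).set_right (by omega) (by omega) _).set_right
          (by omega) (by omega) _).set_right (by omega) (by omega) _
      · refine e1.congr ?_ ?_ ?_ ?_ (fun _ _ => rfl)
        · simp [State.set_reg]
        · simp [State.set_reg]
        · simp [State.set_reg]
        · rw [State.set_reg, if_neg (by omega), State.set_reg, if_neg (by omega), State.set_reg,
            if_neg (by omega)]
      · simpa [State.set_reg] using e2
      · simpa [State.set_reg] using e3
      · exact e4.trans k5) s ⟨.refl _ _, hq.1.1.1, hq.1.1.2.1, hq.1.1.2.2, hq.1.2⟩ hq.2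
  refine ⟨t, ?_, s', hr, k1, ⟨k2, k3, k4⟩, k5⟩
  simpa only [add_assoc] using ht

theorem Emit.let {v : View Γ} {R C : Γ → ℕ} {A : Γ → ℕ → ℕ → ℕ} {g : Γ → (ℕ → ℕ → ℕ) → List ℕ}
    (hA : v.Tab R C A) (hg : ∀ r hr, (v.arr R C r hr).Emit fun p => g p.1 p.2) :
    v.Emit fun γ => g γ (A γ) := by
  intro fr hfr
  refine (hA fr hfr).seq hfr ?_
  obtain ⟨T, ⟨e, he⟩, p, hp⟩ := hg fr hfr (fr + 3) le_rfl
  refine ⟨_, Bd.pow_scale e, p, fun γ s₀ s _ hs _ hq => ?_⟩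
  have hrel : (v.arr R C fr hfr).rel (γ, A γ) s := ⟨hs, hq.1⟩
  obtain ⟨t, ht, s', hr, ha, hq'⟩ := hp _ _ hrel
  exact ⟨t, ht.trans (he _ _ hrel), s', hr, ha.mono (by omega), by rw [hq', hq.2]⟩

theorem Comp.let {v : View Γ} {R C : Γ → ℕ} {A : Γ → ℕ → ℕ → ℕ} {f : Γ → (ℕ → ℕ → ℕ) → ℕ}
    (hA : v.Tab R C A) (hf : ∀ r hr, (v.arr R C r hr).Comp fun p => f p.1 p.2) :
    v.Comp fun γ => f γ (A γ) := by
  intro fr hfr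
  have := v.pos
  refine (hA fr hfr).seq hfr ?_
  obtain ⟨T, ⟨e, he⟩, p, hp⟩ := hf fr hfr (fr + 3) le_rfl
  refine ⟨_, (Bd.pow_scale e).add (.const 2), .seq p (copy fr (fr + 3)), fun γ s₀ s _ hs _ hq => ?_⟩
  have hrel : (v.arr R C fr hfr).rel (γ, A γ) s := ⟨hs, hq.1⟩
  obtain ⟨t, ht, s', hr, ha, h1, h2⟩ := hp _ _ hrel
  refine ⟨t + 2, Nat.add_le_add_right (ht.trans (he _ _ hrel)) 2, _,
    hr.seq (runs_copy (by omega) _), (ha.mono (by omega)).set_right le_rfl (by omega) _, ?_, ?_⟩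
  · rw [State.set_reg_same, h1]
  · exact h2.trans hq.2

theorem Tab.let {v : View Γ} {R C R' C' : Γ → ℕ} {A : Γ → ℕ → ℕ → ℕ}
    {B : Γ → (ℕ → ℕ → ℕ) → ℕ → ℕ → ℕ} (hA : v.Tab R C A)
    (hB : ∀ r hr, (v.arr R C r hr).Tab (fun p => R' p.1) (fun p => C' p.1) fun p => B p.1 p.2) :
    v.Tab R' C' fun γ => B γ (A γ) := by
  intro fr hfr
  have := v.pos
  refine (hA fr hfr).seq hfr ?_
  obtain ⟨T, ⟨e, he⟩, p, hp⟩ := hB fr hfr (fr + 3) le_rfl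
  refine ⟨_, (Bd.pow_scale e).add (.const 6), .seq p (.seq (copy fr (fr + 3))
    (.seq (copy (fr + 1) (fr + 4)) (copy (fr + 2) (fr + 5)))), fun γ s₀ s _ hs _ hq => ?_⟩
  have hrel : (v.arr R C fr hfr).rel (γ, A γ) s := ⟨hs, hq.1⟩
  obtain ⟨t, ht, s', hr, ha, ⟨e1, e2, e3⟩, e4⟩ := hp _ _ hrel
  refine ⟨t + (2 + (2 + 2)), Nat.add_le_add_right (ht.trans (he _ _ hrel)) 6, _,
    hr.seq ((runs_copy (by omega) _).seq ((runs_copy (by omega) _).seq (runs_copy (by omega) _))),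
    (((ha.mono (by omega)).set_right le_rfl (by omega) _).set_right (by omega) (by omega)
      _).set_right (by omega) (by omega) _, ⟨?_, ?_, ?_⟩, ?_⟩
  · refine e1.congr ?_ ?_ ?_ ?_ (fun _ _ => rfl)
    · simp [State.set_reg]
    · simp [State.set_reg]
    · simp [State.set_reg]
    · rw [State.set_reg, if_neg (by omega), State.set_reg, if_neg (by omega), State.set_reg,
        if_neg (by omega)]
  · simpa [State.set_reg] using e2
  · simpa [State.set_reg] using e3
  · exact e4.trans hq.2

end View
end RAM

/-! ### Decidable predicates, minimization, powers and division -/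

namespace RAM

/-- The truth value of a proposition as a number. -/
noncomputable def bit (p : Prop) : ℕ := by classical exact if p then 1 else 0

theorem bit_pos {p : Prop} (h : p) : bit p = 1 := by simp [bit, h]

theorem bit_neg {p : Prop} (h : ¬p) : bit p = 0 := by simp [bit, h]

@[simp] theorem bit_ne_zero {p : Prop} : bit p ≠ 0 ↔ p := by
  by_cases h : p <;> simp [bit, h]

/-- The least `b < N` with `p b`, if there is one. -/
noncomputable def least (N : ℕ) (p : ℕ → Prop) : ℕ :=
  ∑ b ∈ Finset.range N, bit (∀ b' < N, b' ≤ b → ¬p b')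

/-- A summand of `least` is `1` exactly for the `b` below the first witness, so the sum is that
witness. This form makes minimization an instance of summation. -/
theorem least_spec {N : ℕ} {p : ℕ → Prop} (h : ∃ b < N, p b) :
    least N p < N ∧ p (least N p) := by
  classical
  obtain ⟨h1, h2⟩ : Nat.find h < N ∧ p (Nat.find h) := Nat.find_spec h
  have : least N p = Nat.find h := by
    have : least N p = ∑ b ∈ Finset.range N, if b < Nat.find h then 1 else 0 := by
      refine Finset.sum_congr rfl fun b hb => ?_
      by_cases hlt : b < Nat.find h
      · rw [if_pos hlt]
        exact bit_pos fun b' hb' hle hp => Nat.find_min h (hle.trans_lt hlt) ⟨hb', hp⟩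
      · rw [if_neg hlt]
        exact bit_neg fun H => H _ h1 (not_lt.1 hlt) h2
    rw [this, Finset.sum_boole, show (Finset.range N).filter (· < Nat.find h) =
      Finset.range (Nat.find h) by
        ext; simp only [Finset.mem_filter, Finset.mem_range]; omega]
    simp
  rw [this]
  exact ⟨h1, h2⟩

variable {Γ : Type}

namespace View

/-- The truth value of `p γ` can be computed in polynomial time. -/
def Dec (v : View Γ) (p : Γ → Prop) : Prop := v.Comp fun γ => bit (p γ)

variable {v : View Γ} {p q : Γ → Prop} {f g : Γ → ℕ}

theorem Dec.congr (hp : v.Dec p) (h : ∀ γ, p γ ↔ q γ) : v.Dec q :=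
  Comp.congr hp fun γ => by rw [propext (h γ)]

theorem Comp.ne_zero (hf : v.Comp f) : v.Dec fun γ => f γ ≠ 0 :=
  (hf.cond (.const 1) (.const 0)).congr fun γ => by by_cases h : f γ = 0 <;> simp [bit, h]

theorem Comp.ite [∀ γ, Decidable (p γ)] (hp : v.Dec p) (hf : v.Comp f) (hg : v.Comp g) :
    v.Comp fun γ => if p γ then f γ else g γ :=
  (Comp.cond hp hf hg).congr fun γ => by by_cases h : p γ <;> simp [bit, h]

theorem Emit.ite [∀ γ, Decidable (p γ)] {f g : Γ → List ℕ} (hp : v.Dec p) (hf : v.Emit f)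
    (hg : v.Emit g) : v.Emit fun γ => if p γ then f γ else g γ := by
  have := Emit.cond hp hf hg
  simpa only [bit_ne_zero] using this

theorem Dec.not (hp : v.Dec p) : v.Dec fun γ => ¬p γ :=
  (Comp.cond hp (.const 0) (.const 1)).congr fun γ => by by_cases h : p γ <;> simp [bit, h]

theorem Dec.and (hp : v.Dec p) (hq : v.Dec q) : v.Dec fun γ => p γ ∧ q γ :=
  (Comp.cond hp hq (.const 0)).congr fun γ => by
    by_cases h : p γ <;> by_cases h' : q γ <;> simp [bit, h, h']

theorem Dec.or (hp : v.Dec p) (hq : v.Dec q) : v.Dec fun γ => p γ ∨ q γ :=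
  (Comp.cond hp (.const 1) hq).congr fun γ => by
    by_cases h : p γ <;> by_cases h' : q γ <;> simp [bit, h, h']

theorem Dec.imp (hp : v.Dec p) (hq : v.Dec q) : v.Dec fun γ => p γ → q γ :=
  (hp.not.or hq).congr fun _ => imp_iff_not_or.symm

theorem Comp.lt (hf : v.Comp f) (hg : v.Comp g) : v.Dec fun γ => f γ < g γ :=
  (hg.sub hf).ne_zero.congr fun γ => by omega

theorem Comp.le (hf : v.Comp f) (hg : v.Comp g) : v.Dec fun γ => f γ ≤ g γ :=
  (hf.sub hg).ne_zero.not.congr fun γ => by omega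

theorem Comp.eq (hf : v.Comp f) (hg : v.Comp g) : v.Dec fun γ => f γ = g γ :=
  ((hf.le hg).and (hg.le hf)).congr fun γ => by omega

theorem Dec.ex {N : Γ → ℕ} {p : Γ → ℕ → Prop} (hN : v.Comp N) (hb : v.Bd N)
    (hp : ∀ r hr, (v.num r hr).Dec fun x => p x.1 x.2) : v.Dec fun γ => ∃ i < N γ, p γ i :=
  (Comp.sum (f := fun γ i => bit (p γ i)) hN hb hp).ne_zero.congr fun γ => by
    simp [Finset.sum_eq_zero_iff]

theorem Dec.all {N : Γ → ℕ} {p : Γ → ℕ → Prop} (hN : v.Comp N) (hb : v.Bd N)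
    (hp : ∀ r hr, (v.num r hr).Dec fun x => p x.1 x.2) : v.Dec fun γ => ∀ i < N γ, p γ i :=
  (Dec.ex (p := fun γ i => ¬p γ i) hN hb fun r hr => (hp r hr).not).not.congr fun γ => by
    push Not; rfl

theorem Comp.least {N : Γ → ℕ} {p : Γ → ℕ → Prop} (hN : v.Comp N) (hb : v.Bd N)
    (hp : ∀ r hr, (v.num r hr).Dec fun x => p x.1 x.2) : v.Comp fun γ => least (N γ) (p γ) := by
  refine Comp.sum (f := fun γ b => bit (∀ b' < N γ, b' ≤ b → ¬p γ b')) hN hb fun r hr => ?_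
  refine Dec.all (N := fun x : Γ × ℕ => N x.1) (p := fun x b' => b' ≤ x.2 → ¬p x.1 b') hN.num hb.num
    fun r' hr' => ?_
  refine (Comp.last.le Comp.last.num).imp (Dec.not ?_)
  -- `hp` is about a context with one additional number. It is applied to the number in register
  -- `r'`, ignoring the one in register `r`.
  intro fr hfr
  obtain ⟨T, ⟨c, hc⟩, P, hP⟩ := hp r' (by have : r + 1 ≤ r' := hr'; omega) fr hfr
  refine ⟨fun x => T (x.1.1, x.2), ⟨c, fun x s hs => hc (x.1.1, x.2) s ⟨hs.1.1, hs.2⟩⟩, P,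
    fun x s hs => hP (x.1.1, x.2) s ⟨hs.1.1, hs.2⟩⟩

/-- Only base and exponent have to be bounded, not the power: a product with the base is computed by
as many additions as the base says, whatever the size of the other factor. The running product is
kept in a matrix with one entry. -/
theorem Comp.pow (hf : v.Comp f) (bf : v.Bd f) (hg : v.Comp g) (bg : v.Bd g) :
    v.Comp fun γ => f γ ^ g γ := by
  have h1 : v.Tab (fun _ => 1) (fun _ => 1) fun γ =>
      iter (fun _ A => tab 1 1 fun _ _ => f γ * A 0 0)
      (tab 1 1 fun _ _ => 1) (g γ) := by
    refine Tab.iter (step := fun γ _ A => tab 1 1 fun _ _ => f γ * A 0 0) hg bg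
      (Tab.tab (.const 1) (.const 1) (.const 1) (.const 1) fun _ _ _ _ => .const 1)
      fun r hr r' hr' => ?_
    refine Tab.tab (f := fun x : (Γ × (ℕ → ℕ → ℕ)) × ℕ => fun _ _ => f x.1.1 * x.1.2 0 0)
      (.const 1) (.const 1) (.const 1) (.const 1) fun _ _ _ _ => ?_
    exact Comp.mul hf.arr.num.num.num bf.arr.num.num.num
      (Comp.read (Var.last (.const 1)).num.num.num (.const 0) (.const 0))
  refine (Comp.let (f := fun _ A => A 0 0) h1 fun _ _ =>
    Comp.read (Var.last (.const 1)) (.const 0) (.const 0)).congr fun γ => ?_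
  induction g γ with
  | zero => simp [iter, tab]
  | succ m ih =>
    rw [iter, tab_apply _ one_pos one_pos, ih, pow_succ']

/-- Division, if the quotient is known to be less than `N`. -/
theorem Comp.div {N : Γ → ℕ} (hf : v.Comp f) (hg : v.Comp g) (bg : v.Bd g) (hN : v.Comp N)
    (bN : v.Bd N) : v.Comp fun γ => min (f γ / g γ) (N γ) := by
  refine (Comp.ite (p := fun γ => g γ = 0) (hg.eq (.const 0)) (.const 0) (Comp.sum
    (f := fun γ j => bit (g γ * (j + 1) ≤ f γ)) hN bN fun r hr =>
      (hg.num.mul bg.num (Comp.last.add (.const 1))).le hf.num)).congr fun γ => ?_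
  split_ifs with h
  · simp [h]
  · have : ∀ j, bit (g γ * (j + 1) ≤ f γ) = if j < f γ / g γ then 1 else 0 := fun j => by
      have : j < f γ / g γ ↔ g γ * (j + 1) ≤ f γ := by
        rw [← Nat.succ_le_iff, Nat.le_div_iff_mul_le (by omega), mul_comm]
      simp [bit, this]
    simp only [this, Finset.sum_boole, Nat.cast_id]
    rw [show (Finset.range (N γ)).filter (· < f γ / g γ) = Finset.range (min (f γ / g γ) (N γ)) by
      ext; simp; tauto, Finset.card_range]

end View
end RAM

/-! ### Instances as sequences of numbers -/

namespace VMC.Instance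

/-- The adjacency relation, on numbers. -/
def adj (I : Instance) (u v : ℕ) : Prop := ∃ hu hv, I.G.Adj ⟨u, hu⟩ ⟨v, hv⟩

/-- The terminal pairs, on numbers. -/
def pair (I : Instance) (u v : ℕ) : Prop := ∃ hu hv, (⟨u, hu⟩, ⟨v, hv⟩) ∈ I.T

/-- The set `W`, on numbers. -/
def inW (I : Instance) (v : ℕ) : Prop := ∃ hv, ⟨v, hv⟩ ∈ I.W

/-- The encoding of an instance as a matrix with one row. -/
noncomputable def input (I : Instance) (i j : ℕ) : ℕ := if i = 0 then I.encode.getD j 0 else 0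

theorem size_eq (I : Instance) : I.size = 2 + 2 * (I.n * I.n) + I.n := by
  simp [size, encode]; ring

open RAM (bit)

theorem _root_.List.range_flatMap {α : Type*} (n : ℕ) (f : ℕ → List α) :
    (List.range n).flatMap f = (List.ofFn fun i : Fin n => f i).flatten := by
  rw [List.flatMap_def]
  congr 1
  exact List.ext_getElem (by simp) (by simp)

theorem _root_.List.flatten_ofFn_singleton {α : Type*} {n : ℕ} (g : Fin n → α) :
    (List.ofFn fun i => [g i]).flatten = List.ofFn g := by
  induction n with
  | zero => simp
  | succ n ih => simp [List.ofFn_succ, ih]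

/-- Nested ranges are the shape in which `View.Emit.for` produces output. -/
theorem encode_eq (I : Instance) : I.encode = [I.n, I.k] ++
    ((List.range I.n).flatMap fun u => (List.range I.n).flatMap fun v => [bit (I.adj u v)]) ++
    ((List.range I.n).flatMap fun u => (List.range I.n).flatMap fun v => [bit (I.pair u v)]) ++
    (List.range I.n).flatMap fun v => [bit (I.inW v)] := by
  have key : ∀ q : ℕ → ℕ → Prop, ∀ p : Fin (I.n * I.n) → Prop, ∀ _ : ∀ i, Decidable (p i),
      (∀ i, p i ↔ q i.divNat i.modNat) → List.ofFn (fun i => if p i then 1 else 0) =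
        (List.range I.n).flatMap fun u => (List.range I.n).flatMap fun v => [bit (q u v)] := by
    intro q p _ h
    rw [List.ofFn_mul, List.range_flatMap]
    congr 2
    funext u
    rw [List.range_flatMap]
    have h1 : ∀ v : Fin I.n, (u * I.n + v) / I.n = u := fun v => by
      rw [mul_comm, Nat.mul_add_div v.pos, Nat.div_eq_of_lt v.2, add_zero]
    have h2 : ∀ v : Fin I.n, (u * I.n + v) % I.n = v := fun v => by
      rw [mul_comm, Nat.mul_add_mod, Nat.mod_eq_of_lt v.2]
    rw [List.flatten_ofFn_singleton]
    congr 1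
    funext v
    rw [bit]
    congr 1
    simp [h, h1, h2]
  rw [encode, key I.adj, key I.pair]
  · congr 1
    rw [List.range_flatMap]
    rw [List.flatten_ofFn_singleton]
    simp [bit, inW]
  · intro i
    exact ⟨fun h => ⟨_, _, h⟩, fun ⟨_, _, h⟩ => h⟩
  · intro i
    exact ⟨fun h => ⟨_, _, h⟩, fun ⟨_, _, h⟩ => h⟩

theorem input_n (I : Instance) : I.input 0 0 = I.n := by simp [input, encode]

theorem input_k (I : Instance) : I.input 0 1 = I.k := by simp [input, encode]

theorem _root_.List.getD_add_length_append {α : Type*} (l l' : List α) {i : ℕ} (d : α) :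
    (l ++ l').getD (l.length + i) d = l'.getD i d := by
  rw [List.getD_append_right _ _ _ _ (by simp)]
  simp

theorem divNat_modNat {n u v : ℕ} (hv : v < n) (h : n * u + v < n * n) :
    ((⟨n * u + v, h⟩ : Fin (n * n)).divNat : ℕ) = u ∧
      ((⟨n * u + v, h⟩ : Fin (n * n)).modNat : ℕ) = v := by
  constructor
  · simp [Nat.mul_add_div (by omega : 0 < n), Nat.div_eq_of_lt hv]
  · simp [Nat.mod_eq_of_lt hv]

theorem input_adj (I : Instance) {u v : ℕ} (hu : u < I.n) (hv : v < I.n) :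
    I.input 0 (2 + (I.n * u + v)) = bit (I.adj u v) := by
  have hlt : I.n * u + v < I.n * I.n := by rw [mul_comm I.n u]; exact RAM.index_lt hu hv
  obtain ⟨h1, h2⟩ := divNat_modNat hv hlt
  simp only [input, if_true, encode, List.append_assoc]
  rw [show 2 = [I.n, I.k].length from rfl, List.getD_add_length_append,
    List.getD_append _ _ _ _ (by simpa using hlt), List.getD_eq_getElem _ _ (by simpa using hlt),
    List.getElem_ofFn]
  rw [show (⟨I.n * u + v, hlt⟩ : Fin (I.n * I.n)).divNat = ⟨u, hu⟩ from Fin.ext h1,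
    show (⟨I.n * u + v, hlt⟩ : Fin (I.n * I.n)).modNat = ⟨v, hv⟩ from Fin.ext h2]
  rw [bit]
  congr 1
  simp [adj, hu, hv]

theorem input_pair (I : Instance) {u v : ℕ} (hu : u < I.n) (hv : v < I.n) :
    I.input 0 (2 + (I.n * I.n + (I.n * u + v))) = bit (I.pair u v) := by
  have hlt : I.n * u + v < I.n * I.n := by rw [mul_comm I.n u]; exact RAM.index_lt hu hv
  obtain ⟨h1, h2⟩ := divNat_modNat hv hlt
  simp only [input, if_true, encode, List.append_assoc]
  rw [show 2 = [I.n, I.k].length from rfl, List.getD_add_length_append,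
    List.getD_append_right _ _ _ _ (by simp), List.length_ofFn, Nat.add_sub_cancel_left,
    List.getD_append _ _ _ _ (by simpa using hlt), List.getD_eq_getElem _ _ (by simpa using hlt),
    List.getElem_ofFn]
  rw [show (⟨I.n * u + v, hlt⟩ : Fin (I.n * I.n)).divNat = ⟨u, hu⟩ from Fin.ext h1,
    show (⟨I.n * u + v, hlt⟩ : Fin (I.n * I.n)).modNat = ⟨v, hv⟩ from Fin.ext h2]
  rw [bit]
  congr 1
  simp [pair, hu, hv]

theorem input_inW (I : Instance) {v : ℕ} (hv : v < I.n) :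
    I.input 0 (2 + (I.n * I.n + (I.n * I.n + v))) = bit (I.inW v) := by
  simp only [input, if_true, encode, List.append_assoc]
  rw [show 2 = [I.n, I.k].length from rfl, List.getD_add_length_append,
    List.getD_append_right _ _ _ _ (by simp), List.length_ofFn, Nat.add_sub_cancel_left,
    List.getD_append_right _ _ _ _ (by simp), List.length_ofFn, Nat.add_sub_cancel_left,
    List.getD_eq_getElem _ _ (by simpa using hv), List.getElem_ofFn]
  simp [bit, inW, hv]

end VMC.Instance

/-! ### The input as a context -/

namespace RAM
open VMC

/-- The context that consists of an instance. -/
noncomputable def inputView : View Instance where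
  rel I s := ArrAt s 1 I.input ∧ s.reg 2 = 1
  fr := 4
  pos := by omega
  -- The powers of this quantity have the form `k^O(k) * n^O(1)`, so "polynomial in the scale" is
  -- the running time that is wanted.
  scale I := max I.k 2 ^ I.k * (I.n + 2)
  two_le I := by
    have : 0 < max I.k 2 ^ I.k := Nat.pow_pos (by omega)
    nlinarith
  frame I s s' h ha := ⟨h.1.agree ha (by omega) (by omega),
    (ha.reg 2 (by omega) (by omega)).trans h.2⟩

/-- The program that prepares the input for the other programs. -/
def prepare : Program :=
  -- Register `4` has not been written and holds `0`, so the loads fetch `n` from cell `0`. The loop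
  -- adds `2 * n` to register `0` in each of `n` rounds.
  .seq (.load 0 4) (.seq (.load 5 4) (.seq (.load 6 4) (.seq (.const 7 1) (.seq (.const 2 2)
    (.seq (.add 0 0 2) (.seq (.loop 5 (.seq (.add 0 0 6) (.seq (.add 0 0 6) (.sub 5 5 7))))
      (.seq (.const 2 1) (copy 3 0))))))))

/-- The stack pointer must be placed behind the input, at `n + 2 + 2 * n * n`, which addition alone
can compute in linear time. The input is then the matrix with base `0` and one row. -/
theorem runs_prepare (I : Instance) : ∃ t ≤ 4 * I.n + 10, ∃ s,
    Runs prepare (init I.encode) t s ∧ inputView.rel I s ∧ s.out = [] := by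
  have h0 : (init I.encode).mem 0 = I.n := by simp [init, Instance.encode]
  set s0 := init I.encode with hs0
  have hreg : ∀ r, s0.reg r = 0 := fun _ => rfl
  set s1 := ((((((s0.set 0 I.n).set 5 I.n).set 6 I.n).set 7 1).set 2 2).set 0 (I.n + 2)) with hs1
  obtain ⟨t, ht, s, hr, h1, h2, h3, h4, h5, h6, h7⟩ := loop_rule (c := 5) (N := I.n) (T := 3)
    (P := .seq (.add 0 0 6) (.seq (.add 0 0 6) (.sub 5 5 7)))
    (Inv := fun i s => s.reg 5 = I.n - i ∧ s.reg 0 = I.n + 2 + 2 * (i * I.n) ∧ s.reg 6 = I.n ∧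
      s.reg 7 = 1 ∧ s.mem = s0.mem ∧ s.out = [] ∧ s.reg 1 = 0)
    (by
      rintro i hi s ⟨h1, h2, h3, h4, h5, h6, h7⟩
      refine ⟨by omega, 1 + (1 + 1), le_rfl, _,
        (runs_add _ _ _ _).seq ((runs_add _ _ _ _).seq (runs_sub _ _ _ _)),
        ?_, ?_, ?_, ?_, h5, h6, ?_⟩
      · simp [State.set_reg, h1, h4]; omega
      · simp [State.set_reg, h2, h3]; ring
      · simp [State.set_reg, h3]
      · simp [State.set_reg, h4]
      · simp [State.set_reg, h7])
    (by rintro s ⟨h1, _⟩; omega) s1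
    (by simp [hs1, State.set_reg, hreg]; simp [hs0, init])
  refine ⟨1 + (1 + (1 + (1 + (1 + (1 + (t + (1 + 2))))))), by omega,
    (s.set 2 1).set 3 (s.reg 0), ?_, ⟨⟨?_, ?_, ?_⟩, ?_⟩, ?_⟩
  · have e1 := runs_load 0 4 s0
    rw [hreg, h0] at e1
    have e2 := runs_load 5 4 (s0.set 0 I.n)
    rw [State.set_reg, if_neg (by omega), hreg, State.set_mem, h0] at e2
    have e3 := runs_load 6 4 ((s0.set 0 I.n).set 5 I.n)
    rw [State.set_reg, if_neg (by omega), State.set_reg, if_neg (by omega), hreg, State.set_mem,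
      State.set_mem, h0] at e3
    have e4 := runs_add 0 0 2 (((((s0.set 0 I.n).set 5 I.n).set 6 I.n).set 7 1).set 2 2)
    have e5 := runs_copy (x := 3) (y := 0) (by omega) (s.set 2 1)
    refine e1.seq (e2.seq (e3.seq ((runs_const _ _ _).seq ((runs_const _ _ _).seq
      (Runs.seq (s' := s1) ?_ (hr.seq ((runs_const _ _ _).seq ?_)))))))
    · simpa [State.set_reg] using e4
    · simpa [State.set_reg] using e5
  · simp [State.set_reg, h7]
  · intro i j hi hj
    simp [State.set_reg] at hi
    subst hi
    simp [State.set_reg, h7, h5, Instance.input, hs0, init]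
  · intro i j hij
    simp [State.set_reg, h2] at hij
    by_cases hi : i = 0
    · rw [Instance.input, if_pos hi, List.getD_eq_default]
      have := I.size_eq
      rw [Instance.size] at this
      have := hij hi
      omega
    · exact if_neg hi
  · simp [State.set_reg]
  · exact h6

theorem exists_program {g : Instance → List ℕ} (h : inputView.Emit g) :
    ∃ p, ∃ c, ∀ I : Instance,
      OutputsWithin p I.encode (g I) (c * max I.k 2 ^ (c * I.k) * (I.n + 1) ^ c) := by
  obtain ⟨T, ⟨c, hc⟩, p, hp⟩ := h 4 le_rfl
  obtain ⟨D, hD⟩ : ∃ D, D = 2 ^ c := ⟨_, rfl⟩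
  -- `D = 2 ^ c` pays for `n + 2 ≤ 2 * (n + 1)`, and `14` for the preparation: `4 * n + 10 ≤ 14 * (n
  -- + 1)`.
  refine ⟨.seq prepare p, c + D + 14, fun I => ?_⟩
  obtain ⟨t, ht, s, hr, h1, h2⟩ := runs_prepare I
  obtain ⟨t', ht', s', hr', -, h3⟩ := hp I s h1
  refine ⟨t + t', ?_, s', hr.seq hr', by rw [h3, h2, List.nil_append]⟩
  set C := c + D + 14 with hC
  set M := max I.k 2 with hM
  have hM1 : 1 ≤ M := by omega
  have h4 : t' ≤ (M ^ I.k * (I.n + 2)) ^ c := ht'.trans (hc I s h1)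
  have h5 : (M ^ I.k * (I.n + 2)) ^ c ≤ M ^ (C * I.k) * (D * (I.n + 1) ^ C) := by
    rw [mul_pow, ← pow_mul, mul_comm I.k]
    refine Nat.mul_le_mul (Nat.pow_le_pow_right hM1 (Nat.mul_le_mul_right _ (by omega))) ?_
    calc (I.n + 2) ^ c ≤ (2 * (I.n + 1)) ^ c := Nat.pow_le_pow_left (by omega) _
      _ = D * (I.n + 1) ^ c := by rw [mul_pow, hD]
      _ ≤ _ := Nat.mul_le_mul_left _ (Nat.pow_le_pow_right (by omega) (by omega))
  have h6 : t ≤ 14 * (I.n + 1) ^ C := by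
    have : I.n + 1 ≤ (I.n + 1) ^ C := Nat.le_self_pow (by omega) _
    omega
  have h7 : 1 ≤ M ^ (C * I.k) := Nat.one_le_pow _ _ hM1
  calc t + t' ≤ M ^ (C * I.k) * (14 * (I.n + 1) ^ C) + M ^ (C * I.k) * (D * (I.n + 1) ^ C) := by
        have := Nat.mul_le_mul h7 h6
        omega
    _ = (D + 14) * M ^ (C * I.k) * (I.n + 1) ^ C := by ring
    _ ≤ _ := Nat.mul_le_mul_right _ (Nat.mul_le_mul_right _ (by omega))

variable {Γ : Type}

/-- The context contains the instance `π γ`. -/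
structure View.Has (v : View Γ) (π : Γ → Instance) : Prop where
  var : v.Var fun γ => (π γ).input
  bd : ∃ c, ∀ γ s, v.rel γ s → max (π γ).k 2 ^ (π γ).k * ((π γ).n + 2) ≤ v.scale γ ^ c

namespace View
variable {v : View Γ} {π : Γ → Instance} {f g : Γ → ℕ}

theorem has_inputView : inputView.Has fun I => I :=
  ⟨⟨1, by omega, le_rfl, _, Bd.const 1, fun _ _ h => ⟨h.1, h.2.le⟩⟩, 1, fun _ _ _ => by
    simp [inputView]⟩

theorem Has.num (h : v.Has π) {r : ℕ} {hr : v.fr ≤ r} : (v.num r hr).Has fun p => π p.1 :=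
  ⟨h.var.num, let ⟨c, hc⟩ := h.bd; ⟨c, fun p s hs => hc p.1 s hs.1⟩⟩

theorem Has.arr (h : v.Has π) {R C : Γ → ℕ} {r : ℕ} {hr : v.fr ≤ r} :
    (v.arr R C r hr).Has fun p => π p.1 :=
  ⟨h.var.arr, let ⟨c, hc⟩ := h.bd; ⟨c, fun p s hs => hc p.1 s hs.1⟩⟩

theorem Has.bd_pow (h : v.Has π) : v.Bd fun γ => max (π γ).k 2 ^ (π γ).k :=
  Bd.mono (N := fun γ => max (π γ).k 2 ^ (π γ).k * ((π γ).n + 2)) h.bd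
    fun _ => Nat.le_mul_of_pos_right _ (by omega)

theorem Has.bd_n (h : v.Has π) : v.Bd fun γ => (π γ).n :=
  Bd.mono (N := fun γ => max (π γ).k 2 ^ (π γ).k * ((π γ).n + 2)) h.bd fun γ =>
    (by omega : (π γ).n ≤ (π γ).n + 2).trans (Nat.le_mul_of_pos_left _ (Nat.pow_pos (by omega)))

theorem Has.bd_k (h : v.Has π) : v.Bd fun γ => (π γ).k :=
  h.bd_pow.mono fun γ => (Nat.lt_pow_self (by omega : 1 < max (π γ).k 2)).le

theorem Has.n (h : v.Has π) : v.Comp fun γ => (π γ).n :=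
  (Comp.read h.var (.const 0) (.const 0)).congr fun γ => (π γ).input_n

theorem Has.k (h : v.Has π) : v.Comp fun γ => (π γ).k :=
  (Comp.read h.var (.const 0) (.const 1)).congr fun γ => (π γ).input_k

/-- The range tests are needed because an index beyond `n` would address another part of the input.
-/
theorem Has.adj (h : v.Has π) (hf : v.Comp f) (hg : v.Comp g) :
    v.Dec fun γ => (π γ).adj (f γ) (g γ) := by
  refine ((hf.lt h.n).and ((hg.lt h.n).and (Comp.read h.var (.const 0) ((Comp.const 2).add
    ((h.n.mul h.bd_n hf).add hg))).ne_zero)).congr fun γ => ⟨?_, ?_⟩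
  · rintro ⟨h1, h2, h3⟩
    rwa [Instance.input_adj _ h1 h2, bit_ne_zero] at h3
  · rintro ⟨h1, h2, h3⟩
    refine ⟨h1, h2, ?_⟩
    rw [Instance.input_adj _ h1 h2, bit_ne_zero]
    exact ⟨h1, h2, h3⟩

theorem Has.pair (h : v.Has π) (hf : v.Comp f) (hg : v.Comp g) :
    v.Dec fun γ => (π γ).pair (f γ) (g γ) := by
  refine ((hf.lt h.n).and ((hg.lt h.n).and (Comp.read h.var (.const 0) ((Comp.const 2).add
    ((h.n.mul h.bd_n h.n).add ((h.n.mul h.bd_n hf).add hg)))).ne_zero)).congr fun γ => ⟨?_, ?_⟩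
  · rintro ⟨h1, h2, h3⟩
    rwa [Instance.input_pair _ h1 h2, bit_ne_zero] at h3
  · rintro ⟨h1, h2, h3⟩
    refine ⟨h1, h2, ?_⟩
    rw [Instance.input_pair _ h1 h2, bit_ne_zero]
    exact ⟨h1, h2, h3⟩

theorem Has.inW (h : v.Has π) (hf : v.Comp f) : v.Dec fun γ => (π γ).inW (f γ) := by
  refine ((hf.lt h.n).and (Comp.read h.var (.const 0) ((Comp.const 2).add ((h.n.mul h.bd_n h.n).add
    ((h.n.mul h.bd_n h.n).add hf)))).ne_zero).congr fun γ => ⟨?_, ?_⟩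
  · rintro ⟨h1, h3⟩
    rwa [Instance.input_inW _ h1, bit_ne_zero] at h3
  · rintro ⟨h1, h3⟩
    refine ⟨h1, ?_⟩
    rw [Instance.input_inW _ h1, bit_ne_zero]
    exact ⟨h1, h3⟩

end View
end RAM

/-! ### The torso of an instance -/

namespace VMC
variable {V : Type*} {G : SimpleGraph V}

theorem ConnectedOff.refl {X : Finset V} {u : V} (h : u ∉ X) : ConnectedOff G X u u :=
  ⟨.nil, by simpa using h⟩

theorem ConnectedOff.symm {X : Finset V} {u v : V} (h : ConnectedOff G X u v) :
    ConnectedOff G X v u :=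
  let ⟨p, hp⟩ := h
  ⟨p.reverse, by simpa using hp⟩

theorem ConnectedOff.trans {X : Finset V} {u v w : V} (h : ConnectedOff G X u v)
    (h' : ConnectedOff G X v w) : ConnectedOff G X u w := by
  obtain ⟨p, hp⟩ := h
  obtain ⟨q, hq⟩ := h'
  refine ⟨p.append q, fun x hx => ?_⟩
  rw [SimpleGraph.Walk.mem_support_append_iff] at hx
  exact hx.elim (hp x) (hq x)

theorem ConnectedOff.left {X : Finset V} {u v : V} (h : ConnectedOff G X u v) : u ∉ X :=
  let ⟨p, hp⟩ := h
  hp u p.start_mem_support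

theorem ConnectedOff.right {X : Finset V} {u v : V} (h : ConnectedOff G X u v) : v ∉ X :=
  h.symm.left

theorem ConnectedOff.adj {X : Finset V} {u v : V} (h : G.Adj u v) (hu : u ∉ X) (hv : v ∉ X) :
    ConnectedOff G X u v :=
  ⟨.cons h .nil, by simp [hu, hv]⟩

/-- Induction along a walk. -/
theorem ConnectedOff.rec_tail {X : Finset V} {u v : V} (h : ConnectedOff G X u v)
    {P : V → Prop} (h0 : P u) (hs : ∀ a b, P a → a ∉ X → b ∉ X → G.Adj a b → P b) : P v := by
  obtain ⟨p, hp⟩ := h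
  induction p with
  | nil => exact h0
  | cons hadj p ih =>
    simp only [SimpleGraph.Walk.support_cons, List.mem_cons, forall_eq_or_imp] at hp
    exact ih (hs _ _ h0 hp.1 (hp.2 _ p.start_mem_support) hadj) hp.2

theorem ConnectedOff.mono {X Y : Finset V} {u v : V} (h : ConnectedOff G X u v) (hY : Y ⊆ X) :
    ConnectedOff G Y u v :=
  let ⟨p, hp⟩ := h
  ⟨p, fun x hx hxY => hp x hx (hY hxY)⟩

/-- There is a walk from `a` to `b` all of whose vertices but the last one lie in `Z`. -/
def Thru (G : SimpleGraph V) (Z : Set V) : V → V → Prop :=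
  Relation.ReflTransGen fun a b => a ∈ Z ∧ G.Adj a b

theorem Thru.eq_of_notMem {Z : Set V} {a b : V} (h : Thru G Z a b) (ha : a ∉ Z) : a = b := by
  induction h using Relation.ReflTransGen.head_induction_on with
  | refl => rfl
  | head h _ _ => exact absurd h.1 ha

theorem Thru.connectedOff {Z : Set V} {Y : Finset V} {a b : V} (h : Thru G Z a b)
    (hZ : ∀ z ∈ Z, z ∉ Y) (hb : b ∉ Y) : ConnectedOff G Y a b := by
  induction h using Relation.ReflTransGen.head_induction_on with
  | refl => exact .refl hb
  | head h _ ih => exact (ConnectedOff.adj h.2 (hZ _ h.1) ih.left).trans ih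

/-- The graph in which the vertices outside `Z` that are connected through `Z` are made adjacent,
and each vertex of `Z` is attached to `w`. -/
def torso (G : SimpleGraph V) (Z : Set V) (w : V) : SimpleGraph V :=
  SimpleGraph.fromRel fun u v =>
    (u ∉ Z ∧ v ∉ Z ∧ ∃ a, G.Adj u a ∧ Thru G Z a v) ∨ (u ∈ Z ∧ v = w)

open Classical in
/-- The pairs of vertices outside `Z` that are connected through `Z` to the elements of a pair in
`T`. -/
noncomputable def torsoPairs [Fintype V] (G : SimpleGraph V) (T : Finset (V × V)) (Z : Set V) :
    Finset (V × V) :=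
  {p | p.1 ∉ Z ∧ p.2 ∉ Z ∧ ∃ st ∈ T, Thru G Z st.1 p.1 ∧ Thru G Z st.2 p.2}

theorem mem_torsoPairs [Fintype V] {T : Finset (V × V)} {Z : Set V} {p : V × V} :
    p ∈ torsoPairs G T Z ↔
      p.1 ∉ Z ∧ p.2 ∉ Z ∧ ∃ st ∈ T, Thru G Z st.1 p.1 ∧ Thru G Z st.2 p.2 := by
  simp [torsoPairs]

variable {Z : Set V} {w : V}

/-- Induction along the walk: as long as it has stayed in `Z`, the first alternative holds;
afterwards `t'` is the last vertex outside `Z`, and each excursion into `Z` is replaced by an edge.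
`X` may meet `Z` here, which is what makes bypassing sound for every `Z`. -/
theorem ConnectedOff.torso {X : Finset V} {s t : V} (h : ConnectedOff G X s t) :
    (t ∈ Z ∧ Thru G Z s t) ∨ ∃ s' t', s' ∉ Z ∧ t' ∉ Z ∧ Thru G Z s s' ∧ Thru G Z t t' ∧
      ConnectedOff (torso G Z w) X s' t' := by
  refine h.rec_tail (P := fun b => (b ∈ Z ∧ Thru G Z s b) ∨ ∃ s' t', s' ∉ Z ∧ t' ∉ Z ∧
    Thru G Z s s' ∧ Thru G Z b t' ∧ ConnectedOff (VMC.torso G Z w) X s' t') ?_ ?_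
  · by_cases hs : s ∈ Z
    · exact .inl ⟨hs, .refl⟩
    · exact .inr ⟨s, s, hs, hs, .refl, .refl, .refl h.left⟩
  · rintro b c (⟨hb, h1⟩ | ⟨s', b', hs', hb', h1, h2, h3⟩) - hcX hbc
    · by_cases hc : c ∈ Z
      · exact .inl ⟨hc, h1.tail ⟨hb, hbc⟩⟩
      · exact .inr ⟨c, c, hc, hc, h1.tail ⟨hb, hbc⟩, .refl, .refl hcX⟩
    · by_cases hc : c ∈ Z
      · exact .inr ⟨s', b', hs', hb', h1, .head ⟨hc, hbc.symm⟩ h2, h3⟩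
      · refine .inr ⟨s', c, hs', hc, h1, .refl, ?_⟩
        rcases eq_or_ne b' c with rfl | hne
        · exact h3
        · refine h3.trans (.adj ?_ h3.right hcX)
          rw [VMC.torso, SimpleGraph.fromRel_adj]
          exact ⟨hne, .inr (.inl ⟨hc, hb', b, hbc.symm, h2⟩)⟩

theorem ConnectedOff.torso_of_notMem {X : Finset V} {s t : V} (h : ConnectedOff G X s t)
    (hs : s ∉ Z) (ht : t ∉ Z) : ConnectedOff (VMC.torso G Z w) X s t := by
  obtain ⟨h1, -⟩ | ⟨s', t', -, -, h3, h4, h5⟩ := h.torso (Z := Z) (w := w)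
  · exact absurd h1 ht
  · rwa [← h3.eq_of_notMem hs, ← h4.eq_of_notMem ht] at h5

/-- In the torso a vertex of `Z` has no neighbour but `w`, so a walk that visits it stands at `w`
before and after; the induction lets `w` take its place. Unlike the converse, this needs `Y` to miss
`Z`, since the edges of the torso are expanded into walks through `Z`. -/
theorem ConnectedOff.of_torso {Y : Finset V} {s t : V} (h : ConnectedOff (VMC.torso G Z w) Y s t)
    (hw : w ∉ Z) (hZ : ∀ z ∈ Z, z ∉ Y) (hs : s ∉ Z) (ht : t ∉ Z) : ConnectedOff G Y s t := by
  have key : (t ∉ Z → ConnectedOff G Y s t) ∧ (t ∈ Z → ConnectedOff G Y s w) := by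
    refine h.rec_tail (P := fun b => (b ∉ Z → ConnectedOff G Y s b) ∧
      (b ∈ Z → ConnectedOff G Y s w)) ⟨fun _ => .refl h.left, fun h' => absurd h' hs⟩ ?_
    rintro a b ⟨h1, h2⟩ haY hbY hab
    rw [VMC.torso, SimpleGraph.fromRel_adj] at hab
    rcases hab with ⟨-, (⟨ha, hb, c, hac, hcb⟩ | ⟨ha, rfl⟩) | (⟨hb, ha, c, hbc, hca⟩ | ⟨hb, rfl⟩)⟩
    · have h3 := hcb.connectedOff hZ hbY
      exact ⟨fun _ => (h1 ha).trans ((ConnectedOff.adj hac haY h3.left).trans h3),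
        fun h' => absurd h' hb⟩
    · exact ⟨fun _ => h2 ha, fun _ => h2 ha⟩
    · have h3 := hca.connectedOff hZ haY
      exact ⟨fun _ => (h1 ha).trans (h3.symm.trans (ConnectedOff.adj hbc hbY h3.left).symm),
        fun h' => absurd h' hb⟩
    · exact ⟨fun h' => absurd hb h', fun _ => h1 hw⟩
  exact key.1 ht

namespace Instance

variable (I : Instance) (Z : Set (Fin I.n))

theorem isMulticut_torsoPairs {Y : Finset (Fin I.n)} {w : Fin I.n} (hw : w ∉ Z)
    (hZ : ∀ z ∈ Z, z ∉ Y) (h : IsMulticut I.G I.T Y) :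
    IsMulticut (VMC.torso I.G Z w) (torsoPairs I.G I.T Z) Y := by
  intro p hp hc
  obtain ⟨h1, h2, st, hst, h3, h4⟩ := mem_torsoPairs.1 hp
  refine h st hst ((h3.connectedOff hZ hc.left).trans
    ((hc.of_torso hw hZ h1 h2).trans (h4.connectedOff hZ hc.right).symm))

/-- The instance obtained by bypassing a set `Z` of vertices outside `W`. -/
noncomputable def torso (hZ : ∀ z ∈ Z, z ∉ I.W) (w : Fin I.n) (hw : w ∈ I.W) : Instance where
  n := I.n
  G := VMC.torso I.G Z w
  T := torsoPairs I.G I.T Z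
  W := I.W
  k := I.k
  multicut := I.isMulticut_torsoPairs Z (fun h => hZ w h hw) hZ I.multicut
  card_le := I.card_le

variable {I Z} {hZ : ∀ z ∈ Z, z ∉ I.W} {w : Fin I.n} {hw : w ∈ I.W}

/-- The torso does not see a walk between two terminals that lies entirely in `Z`. But such a walk
avoids `W`, which is a multicut, so there is none. -/
theorem IsSolution.of_torso {X : Finset (Fin I.n)} (h : (I.torso Z hZ w hw).IsSolution X) :
    I.IsSolution X := by
  refine ⟨h.card_le, fun st hst hc => ?_, h.disjoint, h.disjoint, fun w₁ h₁ w₂ h₂ hc => ?_⟩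
  · obtain ⟨h1, h2⟩ | ⟨s', t', h1, h2, h3, h4, h5⟩ := hc.torso (Z := Z) (w := w)
    · exact I.multicut st hst (h2.connectedOff hZ (hZ _ h1))
    · exact h.multicut (s', t') (mem_torsoPairs.2 ⟨h1, h2, st, hst, h3, h4⟩) h5
  · exact h.multiwayCut.2 w₁ h₁ w₂ h₂
      (hc.torso_of_notMem (fun h => hZ _ h h₁) fun h => hZ _ h h₂)

/-- Vertices of `Z` are attached to `w`; the others are not in the shadow, and the torso preserves
their connections to `W`. -/
theorem IsSolution.torso {X : Finset (Fin I.n)} (h : I.IsSolution X) (hX : ∀ z ∈ Z, z ∉ X)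
    (hsh : shadow I.G I.W X ⊆ Z) : (I.torso Z hZ w hw).IsShadowlessSolution X := by
  have hw' : w ∉ Z := fun h => hZ w h hw
  refine ⟨⟨h.card_le, I.isMulticut_torsoPairs Z hw' hX h.multicut, h.disjoint, h.disjoint,
    fun w₁ h₁ w₂ h₂ hc => h.multiwayCut.2 w₁ h₁ w₂ h₂
      (hc.of_torso hw' hX (fun h => hZ _ h h₁) fun h => hZ _ h h₂)⟩, ?_⟩
  refine Set.eq_empty_of_forall_notMem fun v hv => ?_
  obtain ⟨h1, h2, h3⟩ := hv
  by_cases hvZ : v ∈ Z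
  · refine h3 w hw (.adj ?_ h2 (Finset.disjoint_right.1 h.disjoint hw))
    simp only [Instance.torso, VMC.torso]
    exact ⟨fun h => hw' (h ▸ hvZ), .inl (.inr ⟨hvZ, rfl⟩)⟩
  · obtain ⟨w', hw', hc⟩ : ∃ w' ∈ I.W, ConnectedOff I.G X v w' := by
      by_contra! hcon
      exact hvZ (hsh ⟨h1, h2, hcon⟩)
    exact h3 w' hw' (hc.torso_of_notMem hvZ fun h => hZ _ h hw')

end Instance

/-! ### Solutions with an extremal shadow -/

section Boundary

variable [Fintype V]

open Classical in
/-- The vertices of `B` that have a neighbour outside `B`. -/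
noncomputable def boundary (G : SimpleGraph V) (B : Finset V) : Finset V :=
  {v ∈ B | ∃ u, G.Adj v u ∧ u ∉ B}

theorem mem_boundary {B : Finset V} {v : V} :
    v ∈ boundary G B ↔ v ∈ B ∧ ∃ u, G.Adj v u ∧ u ∉ B := by
  simp [boundary]

theorem boundary_subset {B : Finset V} : boundary G B ⊆ B := fun _ h => (mem_boundary.1 h).1

/-- A walk that starts outside `B` can enter `B` only through its boundary. -/
theorem ConnectedOff.of_boundary {B : Finset V} {u v : V} (h : ConnectedOff G (boundary G B) u v)
    (hu : u ∉ B) : ConnectedOff G B u v := by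
  refine h.rec_tail (P := fun b => ConnectedOff G B u b) (.refl hu) ?_
  intro a b hua _ hb hab
  exact hua.trans (.adj hab hua.right fun hbB => hb (mem_boundary.2 ⟨hbB, a, hab.symm, hua.right⟩))

end Boundary

namespace Instance
variable {I : Instance}

/-- As `W` is a multicut, a walk between two terminals passes through `W`. -/
theorem exists_mem_connectedOff {X : Finset (Fin I.n)} {st : Fin I.n × Fin I.n} (hst : st ∈ I.T)
    (h : ConnectedOff I.G X st.1 st.2) :
    ∃ w ∈ I.W, ConnectedOff I.G X st.1 w ∧ ConnectedOff I.G X w st.2 := by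
  by_contra! hcon
  refine I.multicut st hst ?_
  have key : ConnectedOff I.G X st.1 st.2 ∧ ConnectedOff I.G I.W st.1 st.2 := by
    have aux : ∀ b, ConnectedOff I.G X st.1 b → ConnectedOff I.G X b st.2 → b ∉ I.W :=
      fun b h1 h2 hb => hcon b hb h1 h2
    refine h.rec_tail (P := fun b => ConnectedOff I.G X st.1 b ∧ ConnectedOff I.G I.W st.1 b)
      ⟨.refl h.left, .refl (aux _ (.refl h.left) h)⟩ ?_
    rintro a b ⟨h1, h2⟩ ha hb hab
    have h3 := h1.trans (.adj hab ha hb)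
    exact ⟨h3, h2.trans (.adj hab h2.right (aux b h3 (h3.symm.trans h)))⟩
  exact key.2

/-- Whatever a solution has to prevent is a walk through a vertex of `W`. Seen from there, a walk
that avoids the boundary of `B` avoids `B` and hence `X`. So a solution can be pushed outwards as
long as its size permits. -/
theorem IsSolution.boundary {X B : Finset (Fin I.n)} (h : I.IsSolution X) (hXB : X ⊆ B)
    (hB : Disjoint B I.W) (hk : (VMC.boundary I.G B).card ≤ I.k) :
    I.IsSolution (VMC.boundary I.G B) := by
  have hd : Disjoint (VMC.boundary I.G B) I.W := hB.mono_left boundary_subset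
  refine ⟨hk, fun st hst hc => ?_, hd, hd, fun w₁ h₁ w₂ h₂ hc => ?_⟩
  · obtain ⟨w, hw, h1, h2⟩ := exists_mem_connectedOff hst hc
    have hwB := Finset.disjoint_right.1 hB hw
    exact h.multicut st hst (((h1.symm.of_boundary hwB).symm.trans (h2.of_boundary hwB)).mono hXB)
  · exact h.multiwayCut.2 w₁ h₁ w₂ h₂
      ((hc.of_boundary (Finset.disjoint_right.1 hB h₁)).mono hXB)

/-- `B` is a maximal set disjoint from `W` with at most `k` boundary vertices, and its boundary is
a solution. -/
structure IsExtremal (I : Instance) (B : Finset (Fin I.n)) : Prop where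
  disjoint : Disjoint B I.W
  isSolution : I.IsSolution (VMC.boundary I.G B)
  lt_card : ∀ B', B ⊂ B' → Disjoint B' I.W → I.k < (VMC.boundary I.G B').card

theorem IsYes.exists_isExtremal (h : I.IsYes) : ∃ B, I.IsExtremal B := by
  classical
  obtain ⟨X, hX⟩ := h
  let S : Finset (Finset (Fin I.n)) :=
    {B | Disjoint B I.W ∧ I.IsSolution (VMC.boundary I.G B)}
  have hS : S.Nonempty := by
    -- `X` together with its shadow; only vertices of `X` can have neighbours outside.
    let B : Finset (Fin I.n) := {v | ∀ w ∈ I.W, ¬ConnectedOff I.G X v w}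
    have hB : Disjoint B I.W := Finset.disjoint_left.2 fun v hv hw =>
      (Finset.mem_filter.1 hv).2 v hw (.refl (Finset.disjoint_right.1 hX.disjoint hw))
    have hXB : X ⊆ B := fun x hx =>
      Finset.mem_filter.2 ⟨Finset.mem_univ _, fun w _ hc => hc.left hx⟩
    have hbX : VMC.boundary I.G B ⊆ X := by
      intro v hv
      obtain ⟨h1, u, hvu, hu⟩ := mem_boundary.1 hv
      by_contra hvX
      simp only [B, Finset.mem_filter, Finset.mem_univ, true_and, not_forall, not_not] at hu
      obtain ⟨w, hw, hc⟩ := hu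
      exact (Finset.mem_filter.1 h1).2 w hw ((ConnectedOff.adj hvu hvX hc.left).trans hc)
    exact ⟨B, Finset.mem_filter.2 ⟨Finset.mem_univ _, hB, hX.boundary hXB hB
      ((Finset.card_le_card hbX).trans hX.card_le)⟩⟩
  obtain ⟨B, hB⟩ := S.exists_maximal hS
  have hBS := (Finset.mem_filter.1 hB.1).2
  refine ⟨B, hBS.1, hBS.2, fun B' hlt hd => ?_⟩
  -- A larger set with a small boundary would again have a solution as its boundary, against
  -- maximality.
  by_contra! hk
  exact hB.not_gt (Finset.mem_filter.2 ⟨Finset.mem_univ _, hd,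
    hBS.2.boundary (boundary_subset.trans hlt.1) hd hk⟩) hlt

namespace IsExtremal
variable {B : Finset (Fin I.n)}

theorem subset_of_boundary_subset (h : I.IsExtremal B) {B' : Finset (Fin I.n)} (hB : B ⊆ B')
    (hd : Disjoint B' I.W) (hb : VMC.boundary I.G B' ⊆ VMC.boundary I.G B) : B' ⊆ B := by
  by_contra hne
  have := h.lt_card B' ⟨hB, hne⟩ hd
  have := (Finset.card_le_card hb).trans h.isSolution.card_le
  omega

/-- Adding to `B` everything that its boundary cuts off from `W` creates no new boundary vertices,
so by maximality nothing is added. -/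
theorem exists_connectedOff (h : I.IsExtremal B) {v : Fin I.n} (hv : v ∉ B) :
    ∃ w ∈ I.W, ConnectedOff I.G (VMC.boundary I.G B) v w := by
  classical
  by_contra! hcon
  let B' : Finset (Fin I.n) :=
    {u | u ∈ B ∨ ∀ w ∈ I.W, ¬ConnectedOff I.G (VMC.boundary I.G B) u w}
  have hmem : ∀ u, u ∈ B' ↔ u ∈ B ∨ ∀ w ∈ I.W, ¬ConnectedOff I.G (VMC.boundary I.G B) u w := by
    simp [B']
  have hnb : ∀ u, u ∉ B → u ∉ VMC.boundary I.G B := fun u hu h => hu (boundary_subset h)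
  refine hv (h.subset_of_boundary_subset (B' := B') (fun u hu => (hmem u).2 (.inl hu)) ?_ ?_
    ((hmem v).2 (.inr hcon)))
  · refine Finset.disjoint_left.2 fun u hu hw => ?_
    have huB := Finset.disjoint_right.1 h.disjoint hw
    exact ((hmem u).1 hu).elim huB fun h' => h' u hw (.refl (hnb u huB))
  · intro x hx
    obtain ⟨h1, u, hxu, hu⟩ := mem_boundary.1 hx
    rw [hmem, not_or] at hu
    by_cases hxB : x ∈ B
    · exact mem_boundary.2 ⟨hxB, u, hxu, hu.1⟩
    · have h2 := hu.2
      push Not at h2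
      obtain ⟨w, hw, hc⟩ := h2
      exact (((hmem x).1 h1).resolve_left hxB w hw
        ((ConnectedOff.adj hxu (hnb x hxB) hc.left).trans hc)).elim

theorem shadow_subset (h : I.IsExtremal B) :
    shadow I.G I.W (VMC.boundary I.G B) ⊆ {v | v ∈ B ∧ v ∉ VMC.boundary I.G B} := by
  rintro v ⟨-, h2, h3⟩
  refine ⟨?_, h2⟩
  by_contra hv
  obtain ⟨w, hw, hc⟩ := h.exists_connectedOff hv
  exact h3 w hw hc

theorem mem_of_forall_adj (h : I.IsExtremal B) {v : Fin I.n} (hv : v ∉ I.W)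
    (hN : ∀ u, I.G.Adj v u → u ∈ B) : v ∈ B := by
  classical
  refine h.subset_of_boundary_subset (B' := insert v B) (Finset.subset_insert _ _) ?_ ?_
    (Finset.mem_insert_self _ _)
  · exact Finset.disjoint_insert_left.2 ⟨hv, h.disjoint⟩
  · intro x hx
    obtain ⟨h1, u, hxu, hu⟩ := mem_boundary.1 hx
    rw [Finset.mem_insert, not_or] at hu
    rcases Finset.mem_insert.1 h1 with rfl | h1
    · exact (hu.2 (hN u hxu)).elim
    · exact mem_boundary.2 ⟨h1, u, hxu, hu.2⟩

end IsExtremal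
end Instance
end VMC

/-! ### Important cuts -/

namespace VMC
section Cut

/-- The capacity of the arcs of the network `M` on the nodes below `N` that leave `Q`. -/
def cut (N : ℕ) (M : ℕ → ℕ → ℕ) (Q : Finset ℕ) : ℕ :=
  ∑ a ∈ Finset.range N, ∑ b ∈ Finset.range N, if a ∈ Q ∧ b ∉ Q then M a b else 0

variable {N : ℕ} {M : ℕ → ℕ → ℕ} {sink : ℕ → Prop}

/-- Submodularity, checked arc by arc. -/
theorem cut_inter_add_cut_union (Q Q' : Finset ℕ) :
    cut N M (Q ∩ Q') + cut N M (Q ∪ Q') ≤ cut N M Q + cut N M Q' := by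
  simp only [cut, ← Finset.sum_add_distrib]
  refine Finset.sum_le_sum fun a _ => Finset.sum_le_sum fun b _ => ?_
  by_cases h1 : a ∈ Q <;> by_cases h2 : a ∈ Q' <;> by_cases h3 : b ∈ Q <;>
    by_cases h4 : b ∈ Q' <;> simp [h1, h2, h3, h4]

theorem le_cut {Q : Finset ℕ} {a b : ℕ} (ha : a < N) (hb : b < N) (h1 : a ∈ Q) (h2 : b ∉ Q) :
    M a b ≤ cut N M Q := by
  have h := Finset.single_le_sum (f := fun b => if a ∈ Q ∧ b ∉ Q then M a b else 0)
    (fun _ _ => Nat.zero_le _) (Finset.mem_range.2 hb)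
  have h' := Finset.single_le_sum (f := fun a => ∑ b ∈ Finset.range N,
    if a ∈ Q ∧ b ∉ Q then M a b else 0) (fun _ _ => Nat.zero_le _) (Finset.mem_range.2 ha)
  simp only [h1, h2, not_false_eq_true, and_self, if_true] at h
  refine h.trans (le_trans ?_ h')
  simp [h1]

/-- `Q` consists of nodes below `N` other than the sinks. -/
def Admissible (N : ℕ) (sink : ℕ → Prop) (Q : Finset ℕ) : Prop := ∀ a ∈ Q, a < N ∧ ¬sink a

/-- Every admissible set that properly contains `Q` has a larger cut. -/
structure IsImportant (N : ℕ) (M : ℕ → ℕ → ℕ) (sink : ℕ → Prop) (Q : Finset ℕ) : Prop where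
  admissible : Admissible N sink Q
  lt_cut : ∀ Q', Q ⊂ Q' → Admissible N sink Q' → cut N M Q < cut N M Q'

theorem Admissible.union {Q Q' : Finset ℕ} (h : Admissible N sink Q) (h' : Admissible N sink Q') :
    Admissible N sink (Q ∪ Q') := fun a ha => (Finset.mem_union.1 ha).elim (h a) (h' a)

theorem Admissible.inter {Q Q' : Finset ℕ} (h : Admissible N sink Q) :
    Admissible N sink (Q ∩ Q') := fun a ha => h a (Finset.mem_inter.1 ha).1

/-- Uncrossing: by submodularity the union has a cut no larger than that of `Q`, so importance
forces it to equal `Q`. -/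
theorem IsImportant.subset_of_cut_le {Q Q' : Finset ℕ} (h : IsImportant N M sink Q)
    (hQ' : Admissible N sink Q') (hle : cut N M Q' ≤ cut N M (Q ∩ Q')) : Q' ⊆ Q := by
  by_contra hne
  have h1 := h.lt_cut (Q ∪ Q') ⟨Finset.subset_union_left, fun h' => hne
    (Finset.subset_union_right.trans h')⟩ (h.admissible.union hQ')
  have h2 := cut_inter_add_cut_union (N := N) (M := M) Q Q'
  omega

/-- A largest set among the admissible sets that contain `A` and have the least possible cut. -/
theorem exists_largest_cut {A : Finset ℕ} (hA : Admissible N sink A) :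
    ∃ Q, A ⊆ Q ∧ Admissible N sink Q ∧
      (∀ Q', A ⊆ Q' → Admissible N sink Q' → cut N M Q ≤ cut N M Q') ∧
      ∀ Q', Q ⊂ Q' → Admissible N sink Q' → cut N M Q < cut N M Q' := by
  classical
  let S : Finset (Finset ℕ) :=
    (Finset.range N).powerset.filter fun Q => A ⊆ Q ∧ Admissible N sink Q
  have hmem : ∀ Q, Q ∈ S ↔ A ⊆ Q ∧ Admissible N sink Q := fun Q => by
    simp only [S, Finset.mem_filter, Finset.mem_powerset, and_iff_right_iff_imp]
    exact fun h a ha => Finset.mem_range.2 (h.2 a ha).1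
  obtain ⟨Q₀, h0, hmin⟩ := S.exists_min_image (cut N M) ⟨A, (hmem A).2 ⟨subset_rfl, hA⟩⟩
  let S' := S.filter fun Q => cut N M Q ≤ cut N M Q₀
  obtain ⟨Q, hQ⟩ := S'.exists_maximal ⟨Q₀, Finset.mem_filter.2 ⟨h0, le_rfl⟩⟩
  have h1 := Finset.mem_filter.1 hQ.1
  have h2 := (hmem Q).1 h1.1
  refine ⟨Q, h2.1, h2.2, fun Q' hA' hQ' => h1.2.trans (hmin Q' ((hmem Q').2 ⟨hA', hQ'⟩)),
    fun Q' hlt hQ' => ?_⟩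
  by_contra! hle
  exact hQ.not_gt (Finset.mem_filter.2 ⟨(hmem Q').2 ⟨h2.1.trans hlt.1, hQ'⟩, hle.trans h1.2⟩) hlt

end Cut

/-! ### The network with split vertices and its important cuts -/

namespace Instance
variable (I : Instance)

open Classical in
/-- The network in which each vertex `v` of an instance is split into the nodes `v` and `n + v`,
joined by an arc of capacity `1`; edges have the capacity `k + 1`. -/
noncomputable def cap (a b : ℕ) : ℕ :=
  if a < I.n ∧ b = I.n + a then 1 else if I.n ≤ a ∧ I.adj (a - I.n) b then I.k + 1 else 0

/-- The nodes of the network that belong to `W`. -/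
def sink (a : ℕ) : Prop := I.inW a ∨ (I.n ≤ a ∧ I.inW (a - I.n))

/-- There is an important set of nodes with a cut of size at most `k` that contains the node
`n + v` and has a boundary in `U`. -/
def Covered (U : ℕ → Prop) (v : ℕ) : Prop :=
  ∃ Q, IsImportant (2 * I.n) I.cap I.sink Q ∧ I.n + v ∈ Q ∧ cut (2 * I.n) I.cap Q ≤ I.k ∧
    ∀ u < I.n, u ∈ Q → I.n + u ∉ Q → U u

variable {I}

theorem inW_iff {v : Fin I.n} : I.inW v ↔ v ∈ I.W := by simp [inW]

theorem sink_iff {v : Fin I.n} : I.sink v ↔ v ∈ I.W := by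
  have := v.2
  rw [sink, inW_iff]
  simp only [or_iff_left_iff_imp]
  omega

theorem sink_add_iff {v : Fin I.n} : I.sink (I.n + v) ↔ v ∈ I.W := by
  rw [sink, Nat.add_sub_cancel_left, inW_iff]
  simp [inW]

theorem adj_iff {u v : Fin I.n} : I.adj u v ↔ I.G.Adj u v := by simp [adj]

theorem Covered.notMem {U : ℕ → Prop} {v : Fin I.n} (h : I.Covered U v) : v ∉ I.W := by
  obtain ⟨Q, h1, h2, -⟩ := h
  exact fun hv => (h1.admissible _ h2).2 (sink_add_iff.2 hv)

theorem cap_self {v : ℕ} (hv : v < I.n) : I.cap v (I.n + v) = 1 := by simp [cap, hv]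

theorem cap_adj {u v : Fin I.n} (h : I.G.Adj u v) : I.cap (I.n + u) v = I.k + 1 := by
  simp [cap, adj_iff, h]

/-- An edge that leaves `Q` would alone cost `k + 1`; thus only the unit arcs of vertices are cut.
-/
theorem mem_of_adj {Q : Finset ℕ} (hQ : cut (2 * I.n) I.cap Q ≤ I.k) {u v : Fin I.n}
    (h : I.G.Adj u v) (hu : I.n + u ∈ Q) : (v : ℕ) ∈ Q := by
  by_contra hv
  have h1 := le_cut (N := 2 * I.n) (M := I.cap) (by omega) (by omega) hu hv
  rw [cap_adj h] at h1
  omega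

theorem card_le_cut {Q : Finset ℕ} {X : Finset (Fin I.n)}
    (h : ∀ x ∈ X, (x : ℕ) ∈ Q ∧ I.n + x ∉ Q) : X.card ≤ cut (2 * I.n) I.cap Q := by
  rw [← Finset.card_map Fin.valEmbedding, Finset.card_eq_sum_ones]
  refine le_trans (Finset.sum_le_sum (g := fun a => ∑ b ∈ Finset.range (2 * I.n),
    if a ∈ Q ∧ b ∉ Q then I.cap a b else 0) fun a ha => ?_)
    (Finset.sum_le_sum_of_subset fun a ha => ?_)
  · obtain ⟨x, hx, rfl⟩ := Finset.mem_map.1 ha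
    refine le_trans ?_ (Finset.single_le_sum (f := fun b =>
      if Fin.valEmbedding x ∈ Q ∧ b ∉ Q then I.cap (Fin.valEmbedding x) b else 0)
      (fun _ _ => Nat.zero_le _) (Finset.mem_range.2 (show I.n + x < 2 * I.n by omega)))
    simp [h x hx, cap_self]
  · obtain ⟨x, hx, rfl⟩ := Finset.mem_map.1 ha
    simp only [Fin.valEmbedding_apply, Finset.mem_range]
    omega

/-- The nodes that correspond to a set of vertices; of its boundary vertices, only the first
node is taken. -/
noncomputable def nodes (B : Finset (Fin I.n)) : Finset ℕ :=
  B.map Fin.valEmbedding ∪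
    (B \ boundary I.G B).map (Fin.valEmbedding.trans (addLeftEmbedding I.n))

theorem mem_nodes {B : Finset (Fin I.n)} {v : Fin I.n} : (v : ℕ) ∈ nodes B ↔ v ∈ B := by
  have := v.2
  simp only [nodes, Finset.mem_union, Finset.mem_map, Fin.valEmbedding_apply,
    Function.Embedding.trans_apply, addLeftEmbedding_apply, Fin.val_inj, exists_eq_right,
    or_iff_left_iff_imp]
  rintro ⟨a, -, h⟩
  omega

theorem add_mem_nodes {B : Finset (Fin I.n)} {v : Fin I.n} :
    I.n + v ∈ nodes B ↔ v ∈ B ∧ v ∉ boundary I.G B := by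
  simp only [nodes, Finset.mem_union, Finset.mem_map, Fin.valEmbedding_apply,
    Function.Embedding.trans_apply, addLeftEmbedding_apply, add_right_inj, Fin.val_inj,
    exists_eq_right, Finset.mem_sdiff, or_iff_right_iff_imp]
  rintro ⟨a, -, h⟩
  omega

theorem node_cases {a : ℕ} (ha : a < 2 * I.n) :
    ∃ v : Fin I.n, a = v ∨ a = I.n + v := by
  rcases lt_or_ge a I.n with h | h
  · exact ⟨⟨a, h⟩, .inl rfl⟩
  · exact ⟨⟨a - I.n, by omega⟩, .inr (by simp; omega)⟩

theorem lt_of_mem_nodes {B : Finset (Fin I.n)} {a : ℕ} (h : a ∈ nodes B) : a < 2 * I.n := by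
  simp only [nodes, Finset.mem_union, Finset.mem_map, Fin.valEmbedding_apply,
    Function.Embedding.trans_apply, addLeftEmbedding_apply] at h
  rcases h with ⟨v, -, rfl⟩ | ⟨v, -, rfl⟩ <;> omega

/-- Since the second nodes of boundary vertices are left out, no edge leaves the set, only the unit
arcs of the boundary vertices. -/
theorem cut_nodes_le (B : Finset (Fin I.n)) :
    cut (2 * I.n) I.cap (nodes B) ≤ (boundary I.G B).card := by
  have key : ∀ a ∈ Finset.range (2 * I.n), (∑ b ∈ Finset.range (2 * I.n),
      if a ∈ nodes B ∧ b ∉ nodes B then I.cap a b else 0) ≤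
      if a ∈ (boundary I.G B).map Fin.valEmbedding then 1 else 0 := by
    intro a ha
    obtain ⟨v, rfl | rfl⟩ := node_cases (Finset.mem_range.1 ha)
    · have h1 : (v : ℕ) ∈ (boundary I.G B).map Fin.valEmbedding ↔ v ∈ boundary I.G B := by
        simp [Fin.val_inj]
      simp only [h1]
      refine le_trans (Finset.sum_le_sum (g := fun b =>
        if b = I.n + v then if v ∈ boundary I.G B then 1 else 0 else 0) fun b _ => ?_)
        (by rw [Finset.sum_ite_eq']; split_ifs <;> simp)
      by_cases hb : b = I.n + v
      · subst hb
        simp only [if_pos, add_mem_nodes, mem_nodes, cap_self v.2]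
        split_ifs <;> simp_all
      · rw [if_neg hb]
        have : ¬I.n ≤ v := by omega
        simp [cap, hb, this]
    · refine le_trans (le_of_eq (Finset.sum_eq_zero fun b hb => ?_)) (Nat.zero_le _)
      rw [ite_eq_right_iff]
      rintro ⟨h1, h2⟩
      rw [add_mem_nodes] at h1
      have h3 : ¬I.n + v < I.n := by omega
      rw [cap, if_neg (fun h => h3 h.1), Nat.add_sub_cancel_left]
      refine if_neg ?_
      rintro ⟨-, hvn, hbn, hadj⟩
      exact h1.2 (mem_boundary.2 ⟨h1.1, ⟨b, hbn⟩, hadj, fun hB => h2 (mem_nodes.2 hB)⟩)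
  refine (Finset.sum_le_sum key).trans ?_
  rw [← Finset.sum_filter, ← Finset.card_eq_sum_ones, ← Finset.card_map Fin.valEmbedding]
  exact Finset.card_le_card fun a ha => (Finset.mem_filter.1 ha).2

namespace IsExtremal
variable {B : Finset (Fin I.n)}

/-- The vertices whose first node lies in a competing `Q` form a set with at most `k` boundary
vertices, which is `B` by maximality. A second node in `Q` then belongs to a vertex with all
neighbours in `B`, hence to an interior vertex of `B`; so `Q` is not larger after all. -/
theorem isImportant_nodes (h : I.IsExtremal B) :
    IsImportant (2 * I.n) I.cap I.sink (nodes B) := by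
  classical
  refine ⟨fun a ha => ⟨lt_of_mem_nodes ha, ?_⟩, fun Q hlt hQ => ?_⟩
  · obtain ⟨v, rfl | rfl⟩ := node_cases (lt_of_mem_nodes ha)
    · rw [sink_iff]
      exact Finset.disjoint_left.1 h.disjoint (mem_nodes.1 ha)
    · rw [sink_add_iff]
      exact Finset.disjoint_left.1 h.disjoint (add_mem_nodes.1 ha).1
  · by_contra! hle
    have hk : cut (2 * I.n) I.cap Q ≤ I.k :=
      hle.trans ((cut_nodes_le B).trans h.isSolution.card_le)
    let B' : Finset (Fin I.n) := {v | (v : ℕ) ∈ Q}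
    have hB' : ∀ v, v ∈ B' ↔ (v : ℕ) ∈ Q := by simp [B']
    have hsub : B ⊆ B' := fun v hv => (hB' v).2 (hlt.1 (mem_nodes.2 hv))
    have hd : Disjoint B' I.W := Finset.disjoint_left.2 fun v hv hw =>
      (hQ v ((hB' v).1 hv)).2 (sink_iff.2 hw)
    have hb : (boundary I.G B').card ≤ cut (2 * I.n) I.cap Q := by
      refine card_le_cut fun x hx => ?_
      obtain ⟨h1, u, hxu, hu⟩ := mem_boundary.1 hx
      exact ⟨(hB' x).1 h1, fun h2 => hu ((hB' u).2 (mem_of_adj hk hxu h2))⟩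
    have hBB : B' = B := by
      by_contra hne
      have := h.lt_card B' (hsub.ssubset_of_ne (Ne.symm hne)) hd
      omega
    refine hlt.2 fun a ha => ?_
    obtain ⟨v, rfl | rfl⟩ := node_cases (hQ a ha).1
    · exact mem_nodes.2 (hBB ▸ (hB' v).2 ha)
    · have hN : ∀ u, I.G.Adj v u → u ∈ B := fun u hu => hBB ▸ (hB' u).2 (mem_of_adj hk hu ha)
      refine add_mem_nodes.2 ⟨h.mem_of_forall_adj
        (fun hw => (hQ _ ha).2 (sink_add_iff.2 hw)) hN, fun hv => ?_⟩
      obtain ⟨-, u, hu, hu'⟩ := mem_boundary.1 hv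
      exact hu' (hN u hu)

theorem covered (h : I.IsExtremal B) {U : ℕ → Prop} (hU : ∀ x ∈ boundary I.G B, U x) {v : Fin I.n}
    (hv : v ∈ B) (hv' : v ∉ boundary I.G B) : I.Covered U v := by
  refine ⟨nodes B, h.isImportant_nodes, add_mem_nodes.2 ⟨hv, hv'⟩,
    (cut_nodes_le B).trans h.isSolution.card_le, fun u hu h1 h2 => ?_⟩
  lift u to Fin I.n using hu
  rw [mem_nodes] at h1
  rw [add_mem_nodes, not_and, not_not] at h2
  exact hU u (h2 h1)

/-- Otherwise `Q` could be left only through boundary vertices of `B`. But `x` has a neighbour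
outside `B`, which is connected to `W` without using them, so `Q` would reach a sink. -/
theorem exists_boundary_node (h : I.IsExtremal B) {x : Fin I.n} (hx : x ∈ boundary I.G B)
    {Q : Finset ℕ} (hQ : Admissible (2 * I.n) I.sink Q) (hk : cut (2 * I.n) I.cap Q ≤ I.k)
    (hxQ : I.n + x ∈ Q) : ∃ y : Fin I.n, y ∉ boundary I.G B ∧ (y : ℕ) ∈ Q ∧ I.n + y ∉ Q := by
  by_contra! hcon
  obtain ⟨-, r, hxr, hr⟩ := mem_boundary.1 hx
  obtain ⟨w, hw, hc⟩ := h.exists_connectedOff hr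
  have : (w : ℕ) ∈ Q := hc.rec_tail (P := fun b => (b : ℕ) ∈ Q) (mem_of_adj hk hxr hxQ)
    fun a b ha haX _ hab => mem_of_adj hk hab (hcon a haX ha)
  exact (hQ _ this).2 (sink_iff.2 hw)

/-- Here `j` bounds the gap between `k + 1` and the least cut around `A`. Let `Q₀` be the largest
set of least cut and `y` a vertex on its boundary outside the solution. Every important `Q` around
`A` contains `Q₀`, so either `y` is on the boundary of `Q`, and putting `y` into `H` settles the
matter, or `Q` also contains the second node of `y`. In that case the gap has shrunk. -/
theorem exists_hitting_of_le_cut (h : I.IsExtremal B) {x : Fin I.n} (hx : x ∈ boundary I.G B)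
    (j : ℕ) : ∀ A, I.n + x ∈ A →
      (∀ Q, A ⊆ Q → Admissible (2 * I.n) I.sink Q → I.k + 1 ≤ cut (2 * I.n) I.cap Q + j) →
      ∃ H : Finset (Fin I.n), H.card ≤ j ∧ Disjoint H (boundary I.G B) ∧
        ∀ U : ℕ → Prop, (∀ y ∈ H, ¬U y) → ∀ Q, IsImportant (2 * I.n) I.cap I.sink Q → A ⊆ Q →
          cut (2 * I.n) I.cap Q ≤ I.k → ∃ u < I.n, u ∈ Q ∧ I.n + u ∉ Q ∧ ¬U u := by
  classical
  induction j with
  | zero =>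
    intro A _ hA
    refine ⟨∅, by simp, by simp, fun U _ Q hQ hAQ hk => ?_⟩
    have := hA Q hAQ hQ.admissible
    omega
  | succ j ih =>
    intro A hxA hA
    by_cases hk : ∃ Q, A ⊆ Q ∧ Admissible (2 * I.n) I.sink Q ∧ cut (2 * I.n) I.cap Q ≤ I.k
    swap
    · exact ⟨∅, by simp, by simp, fun U _ Q hQ hAQ hk' => (hk ⟨Q, hAQ, hQ.admissible, hk'⟩).elim⟩
    obtain ⟨Q₁, h1, h2, h3⟩ := hk
    obtain ⟨Q₀, hAQ, hQ₀, hmin, hmax⟩ := exists_largest_cut (M := I.cap)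
      (fun a ha => h2 a (h1 ha) : Admissible (2 * I.n) I.sink A)
    have hk := (hmin Q₁ h1 h2).trans h3
    obtain ⟨y, hyX, hy, hy'⟩ := h.exists_boundary_node hx hQ₀ hk (hAQ hxA)
    -- As `Q₀` is largest among the least cuts, sets that properly contain it have a cut larger by
    -- at least one.
    obtain ⟨H, hH, hd, hU⟩ := ih (insert (I.n + y) Q₀) (Finset.mem_insert_of_mem (hAQ hxA)) (by
      intro Q hQ hQa
      have h4 := hmax Q ⟨(Finset.subset_insert _ _).trans hQ, fun h' =>
        hy' (h' (hQ (Finset.mem_insert_self _ _)))⟩ hQa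
      have h5 := hA Q₀ hAQ hQ₀
      omega)
    refine ⟨insert y H, (Finset.card_insert_le _ _).trans (by omega),
      Finset.disjoint_insert_left.2 ⟨hyX, hd⟩, fun U hUH Q hQ hAQ' hQk => ?_⟩
    have hsub : Q₀ ⊆ Q := hQ.subset_of_cut_le hQ₀
      (hmin _ (Finset.subset_inter hAQ' hAQ) hQ.admissible.inter)
    by_cases hyQ : I.n + y ∈ Q
    · exact hU U (fun z hz => hUH z (Finset.mem_insert_of_mem hz)) Q hQ
        (Finset.insert_subset hyQ hsub) hQk
    · exact ⟨y, y.2, hsub hy, hyQ, hUH y (Finset.mem_insert_self _ _)⟩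

theorem exists_hitting (h : I.IsExtremal B) {x : Fin I.n} (hx : x ∈ boundary I.G B) :
    ∃ H : Finset (Fin I.n), H.card ≤ I.k + 1 ∧ Disjoint H (boundary I.G B) ∧
      ∀ U : ℕ → Prop, (∀ y ∈ H, ¬U y) → ¬I.Covered U x := by
  obtain ⟨H, h1, h2, h3⟩ := h.exists_hitting_of_le_cut hx (I.k + 1) {I.n + (x : ℕ)} (by simp)
    fun _ _ _ => Nat.le_add_left _ _
  refine ⟨H, h1, h2, fun U hU ⟨Q, hQ, hxQ, hk, hQU⟩ => ?_⟩
  obtain ⟨u, hu, h4, h5, h6⟩ := h3 U hU Q hQ (by simpa using hxQ) hk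
  exact h6 (hQU u hu h4 h5)

end IsExtremal
end Instance
end VMC

/-! ### A small family of colourings that separates small sets -/

namespace Splitter
open RAM Finset

/-- The number of colourings among the first `r` in which `u` and `v` have the same colour. -/
noncomputable def collisions (L : ℕ) (H : ℕ → ℕ → ℕ) (r u v : ℕ) : ℕ :=
  ∑ r' ∈ range L, bit (r' < r ∧ H r' u = H r' v)

/-- The total weight of the pairs `u < v` that collide if `v` gets the colour `c`. -/
noncomputable def cost (n L : ℕ) (H : ℕ → ℕ → ℕ) (r v c : ℕ) : ℕ :=
  ∑ u ∈ range n, if u < v ∧ H r u = c then 2 ^ collisions L H r u v else 0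

/-- The colour of `v` in the colouring `r` is one of least cost. -/
def IsGood (n L q : ℕ) (H : ℕ → ℕ → ℕ) (r v : ℕ) : Prop :=
  H r v < q ∧ ∀ c < q, cost n L H r v (H r v) ≤ cost n L H r v c

variable {n L q m : ℕ} {H : ℕ → ℕ → ℕ}

theorem collisions_comm (r u v : ℕ) : collisions L H r u v = collisions L H r v u := by
  simp only [collisions, eq_comm]

theorem collisions_succ {r : ℕ} (hr : r < L) (u v : ℕ) :
    collisions L H (r + 1) u v = collisions L H r u v + bit (H r u = H r v) := by
  have : bit (H r u = H r v) = ∑ r' ∈ range L, if r' = r then bit (H r u = H r v) else 0 := by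
    rw [sum_ite_eq', if_pos (mem_range.2 hr)]
  rw [collisions, collisions, this, ← sum_add_distrib]
  refine sum_congr rfl fun r' _ => ?_
  rcases lt_trichotomy r' r with h | rfl | h
  · simp [h, h.ne, h.trans (Nat.lt_succ_self r)]
  · simp [bit]
  · have h1 : ¬r' < r + 1 := by omega
    simp [bit, h.ne', h1, h.not_gt]

/-- The total weight of all pairs. -/
noncomputable def potential (n L : ℕ) (H : ℕ → ℕ → ℕ) (r : ℕ) : ℕ :=
  ∑ v ∈ range n, ∑ u ∈ range n, if u < v then 2 ^ collisions L H r u v else 0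

/-- The weight of a pair doubles when it collides, so the potential grows by the weight of the
colliding pairs. -/
theorem potential_succ {r : ℕ} (hr : r < L) : potential n L H (r + 1) =
    potential n L H r + ∑ v ∈ range n, cost n L H r v (H r v) := by
  simp only [potential, cost, ← sum_add_distrib]
  refine sum_congr rfl fun v _ => sum_congr rfl fun u _ => ?_
  by_cases h : u < v <;> by_cases h' : H r u = H r v <;>
    simp [h, h', collisions_succ hr, bit, pow_succ, mul_two]

theorem sum_cost {r v : ℕ} (hH : ∀ u < n, H r u < q) : ∑ c ∈ range q, cost n L H r v c =
    ∑ u ∈ range n, if u < v then 2 ^ collisions L H r u v else 0 := by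
  simp only [cost]
  rw [sum_comm]
  refine sum_congr rfl fun u hu => ?_
  by_cases h : u < v
  · simp [h, sum_ite_eq, hH u (mem_range.1 hu)]
  · simp [h]

/-- A colour of least cost costs at most the average over all `q` colours. Hence a round multiplies
the potential by at most `1 + 1 / q`, the expected growth under a random colouring. -/
theorem mul_potential_succ_le (hH : ∀ r < L, ∀ v < n, IsGood n L q H r v) {r : ℕ} (hr : r < L) :
    q * potential n L H (r + 1) ≤ (q + 1) * potential n L H r := by
  have key : q * ∑ v ∈ range n, cost n L H r v (H r v) ≤ potential n L H r := by
    rw [mul_sum]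
    refine sum_le_sum fun v hv => ?_
    rw [← sum_cost fun u hu => (hH r hr u hu).1]
    have := card_nsmul_le_sum (range q) (cost n L H r v) (cost n L H r v (H r v))
      fun c hc => (hH r hr v (mem_range.1 hv)).2 c (mem_range.1 hc)
    simpa using this
  rw [potential_succ hr]
  linarith

theorem pow_mul_potential_le (hH : ∀ r < L, ∀ v < n, IsGood n L q H r v) {r : ℕ} (hr : r ≤ L) :
    q ^ r * potential n L H r ≤ (q + 1) ^ r * n ^ 2 := by
  induction r with
  | zero =>
    have : potential n L H 0 ≤ ∑ v ∈ range n, ∑ u ∈ range n, 1 :=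
      sum_le_sum fun v _ => sum_le_sum fun u _ => by
        have : collisions L H 0 u v = 0 := by simp [collisions, bit]
        split_ifs <;> simp [this]
    simpa [sq] using this
  | succ r ih =>
    calc q ^ (r + 1) * potential n L H (r + 1) = q ^ r * (q * potential n L H (r + 1)) := by ring
      _ ≤ q ^ r * ((q + 1) * potential n L H r) :=
          Nat.mul_le_mul_left _ (mul_potential_succ_le hH hr)
      _ = (q + 1) * (q ^ r * potential n L H r) := by ring
      _ ≤ (q + 1) * ((q + 1) ^ r * n ^ 2) := Nat.mul_le_mul_left _ (ih (by omega))
      _ = _ := by ring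

theorem succ_pow_self_le (hq : 0 < q) : (q + 1) ^ q ≤ 4 * q ^ q := by
  have hq' : (0 : ℝ) < q := by exact_mod_cast hq
  have h1 : ((1 / q : ℝ) + 1) ^ q ≤ 4 := by
    calc ((1 / q : ℝ) + 1) ^ q ≤ Real.exp (1 / q) ^ q :=
          pow_le_pow_left₀ (by positivity) (Real.add_one_le_exp _) _
      _ = Real.exp 1 := by rw [← Real.exp_nat_mul]; congr 1; field_simp
      _ ≤ 4 := by linarith [Real.exp_one_lt_d9]
  have h2 : ((q : ℝ) + 1) ^ q = ((1 / q : ℝ) + 1) ^ q * (q : ℝ) ^ q := by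
    rw [← mul_pow]; congr 1; field_simp; ring
  have h3 : ((q : ℝ) + 1) ^ q ≤ 4 * (q : ℝ) ^ q := by
    rw [h2]; exact mul_le_mul_of_nonneg_right h1 (by positivity)
  exact_mod_cast h3

/-- A single pair contributes `2 ^ collisions` to the potential, which after `q * m` rounds is at
most `(1 + 1 / q) ^ (q * m) * n ^ 2 ≤ 4 ^ m * n ^ 2 < 2 ^ (4 * m)`. -/
theorem collisions_lt (hq : 0 < q) (hn : n < 2 ^ m)
    (hH : ∀ r < q * m, ∀ v < n, IsGood n (q * m) q H r v) {u v : ℕ} (hu : u < n) (hv : v < n)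
    (huv : u ≠ v) : collisions (q * m) H (q * m) u v < 4 * m := by
  wlog h : u < v generalizing u v
  · rw [collisions_comm]
    exact this hv hu huv.symm (by omega)
  have h1 : 2 ^ collisions (q * m) H (q * m) u v ≤ potential n (q * m) H (q * m) := by
    refine le_trans ?_ (single_le_sum (f := fun v => ∑ u ∈ range n,
      if u < v then 2 ^ collisions (q * m) H (q * m) u v else 0) (fun _ _ => Nat.zero_le _)
      (mem_range.2 hv))
    refine le_trans ?_ (single_le_sum (f := fun u =>
      if u < v then 2 ^ collisions (q * m) H (q * m) u v else 0) (fun _ _ => Nat.zero_le _)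
      (mem_range.2 hu))
    simp [h]
  have h2 : (q + 1) ^ (q * m) ≤ 4 ^ m * q ^ (q * m) := by
    rw [pow_mul, pow_mul, ← mul_pow]
    exact Nat.pow_le_pow_left (succ_pow_self_le hq) _
  have h3 : potential n (q * m) H (q * m) ≤ 4 ^ m * n ^ 2 := by
    refine Nat.le_of_mul_le_mul_left (c := q ^ (q * m)) ?_ (by positivity)
    calc _ ≤ (q + 1) ^ (q * m) * n ^ 2 := pow_mul_potential_le hH le_rfl
      _ ≤ 4 ^ m * q ^ (q * m) * n ^ 2 := Nat.mul_le_mul_right _ h2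
      _ = _ := by ring
  have h4 : n ^ 2 < (2 ^ m) ^ 2 := Nat.pow_lt_pow_left hn (by omega)
  refine (Nat.pow_lt_pow_iff_right (by omega : 1 < 2)).1 ?_
  calc _ ≤ 4 ^ m * n ^ 2 := h1.trans h3
    _ < 4 ^ m * (2 ^ m) ^ 2 := Nat.mul_lt_mul_of_pos_left h4 (by positivity)
    _ = 2 ^ (4 * m) := by
      rw [show 4 = 2 ^ 2 from rfl, ← pow_mul, ← pow_mul, ← pow_add]; congr 1; omega

/-- The `p` pairs together spoil at most `4 * p * m` colourings, fewer than there are. -/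
theorem exists_separating (hm : 0 < m) (hn : n < 2 ^ m) {p : ℕ}
    (hH : ∀ r < (4 * p + 1) * m, ∀ v < n, IsGood n ((4 * p + 1) * m) (4 * p + 1) H r v)
    {P : Finset (ℕ × ℕ)} (hP : P.card ≤ p) (hPn : ∀ e ∈ P, e.1 < n ∧ e.2 < n ∧ e.1 ≠ e.2) :
    ∃ r < (4 * p + 1) * m, ∀ e ∈ P, H r e.1 ≠ H r e.2 := by
  by_contra! hcon
  set L := (4 * p + 1) * m with hL
  have h1 : L ≤ ∑ r ∈ range L, ∑ e ∈ P, bit (r < L ∧ H r e.1 = H r e.2) := by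
    calc L = ∑ r ∈ range L, 1 := by simp
      _ ≤ _ := sum_le_sum fun r hr => by
        obtain ⟨e, he, h⟩ := hcon r (mem_range.1 hr)
        refine le_trans ?_ (single_le_sum (f := fun e => bit (r < L ∧ H r e.1 = H r e.2))
          (fun _ _ => Nat.zero_le _) he)
        exact (bit_pos ⟨mem_range.1 hr, h⟩).ge
  rw [sum_comm] at h1
  have h2 : ∑ e ∈ P, collisions L H L e.1 e.2 ≤ P.card • (4 * m) :=
    sum_le_card_nsmul _ _ _ fun e he =>
      (collisions_lt (by omega) hn hH (hPn e he).1 (hPn e he).2.1 (hPn e he).2.2).le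
  have h3 : P.card • (4 * m) ≤ p * (4 * m) := Nat.mul_le_mul_right _ hP
  have h4 : L = p * (4 * m) + m := by rw [hL]; ring
  have h5 := h1.trans (h2.trans h3)
  omega

/-- A colour of least cost. -/
noncomputable def colour (n L q : ℕ) (H : ℕ → ℕ → ℕ) (r v : ℕ) : ℕ :=
  least q fun c => ∀ c' < q, cost n L H r v c ≤ cost n L H r v c'

/-- The table in which the vertex `v` has got its colour in the colouring `r`. -/
noncomputable def colourStep (n L q r v : ℕ) (H : ℕ → ℕ → ℕ) : ℕ → ℕ → ℕ :=
  tab L n fun i j => if i = r ∧ j = v then colour n L q H r v else H i j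

/-- The table of `L` colourings of `n` vertices. -/
noncomputable def colouring (n L q : ℕ) : ℕ → ℕ → ℕ :=
  iter (fun r H => iter (colourStep n L q r) H n) (tab L n fun _ _ => 0) L

/-- The cost at `(r, v)` depends only on earlier rows and on the entries before `v` in row `r`.
Therefore a good choice stays good when the table is filled further. -/
theorem cost_congr {H' : ℕ → ℕ → ℕ} {r v : ℕ} (hv : v < n)
    (h : ∀ r' < r, ∀ u < n, H r' u = H' r' u) (h' : ∀ u < v, H r u = H' r u) (c : ℕ) :
    cost n L H r v c = cost n L H' r v c := by
  refine sum_congr rfl fun u hu => ?_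
  have h1 : collisions L H r u v = collisions L H' r u v := by
    refine sum_congr rfl fun r' _ => ?_
    by_cases hr : r' < r
    · rw [h r' hr u (mem_range.1 hu), h r' hr v hv]
    · simp [hr, bit]
  by_cases huv : u < v
  · simp only [huv, h' u huv, h1]
  · simp [huv]

theorem IsGood.congr {H' : ℕ → ℕ → ℕ} {r v : ℕ} (hg : IsGood n L q H r v) (hv : v < n)
    (h : ∀ r' < r, ∀ u < n, H r' u = H' r' u) (h' : ∀ u ≤ v, H r u = H' r u) :
    IsGood n L q H' r v := by
  have := fun c => cost_congr (L := L) hv h (fun u hu => h' u hu.le) c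
  rw [IsGood, ← h' v le_rfl]
  exact ⟨hg.1, fun c hc => by rw [← this, ← this]; exact hg.2 c hc⟩

theorem isGood_colourStep (hq : 0 < q) {r v : ℕ} (hr : r < L) (hv : v < n)
    (h : ∀ r' ≤ r, ∀ v' < n, (r' = r → v' < v) → IsGood n L q H r' v') :
    ∀ r' ≤ r, ∀ v' < n, (r' = r → v' < v + 1) →
      IsGood n L q (colourStep n L q r v H) r' v' := by
  have heq : ∀ r' ≤ r, ∀ v' < n, ¬(r' = r ∧ v' = v) → H r' v' = colourStep n L q r v H r' v' :=
    fun r' h1 v' h2 h3 => by rw [colourStep, tab_apply _ (by omega) h2, if_neg h3]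
  intro r' hr' v' hv' hlt
  by_cases hne : r' = r ∧ v' = v
  · obtain ⟨rfl, rfl⟩ := hne
    have hc : colourStep n L q r' v' H r' v' = colour n L q H r' v' := by
      rw [colourStep, tab_apply _ hr hv, if_pos ⟨rfl, rfl⟩]
    have hs := least_spec (N := q) (p := fun c =>
        ∀ c' < q, cost n L H r' v' c ≤ cost n L H r' v' c') (by
      obtain ⟨c, hc, hmin⟩ := (range q).exists_min_image (cost n L H r' v') ⟨0, mem_range.2 hq⟩
      exact ⟨c, mem_range.1 hc, fun c' hc' => hmin c' (mem_range.2 hc')⟩)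
    have hcost := fun c => cost_congr (L := L) (H := H) (H' := colourStep n L q r' v' H) hv
      (fun r'' h1 u hu => heq r'' h1.le u hu (by omega))
      (fun u hu => heq r' le_rfl u (by omega) (by omega)) c
    rw [IsGood, hc]
    exact ⟨hs.1, fun c hc => by rw [← hcost, ← hcost]; exact hs.2 c hc⟩
  · refine (h r' hr' v' hv' fun h1 => by have := hlt h1; omega).congr hv'
      (fun r'' h1 u hu => heq r'' (by omega) u hu (by omega)) fun u hu => heq r' hr' u (by omega) ?_
    rintro ⟨h1, h2⟩
    have := hlt h1
    omega

theorem isGood_colouring (hq : 0 < q) {r v : ℕ} (hr : r < L) (hv : v < n) :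
    IsGood n L q (colouring n L q) r v := by
  have inner : ∀ r < L, ∀ H, (∀ r' < r, ∀ v' < n, IsGood n L q H r' v') → ∀ v ≤ n,
      ∀ r' ≤ r, ∀ v' < n, (r' = r → v' < v) →
        IsGood n L q (iter (colourStep n L q r) H v) r' v' := by
    intro r hr H hH v
    induction v with
    | zero => exact fun _ r' hr' v' hv' h => hH r' (lt_of_le_of_ne hr' fun h' => by
        have := h h'; omega) v' hv'
    | succ v ih => exact fun hv => isGood_colourStep hq hr hv (ih (by omega))
  have outer : ∀ r ≤ L, ∀ r' < r, ∀ v' < n, IsGood n L q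
      (iter (fun r H => iter (colourStep n L q r) H n) (tab L n fun _ _ => 0) r) r' v' := by
    intro r
    induction r with
    | zero => exact fun _ r' h => absurd h (by omega)
    | succ r ih =>
      exact fun hr r' hr' v' hv' =>
        inner r hr _ (ih (by omega)) n le_rfl r' (by omega) v' hv' fun _ => hv'
  exact outer L le_rfl r hr v hv

/-- The vertices whose colour in the colouring `r` is one of the first `k` digits of `τ`. -/
def chosen (q k : ℕ) (H : ℕ → ℕ → ℕ) (r τ v : ℕ) : Prop := ∃ i < k, H r v = τ / q ^ i % q

theorem exists_chosen {k : ℕ} (hm : 0 < m) (hn : n < 2 ^ m) {p : ℕ}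
    (hH : ∀ r < (4 * p + 1) * m, ∀ v < n, IsGood n ((4 * p + 1) * m) (4 * p + 1) H r v)
    {X Y : Finset ℕ} (hX : X ⊆ range n) (hY : Y ⊆ range n) (hXY : Disjoint X Y) (hk : X.card ≤ k)
    (hp : X.card * Y.card ≤ p) (h0 : X = ∅ → Y = ∅) :
    ∃ r < (4 * p + 1) * m, ∃ τ < (4 * p + 1) ^ k, (∀ x ∈ X, chosen (4 * p + 1) k H r τ x) ∧
      ∀ y ∈ Y, ¬chosen (4 * p + 1) k H r τ y := by
  obtain ⟨r, hr, hsep⟩ := exists_separating hm hn hH (P := X ×ˢ Y) (by rwa [card_product])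
    fun e he => by
      obtain ⟨h1, h2⟩ := mem_product.1 he
      exact ⟨mem_range.1 (hX h1), mem_range.1 (hY h2), fun h => disjoint_left.1 hXY h1 (h ▸ h2)⟩
  refine ⟨r, hr, ?_⟩
  rcases X.eq_empty_or_nonempty with rfl | hne
  -- The digits always select some colours when `k` is positive, so for empty `X` nothing could be
  -- avoided; this is why `Y` is required to be empty then.
  · exact ⟨0, Nat.pow_pos (by omega), by simp, by simp [h0 rfl]⟩
  have : Nonempty X := hne.to_subtype
  obtain ⟨g⟩ : Nonempty (X ↪ Fin k) :=
    Function.Embedding.nonempty_of_card_le (by simpa using hk)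
  -- A surjection from the positions of the digits onto `X`: all digits are colours of vertices of
  -- `X`, with repetitions if there are more positions than vertices.
  have hg := Function.invFun_surjective g.injective
  set f : Fin k → X := Function.invFun g
  have hlt : ∀ x : X, H r x < 4 * p + 1 := fun x => (hH r hr x (mem_range.1 (hX x.2))).1
  set τ : Fin ((4 * p + 1) ^ k) := finFunctionFinEquiv fun i => ⟨H r (f i), hlt (f i)⟩ with hτ
  have hd : ∀ i : Fin k, (τ : ℕ) / (4 * p + 1) ^ (i : ℕ) % (4 * p + 1) = H r (f i) := fun i => by
    rw [← finFunctionFinEquiv_symm_apply_val, hτ, Equiv.symm_apply_apply]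
  refine ⟨τ, τ.2, fun x hx => ?_, fun y hy => ?_⟩
  · obtain ⟨i, hi⟩ := hg ⟨x, hx⟩
    exact ⟨i, i.2, by rw [hd, hi]⟩
  · rintro ⟨i, hi, h⟩
    rw [hd ⟨i, hi⟩] at h
    exact hsep (f ⟨i, hi⟩, y) (mem_product.2 ⟨(f ⟨i, hi⟩).2, hy⟩) h.symm

end Splitter

/-! ### Finding important cuts by augmenting paths -/

namespace Flow
open RAM VMC Finset

/-- One more round of the search for the nodes from which a sink can be reached: the nodes that
are found count the rounds. -/
noncomputable def reachStep (N : ℕ) (arc : ℕ → ℕ → Prop) (E : ℕ → ℕ → ℕ) : ℕ → ℕ → ℕ :=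
  tab 1 N fun _ a => E 0 a + bit (E 0 a ≠ 0 ∨ ∃ b < N, arc a b ∧ E 0 b ≠ 0)

/-- The rounds of the search for the nodes from which a sink can be reached. -/
noncomputable def reachIter (N : ℕ) (arc : ℕ → ℕ → Prop) (sink : ℕ → Prop) : ℕ → ℕ → ℕ → ℕ :=
  iter (fun _ => reachStep N arc) (tab 1 N fun _ a => bit (sink a))

/-- The row vector that is not zero at the nodes from which a sink can be reached, and that can be
increased along an arc at such a node unless it is a sink. -/
noncomputable def reach (N : ℕ) (arc : ℕ → ℕ → Prop) (sink : ℕ → Prop) : ℕ → ℕ → ℕ :=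
  reachIter N arc sink (N + 1)

section Reach
variable {N : ℕ} {arc : ℕ → ℕ → Prop} {sink : ℕ → Prop}

theorem reachIter_zero {a : ℕ} (ha : a < N) : reachIter N arc sink 0 0 a = bit (sink a) := by
  rw [reachIter, iter, tab_apply _ one_pos ha]

theorem reachIter_succ (t : ℕ) {a : ℕ} (ha : a < N) : reachIter N arc sink (t + 1) 0 a =
    reachIter N arc sink t 0 a + bit (reachIter N arc sink t 0 a ≠ 0 ∨
      ∃ b < N, arc a b ∧ reachIter N arc sink t 0 b ≠ 0) := by
  rw [reachIter, iter, reachStep, tab_apply _ one_pos ha]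

theorem bit_le_one (p : Prop) : bit p ≤ 1 := by
  by_cases h : p <;> simp [bit, h]

theorem reachIter_le (t : ℕ) {a : ℕ} (ha : a < N) : reachIter N arc sink t 0 a ≤ t + 1 := by
  induction t with
  | zero => rw [reachIter_zero ha]; exact bit_le_one _
  | succ t ih => rw [reachIter_succ t ha]; exact Nat.add_le_add ih (bit_le_one _)

theorem reachIter_ne_zero_of_sink (t : ℕ) {a : ℕ} (ha : a < N) (h : sink a) :
    reachIter N arc sink t 0 a ≠ 0 := by
  induction t with
  | zero => rw [reachIter_zero ha, bit_pos h]; omega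
  | succ t ih => rw [reachIter_succ t ha]; omega

/-- A node that is found in some round has an arc to a node found earlier, which has been counting
for longer. Following increasing values therefore leads to a sink. -/
theorem reachIter_climb (t : ℕ) {a : ℕ} (ha : a < N) (h : reachIter N arc sink t 0 a ≠ 0) :
    sink a ∨ ∃ b < N, arc a b ∧ reachIter N arc sink t 0 a < reachIter N arc sink t 0 b := by
  induction t with
  | zero => rw [reachIter_zero ha, bit_ne_zero] at h; exact .inl h
  | succ t ih =>
    by_cases h0 : reachIter N arc sink t 0 a = 0
    · rw [reachIter_succ t ha, h0, zero_add, bit_ne_zero] at h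
      obtain ⟨b, hb, hab, hne⟩ := h.resolve_left (by omega)
      refine .inr ⟨b, hb, hab, ?_⟩
      rw [reachIter_succ t ha, reachIter_succ t hb, h0,
        bit_pos (p := reachIter N arc sink t 0 b ≠ 0 ∨ _) (.inl hne)]
      have := bit_le_one (0 ≠ 0 ∨ ∃ b < N, arc a b ∧ reachIter N arc sink t 0 b ≠ 0)
      omega
    · refine (ih h0).imp id ?_
      rintro ⟨b, hb, hab, hlt⟩
      refine ⟨b, hb, hab, ?_⟩
      rw [reachIter_succ t ha, reachIter_succ t hb, bit_pos (.inl h0), bit_pos (.inl (by omega))]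
      omega

/-- While the set of nodes found is not closed, each round adds a node; with `N` nodes this cannot
go on for `N + 1` rounds. -/
theorem reachIter_closed : ∀ a < N, ∀ b < N, arc a b → reach N arc sink 0 b ≠ 0 →
    reach N arc sink 0 a ≠ 0 := by
  let E := fun t => reachIter N arc sink t 0
  let Closed := fun t => ∀ a < N, ∀ b < N, arc a b → E t b ≠ 0 → E t a ≠ 0
  let R := fun t => (range N).filter fun a => E t a ≠ 0
  have hmono : ∀ t, ∀ a < N, E t a ≠ 0 → E (t + 1) a ≠ 0 := fun t a ha h => by
    simp only [E] at h ⊢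
    rw [reachIter_succ t ha]
    omega
  have hcl : ∀ t, Closed t → ∀ a < N, E (t + 1) a ≠ 0 → E t a ≠ 0 := by
    intro t ht a ha h h0
    simp only [E] at h h0
    rw [reachIter_succ t ha, h0, zero_add, bit_ne_zero] at h
    obtain ⟨b, hb, hab, hne⟩ := h.resolve_left (by omega)
    exact ht a ha b hb hab hne h0
  have key : ∀ t, Closed t ∨ t ≤ (R t).card := by
    intro t
    induction t with
    | zero => exact .inr (Nat.zero_le _)
    | succ t ih =>
      by_cases hc : Closed t
      · exact .inl fun a ha b hb hab h => hmono t a ha (hc a ha b hb hab (hcl t hc b hb h))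
      · refine .inr (lt_of_le_of_lt (ih.resolve_left hc) (card_lt_card ?_))
        simp only [Closed, not_forall] at hc
        obtain ⟨a, ha, b, hb, hab, h, h0⟩ := hc
        have ha' : E (t + 1) a ≠ 0 := by
          simp only [E]
          rw [reachIter_succ t ha, bit_pos (.inr ⟨b, hb, hab, h⟩)]
          omega
        refine (ssubset_iff_of_subset fun x hx => ?_).2 ⟨a, ?_, ?_⟩
        · rw [mem_filter] at hx ⊢
          exact ⟨hx.1, hmono t x (mem_range.1 hx.1) hx.2⟩
        · exact mem_filter.2 ⟨mem_range.2 ha, ha'⟩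
        · exact fun h' => h0 (mem_filter.1 h').2
  refine (key (N + 1)).resolve_right fun h => ?_
  have := h.trans (card_filter_le _ _)
  rw [card_range] at this
  omega

theorem reach_ne_zero_iff (harc : ∀ a b, arc a b → b < N) {a : ℕ} (ha : a < N) :
    reach N arc sink 0 a ≠ 0 ↔ ∃ b < N, sink b ∧ Relation.ReflTransGen arc a b := by
  constructor
  · have : ∀ t, ∀ a < N, reachIter N arc sink t 0 a ≠ 0 →
        ∃ b < N, sink b ∧ Relation.ReflTransGen arc a b := by
      intro t
      induction t with
      | zero =>
        intro a ha h
        rw [reachIter_zero ha, bit_ne_zero] at h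
        exact ⟨a, ha, h, .refl⟩
      | succ t ih =>
        intro a ha h
        by_cases h0 : reachIter N arc sink t 0 a = 0
        · rw [reachIter_succ t ha, h0, zero_add, bit_ne_zero] at h
          obtain ⟨b, hb, hab, hne⟩ := h.resolve_left (by omega)
          obtain ⟨c, hc, hs, hbc⟩ := ih b hb hne
          exact ⟨c, hc, hs, .head hab hbc⟩
        · exact ih a ha h0
    exact this _ a ha
  · rintro ⟨b, hb, hs, hab⟩
    have key : a < N → reach N arc sink 0 a ≠ 0 := by
      induction hab using Relation.ReflTransGen.head_induction_on with
      | refl => exact fun _ => reachIter_ne_zero_of_sink _ hb hs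
      | head h _ ih =>
        exact fun ha => reachIter_closed _ ha _ (harc _ _ h) h (ih (harc _ _ h) (harc _ _ h))
    exact key ha

theorem reach_congr {arc' : ℕ → ℕ → Prop} (h : ∀ a < N, ∀ b < N, arc a b ↔ arc' a b) :
    reach N arc sink = reach N arc' sink := by
  have : reachStep N arc = reachStep N arc' := by
    funext E i a
    simp only [reachStep, tab]
    refine if_ctx_congr Iff.rfl (fun h1 => ?_) fun _ => rfl
    have : (∃ b < N, arc a b ∧ E 0 b ≠ 0) ↔ ∃ b < N, arc' a b ∧ E 0 b ≠ 0 :=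
      exists_congr fun b => and_congr_right fun hb => by rw [h a h1.2 b hb]
    rw [this]
  rw [reach, reach, reachIter, reachIter, this]

end Reach

/-- Reversing a unit of capacity on an arc changes the cuts by what is lost at its ends. -/
theorem cut_reverse {N : ℕ} {M M' : ℕ → ℕ → ℕ} {x y : ℕ} (hx : x < N) (hy : y < N) (hxy : x ≠ y)
    (hM : M x y ≠ 0) (hM' : ∀ a < N, ∀ b < N, M' a b = if a = x ∧ b = y then M a b - 1 else
      if a = y ∧ b = x then M a b + 1 else M a b) (Q : Finset ℕ) :
    cut N M' Q + (if x ∈ Q then 1 else 0) = cut N M Q + if y ∈ Q then 1 else 0 := by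
  have hsum : ∀ x < N, ∀ y < N, (∑ a ∈ range N, ∑ b ∈ range N,
      if a = x ∧ b = y ∧ a ∈ Q ∧ b ∉ Q then 1 else 0) = if x ∈ Q ∧ y ∉ Q then 1 else 0 := by
    intro x hx y hy
    rw [sum_eq_single x, sum_eq_single y]
    · simp
    · intro b _ hb; simp [hb]
    · simp [hy]
    · intro a _ ha; simp [ha]
    · simp [hx]
  have h1 : cut N M' Q + (if x ∈ Q ∧ y ∉ Q then 1 else 0) =
      cut N M Q + if y ∈ Q ∧ x ∉ Q then 1 else 0 := by
    rw [← hsum x hx y hy, ← hsum y hy x hx]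
    simp only [cut, ← sum_add_distrib]
    refine sum_congr rfl fun a ha => sum_congr rfl fun b hb => ?_
    rw [hM' a (mem_range.1 ha) b (mem_range.1 hb)]
    by_cases hQ : a ∈ Q ∧ b ∉ Q
    · simp only [hQ, not_false_eq_true, and_self, and_true, if_true]
      by_cases h1 : a = x ∧ b = y
      · obtain ⟨rfl, rfl⟩ := h1
        simp [hxy]
        omega
      · by_cases h2 : a = y ∧ b = x
        · simp [h2, hxy.symm]
        · simp [h1, h2]
    · simp [hQ]
  by_cases h2 : x ∈ Q <;> by_cases h3 : y ∈ Q <;> simp_all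

/-- The next node on the way to a sink. -/
noncomputable def next (N : ℕ) (E S : ℕ → ℕ → ℕ) (a : ℕ) : ℕ :=
  least N fun b => S a b ≠ 0 ∧ E 0 a < E 0 b

/-- The matrix `S` consists of the capacities of the arcs, the row `N` that marks the sources,
and the row `N + 1` that starts with the current node. Unless this is a sink, one moves to the
next node and reverses the arc. -/
noncomputable def pathStep (N : ℕ) (sink : ℕ → Prop) (E S : ℕ → ℕ → ℕ) : ℕ → ℕ → ℕ := by
  classical
  exact tab (N + 2) N fun i j =>
    if sink (S (N + 1) 0) then S i j else
    if i = N + 1 then next N E S (S (N + 1) 0) else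
    if i = S (N + 1) 0 ∧ j = next N E S (S (N + 1) 0) then S i j - 1 else
    if i = next N E S (S (N + 1) 0) ∧ j = S (N + 1) 0 then S i j + 1 else S i j

/-- Reversing a path from a source to a sink. -/
noncomputable def augment (N : ℕ) (sink : ℕ → Prop) (E S : ℕ → ℕ → ℕ) : ℕ → ℕ → ℕ :=
  iter (fun _ => pathStep N sink E) (tab (N + 2) N fun i j =>
    if i = N + 1 then least N (fun a => S N a ≠ 0 ∧ E 0 a ≠ 0) else S i j) (N + 2)

/-- Making sources of all nodes that do not reach a sink, and of the nodes pushed by them. -/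
noncomputable def advance (N : ℕ) (push : ℕ → ℕ → Prop) (E S : ℕ → ℕ → ℕ) : ℕ → ℕ → ℕ :=
  tab (N + 2) N fun i j =>
    if i = N then bit (E 0 j = 0 ∨ ∃ a < N, E 0 a = 0 ∧ push a j) else S i j

/-- The nodes of the network `S` that can reach a sink. -/
noncomputable def level (N : ℕ) (sink : ℕ → Prop) (S : ℕ → ℕ → ℕ) : ℕ → ℕ → ℕ :=
  reach N (fun a b => S a b ≠ 0) sink

/-- Some source can reach a sink. -/
def Active (N : ℕ) (E S : ℕ → ℕ → ℕ) : Prop := ∃ a < N, S N a ≠ 0 ∧ E 0 a ≠ 0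

/-- No node that cannot reach a sink pushes one that can. -/
def IsClosed (N : ℕ) (push : ℕ → ℕ → Prop) (E : ℕ → ℕ → ℕ) : Prop :=
  ∀ a < N, ∀ b < N, E 0 a = 0 → push a b → E 0 b = 0

/-- One step of the search for an important cut. -/
noncomputable def flowStep (N : ℕ) (sink : ℕ → Prop) (push : ℕ → ℕ → Prop) (S : ℕ → ℕ → ℕ) :
    ℕ → ℕ → ℕ := by
  classical
  exact if Active N (level N sink S) S then augment N sink (level N sink S) S
    else advance N push (level N sink S) S

/-- The matrix with which the search for an important cut around the node `s` starts. -/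
noncomputable def start (N : ℕ) (M : ℕ → ℕ → ℕ) (s : ℕ) : ℕ → ℕ → ℕ :=
  tab (N + 2) N fun i j => if i < N then M i j else if i = N then bit (j = s) else 0

/-- The search for an important cut of size at most `k` has succeeded. -/
def Succeeds (N : ℕ) (M : ℕ → ℕ → ℕ) (push : ℕ → ℕ → Prop) (k : ℕ) (E S : ℕ → ℕ → ℕ) :
    Prop :=
  ¬Active N E S ∧ IsClosed N push E ∧
    (∑ a ∈ range N, ∑ b ∈ range N, if E 0 a = 0 ∧ E 0 b ≠ 0 then M a b else 0) ≤ k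

variable {N : ℕ} {sink : ℕ → Prop} {push : ℕ → ℕ → Prop} {M S : ℕ → ℕ → ℕ}

theorem level_climb {a : ℕ} (ha : a < N) (h : level N sink S 0 a ≠ 0) :
    sink a ∨ ∃ b < N, S a b ≠ 0 ∧ level N sink S 0 a < level N sink S 0 b :=
  reachIter_climb _ ha h

theorem level_congr {S' : ℕ → ℕ → ℕ} (h : ∀ a < N, ∀ b < N, S a b = S' a b) :
    level N sink S = level N sink S' :=
  reach_congr fun a ha b hb => by rw [h a ha b hb]

theorem cut_congr {M' : ℕ → ℕ → ℕ} (h : ∀ a < N, ∀ b < N, M a b = M' a b) (Q : Finset ℕ) :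
    cut N M Q = cut N M' Q :=
  sum_congr rfl fun a ha => sum_congr rfl fun b hb => by
    rw [h a (mem_range.1 ha) b (mem_range.1 hb)]

/-- The nodes that cannot reach a sink. -/
def low (N : ℕ) (E : ℕ → ℕ → ℕ) : Finset ℕ := (range N).filter fun a => E 0 a = 0

theorem mem_low {E : ℕ → ℕ → ℕ} {a : ℕ} : a ∈ low N E ↔ a < N ∧ E 0 a = 0 := by simp [low]

theorem cut_low (E : ℕ → ℕ → ℕ) : cut N M (low N E) =
    ∑ a ∈ range N, ∑ b ∈ range N, if E 0 a = 0 ∧ E 0 b ≠ 0 then M a b else 0 := by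
  refine sum_congr rfl fun a ha => sum_congr rfl fun b hb => ?_
  simp [mem_low, mem_range.1 ha, mem_range.1 hb]

theorem admissible_low : Admissible N sink (low N (level N sink S)) := fun _ ha =>
  have h := mem_low.1 ha
  ⟨h.1, fun hs => reachIter_ne_zero_of_sink _ h.1 hs h.2⟩

theorem cut_low_level : cut N S (low N (level N sink S)) = 0 := by
  refine sum_eq_zero fun a ha => sum_eq_zero fun b hb => ?_
  rw [ite_eq_right_iff]
  rintro ⟨h1, h2⟩
  rw [mem_low, not_and] at h2
  by_contra h
  exact reachIter_closed (arc := fun a b => S a b ≠ 0) a (mem_range.1 ha) b (mem_range.1 hb) h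
    (h2 (mem_range.1 hb)) (mem_low.1 h1).2

/-- From a node of highest level in `Q` an arc climbs to a still higher node, which would be in `Q`
too. -/
theorem subset_low_of_cut_eq_zero {Q : Finset ℕ} (hQ : Admissible N sink Q) (h : cut N S Q = 0) :
    Q ⊆ low N (level N sink S) := by
  intro a ha
  by_contra hne
  obtain ⟨x, hx, hmax⟩ := (Q.filter fun a => level N sink S 0 a ≠ 0).exists_max_image
    (level N sink S 0) ⟨a, mem_filter.2 ⟨ha, fun h0 => hne (mem_low.2 ⟨(hQ a ha).1, h0⟩)⟩⟩
  rw [mem_filter] at hx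
  obtain ⟨b, hb, h1, h2⟩ := (level_climb (hQ x hx.1).1 hx.2).resolve_left (hQ x hx.1).2
  have hbQ : b ∈ Q := by
    by_contra hbQ
    have := le_cut (M := S) (hQ x hx.1).1 hb hx.1 hbQ
    omega
  have := hmax b (mem_filter.2 ⟨hbQ, by omega⟩)
  omega

/-- The sources of `S` lie in `Q`. -/
def SourcesIn (N : ℕ) (S : ℕ → ℕ → ℕ) (Q : Finset ℕ) : Prop := ∀ a < N, S N a ≠ 0 → a ∈ Q

/-- The walk climbs in the levels, so the arcs reversed behind it do not disturb the arcs still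
ahead. By `cut_reverse` the changes of the cuts telescope: only the source at the beginning and the
sink at the end count. -/
theorem augment_spec (h : Active N (level N sink S) S) :
    (∀ a < N, augment N sink (level N sink S) S N a = S N a) ∧
      ∀ Q, Admissible N sink Q → SourcesIn N S Q →
        cut N (augment N sink (level N sink S) S) Q + 1 = cut N S Q := by
  set E := level N sink S with hE
  set a₀ := least N fun a => S N a ≠ 0 ∧ E 0 a ≠ 0 with ha₀
  obtain ⟨h1, h2, h3⟩ : a₀ < N ∧ S N a₀ ≠ 0 ∧ E 0 a₀ ≠ 0 :=
    least_spec (p := fun a => S N a ≠ 0 ∧ E 0 a ≠ 0) h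
  have hN : 0 < N := by omega
  set S₀ := tab (N + 2) N fun i j => if i = N + 1 then a₀ else S i j with hS₀
  have key : ∀ t, ∀ S', S' = iter (fun _ => pathStep N sink E) S₀ t →
      S' (N + 1) 0 < N ∧ E 0 (S' (N + 1) 0) ≠ 0 ∧ (∀ a < N, S' N a = S N a) ∧
      (sink (S' (N + 1) 0) ∨ t + 1 ≤ E 0 (S' (N + 1) 0) ∧ ∀ a < N, ∀ b < N,
        E 0 (S' (N + 1) 0) ≤ E 0 a → E 0 a < E 0 b → S' a b = S a b) ∧
      ∀ Q : Finset ℕ, cut N S' Q + (if a₀ ∈ Q then 1 else 0) =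
        cut N S Q + if S' (N + 1) 0 ∈ Q then 1 else 0 := by
    intro t
    induction t with
    | zero =>
      rintro _ rfl
      have e1 : S₀ (N + 1) 0 = a₀ := by rw [hS₀, tab_apply _ (by omega) hN, if_pos rfl]
      have e2 : ∀ a < N, ∀ b < N, S₀ a b = S a b := fun a ha b hb => by
        rw [hS₀, tab_apply _ (by omega) hb, if_neg (by omega)]
      simp only [iter, e1]
      refine ⟨h1, h3, fun a ha => ?_, .inr ⟨by omega, fun a ha b hb _ _ => e2 a ha b hb⟩,
        fun Q => by rw [cut_congr e2]⟩
      rw [hS₀, tab_apply _ (by omega) ha, if_neg (by omega)]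
    | succ t ih =>
      rintro S'' rfl
      obtain ⟨S', hS'⟩ : ∃ S', S' = iter (fun _ => pathStep N sink E) S₀ t := ⟨_, rfl⟩
      obtain ⟨i1, i2, i3, i4, i5⟩ := ih S' hS'
      have hstep : iter (fun _ => pathStep N sink E) S₀ (t + 1) = pathStep N sink E S' := by
        rw [iter, hS']
      rw [hstep]
      set x := S' (N + 1) 0 with hx
      by_cases hs : sink x
      · have e : ∀ i < N + 2, ∀ j < N, pathStep N sink E S' i j = S' i j := fun i hi j hj => by
          rw [pathStep, tab_apply _ hi hj, if_pos hs]
        rw [e (N + 1) (by omega) 0 hN]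
        exact ⟨i1, i2, fun a ha => (e N (by omega) a ha).trans (i3 a ha), .inl hs, fun Q => by
          rw [cut_congr fun a ha b hb => e a (by omega) b hb, i5 Q]⟩
      · obtain ⟨i6, i7⟩ := i4.resolve_left hs
        set y := next N E S' x with hy
        obtain ⟨j1, j2, j3⟩ : y < N ∧ S' x y ≠ 0 ∧ E 0 x < E 0 y := by
          refine least_spec (p := fun b => S' x b ≠ 0 ∧ E 0 x < E 0 b) ?_
          obtain ⟨b, hb, hSb, hlt⟩ := (level_climb i1 i2).resolve_left hs
          exact ⟨b, hb, by rwa [i7 x i1 b hb le_rfl hlt], hlt⟩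
        have hxy : x ≠ y := by rintro h; rw [← h] at j3; omega
        have e : ∀ i < N + 2, ∀ j < N, pathStep N sink E S' i j = if i = N + 1 then y else
            if i = x ∧ j = y then S' i j - 1 else if i = y ∧ j = x then S' i j + 1 else S' i j :=
          fun i hi j hj => by rw [pathStep, tab_apply _ hi hj, if_neg hs]
        have e1 : pathStep N sink E S' (N + 1) 0 = y := by
          rw [e _ (by omega) 0 hN, if_pos rfl]
        rw [e1]
        refine ⟨j1, by omega, fun a ha => ?_, .inr ⟨by omega, fun a ha b hb hya hab => ?_⟩,
          fun Q => ?_⟩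
        · rw [e N (by omega) a ha, if_neg (by omega), if_neg (by omega), if_neg (by omega), i3 a ha]
        · rw [e a (by omega) b hb, if_neg (by omega), if_neg, if_neg, i7 a ha b hb (by omega) hab]
          · rintro ⟨rfl, rfl⟩; omega
          · rintro ⟨rfl, -⟩; omega
        · have := cut_reverse (M' := pathStep N sink E S') i1 j1 hxy j2 (fun a ha b hb => by
            rw [e a (by omega) b hb, if_neg (by omega)]) Q
          have := i5 Q
          omega
  obtain ⟨k1, -, k3, k4, k5⟩ := key (N + 2) _ rfl
  refine ⟨k3, fun Q hQ hA => ?_⟩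
  have hsink : sink (iter (fun _ => pathStep N sink E) S₀ (N + 2) (N + 1) 0) := by
    refine k4.resolve_right fun h => ?_
    -- Levels are at most `N + 2`, and each step not yet at a sink climbs by at least one, so `N +
    -- 2` steps suffice.
    have := reachIter_le (arc := fun a b => S a b ≠ 0) (sink := sink) (N + 1) k1
    have := h.1.trans this
    omega
  have := k5 Q
  rw [if_pos (hA a₀ h1 h2), if_neg fun h => (hQ _ h).2 hsink] at this
  exact this

theorem advance_arcs (E : ℕ → ℕ → ℕ) : ∀ a < N, ∀ b < N, advance N push E S a b = S a b :=
  fun a ha b hb => by rw [advance, tab_apply _ (by omega) hb, if_neg (by omega)]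

theorem advance_source {E : ℕ → ℕ → ℕ} {a : ℕ} (ha : a < N) :
    advance N push E S N a ≠ 0 ↔ E 0 a = 0 ∨ ∃ b < N, E 0 b = 0 ∧ push b a := by
  rw [advance, tab_apply _ (by omega) ha, if_pos rfl, bit_ne_zero]

/-- Sources never disappear: when none of them reaches a sink, they all lie in the set that is made
the new set of sources. -/
theorem SourcesIn.of_flowStep {Q : Finset ℕ} (h : SourcesIn N (flowStep N sink push S) Q) :
    SourcesIn N S Q := by
  intro a ha hS
  refine h a ha ?_
  rw [flowStep]
  split_ifs with hact
  · rwa [(augment_spec hact).1 a ha]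
  · rw [advance_source ha]
    by_contra hne
    exact hact ⟨a, ha, hS, fun h0 => hne (.inl h0)⟩

/-- The cuts of the admissible sets that contain the sources differ by `c`. -/
def Reduces (N : ℕ) (sink : ℕ → Prop) (M S : ℕ → ℕ → ℕ) (c : ℕ) : Prop :=
  ∀ Q, Admissible N sink Q → SourcesIn N S Q → cut N S Q + c = cut N M Q

/-- Each augmentation lowers all relevant cuts by one, so `c` is the value of the flow found so far.
-/
theorem Reduces.flowStep {c : ℕ} (h : Reduces N sink M S c) :
    Reduces N sink M (flowStep N sink push S) (c + bit (Active N (level N sink S) S)) := by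
  intro Q hQ hA
  have hA' := hA.of_flowStep
  rw [← h Q hQ hA', Flow.flowStep]
  split_ifs with hact
  · rw [bit_pos hact, ← (augment_spec hact).2 Q hQ hA']
    omega
  · rw [bit_neg hact, cut_congr (advance_arcs _), add_zero]

/-- In the residual network the nodes that reach no sink have a cut of `0`, so they form a least cut
around the sources and can be uncrossed with `Q`. -/
theorem low_subset {c : ℕ} {Q : Finset ℕ} (h : Reduces N sink M S c)
    (hact : ¬Active N (level N sink S) S) (hQ : IsImportant N M sink Q) (hS : SourcesIn N S Q) :
    low N (level N sink S) ⊆ Q := by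
  have hSL : SourcesIn N S (low N (level N sink S)) := fun a ha hSa =>
    mem_low.2 ⟨ha, by_contra fun h0 => hact ⟨a, ha, hSa, h0⟩⟩
  refine hQ.subset_of_cut_le admissible_low ?_
  rw [← h _ admissible_low hSL, cut_low_level, ← h _ hQ.admissible.inter
    fun a ha hSa => mem_inter.2 ⟨hS a ha hSa, hSL a ha hSa⟩]
  omega

/-- An important set closed under `push` is never left by the sources, so it is not missed by the
search. -/
theorem SourcesIn.flowStep {c : ℕ} {Q : Finset ℕ} (hS : SourcesIn N S Q)
    (h : Reduces N sink M S c) (hQ : IsImportant N M sink Q)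
    (hpush : ∀ a ∈ Q, ∀ b, push a b → b ∈ Q) : SourcesIn N (flowStep N sink push S) Q := by
  intro a ha hSa
  rw [Flow.flowStep] at hSa
  split_ifs at hSa with hact
  · rw [(augment_spec hact).1 a ha] at hSa
    exact hS a ha hSa
  · have hL := low_subset h hact hQ hS
    rcases (advance_source ha).1 hSa with h0 | ⟨b, hb, h0, hba⟩
    · exact hL (mem_low.2 ⟨ha, h0⟩)
    · exact hpush b (hL (mem_low.2 ⟨hb, h0⟩)) a hba

theorem level_flowStep (hact : ¬Active N (level N sink S) S) :
    level N sink (flowStep N sink push S) = level N sink S := by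
  rw [flowStep, if_neg hact]
  exact level_congr (advance_arcs _)

/-- The state of the search after `t` steps. -/
noncomputable def flow (N : ℕ) (M : ℕ → ℕ → ℕ) (sink : ℕ → Prop) (push : ℕ → ℕ → Prop) (s : ℕ) :
    ℕ → ℕ → ℕ → ℕ :=
  iter (fun _ => flowStep N sink push) (start N M s)

theorem sourcesIn_start {s : ℕ} (hs : s < N) {Q : Finset ℕ} :
    SourcesIn N (start N M s) Q ↔ s ∈ Q := by
  have h1 : ∀ a < N, start N M s N a ≠ 0 ↔ a = s := fun a ha => by
    rw [start, tab_apply _ (by omega) ha, if_neg (by omega), if_pos rfl, bit_ne_zero]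
  refine ⟨fun h => h s hs ((h1 s hs).2 rfl), fun h a ha hSa => (h1 a ha).1 hSa ▸ h⟩

theorem exists_reduces_flow (s t : ℕ) : ∃ c, Reduces N sink M (flow N M sink push s t) c := by
  induction t with
  | zero =>
    refine ⟨0, fun Q _ _ => cut_congr (fun a ha b hb => ?_) Q⟩
    rw [flow, iter, start, tab_apply _ (by omega) hb, if_pos ha]
  | succ t ih =>
    obtain ⟨c, hc⟩ := ih
    exact ⟨_, hc.flowStep⟩

theorem sourcesIn_of_flow {s t : ℕ} (hs : s < N) {Q : Finset ℕ}
    (h : SourcesIn N (flow N M sink push s t) Q) : s ∈ Q := by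
  induction t with
  | zero => exact (sourcesIn_start hs).1 h
  | succ t ih => exact ih h.of_flowStep

/-- The nodes that reach no sink form the required set: any admissible set of residual cut `0` is
contained in it, so larger ones have a positive residual cut. -/
theorem exists_important_of_succeeds {s t k : ℕ} (hs : s < N)
    (hpush : ∀ a b, push a b → a < N → b < N)
    (h : Succeeds N M push k (level N sink (flow N M sink push s t)) (flow N M sink push s t)) :
    ∃ Q, IsImportant N M sink Q ∧ s ∈ Q ∧ cut N M Q ≤ k ∧ ∀ a ∈ Q, ∀ b, push a b → b ∈ Q := by
  obtain ⟨c, hc⟩ := exists_reduces_flow (N := N) (sink := sink) (M := M) (push := push) s t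
  set S := flow N M sink push s t
  obtain ⟨h1, h2, h3⟩ := h
  have hSL : SourcesIn N S (low N (level N sink S)) := fun a ha hSa =>
    mem_low.2 ⟨ha, by_contra fun h0 => h1 ⟨a, ha, hSa, h0⟩⟩
  have hcut := hc _ admissible_low hSL
  rw [cut_low_level, zero_add] at hcut
  refine ⟨low N (level N sink S), ⟨admissible_low, fun Q hlt hQ => ?_⟩, sourcesIn_of_flow hs hSL,
    by rwa [cut_low], fun a ha b hab => ?_⟩
  · rw [← hcut, ← hc Q hQ fun a ha hSa => hlt.1 (hSL a ha hSa)]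
    have : cut N S Q ≠ 0 := fun h0 => hlt.2 (subset_low_of_cut_eq_zero hQ h0)
    omega
  · have ha' := mem_low.1 ha
    have hb := hpush a b hab ha'.1
    exact mem_low.2 ⟨hb, h2 a ha'.1 b hb ha'.2 hab⟩

/-- Unless the search is finished, an advance makes some source reach a sink, so the next step
augments. Thus `t` unfinished steps include about `t / 2` augmentations, of which the cut of `Q`
permits at most `k`. -/
theorem succeeds_of_important {s k : ℕ} {Q : Finset ℕ} (hs : s < N) (hQ : IsImportant N M sink Q)
    (hsQ : s ∈ Q) (hk : cut N M Q ≤ k) (hpush : ∀ a ∈ Q, ∀ b, push a b → b ∈ Q) :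
    Succeeds N M push k (level N sink (flow N M sink push s (2 * k + 2)))
      (flow N M sink push s (2 * k + 2)) := by
  have key : ∀ t, SourcesIn N (flow N M sink push s t) Q ∧ ∃ c,
      Reduces N sink M (flow N M sink push s t) c ∧
      ((¬Active N (level N sink (flow N M sink push s t)) (flow N M sink push s t) ∧
        IsClosed N push (level N sink (flow N M sink push s t))) ∨
      t ≤ 2 * c + bit (Active N (level N sink (flow N M sink push s t))
        (flow N M sink push s t))) := by
    intro t
    induction t with
    | zero =>
      obtain ⟨c, hc⟩ := exists_reduces_flow (N := N) (sink := sink) (M := M) (push := push) s 0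
      exact ⟨(sourcesIn_start hs).2 hsQ, c, hc, .inr (Nat.zero_le _)⟩
    | succ t ih =>
      obtain ⟨hS, c, hc, h⟩ := ih
      have hstep : flow N M sink push s (t + 1) = flowStep N sink push (flow N M sink push s t) :=
        rfl
      rw [hstep]
      set S := flow N M sink push s t
      refine ⟨hS.flowStep hc hQ hpush, _, hc.flowStep, ?_⟩
      by_cases hact : Active N (level N sink S) S
      · refine .inr ?_
        have h' := h.resolve_left fun h' => h'.1 hact
        rw [bit_pos hact] at h' ⊢
        omega
      · rw [level_flowStep hact]
        have hsrc : ∀ a < N, flowStep N sink push S N a ≠ 0 ↔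
            level N sink S 0 a = 0 ∨ ∃ b < N, level N sink S 0 b = 0 ∧ push b a := fun a ha => by
          rw [flowStep, if_neg hact, advance_source ha]
        by_cases hcl : IsClosed N push (level N sink S)
        · refine .inl ⟨?_, hcl⟩
          rintro ⟨a, ha, h1, h2⟩
          rcases (hsrc a ha).1 h1 with h3 | ⟨b, hb, h3, hba⟩
          · exact h2 h3
          · exact h2 (hcl b hb a ha h3 hba)
        · refine .inr ?_
          have h' := h.resolve_left fun h' => hcl h'.2
          simp only [IsClosed, not_forall] at hcl
          obtain ⟨a, ha, b, hb, h1, h2, h3⟩ := hcl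
          rw [bit_neg hact] at h' ⊢
          rw [bit_pos ⟨b, hb, (hsrc b hb).2 (.inr ⟨a, ha, h1, h2⟩), h3⟩]
          omega
  obtain ⟨hS, c, hc, h⟩ := key (2 * k + 2)
  set S := flow N M sink push s (2 * k + 2)
  have hcQ := hc Q hQ.admissible hS
  -- Here `c ≤ k`, so the number of steps `2 * k + 2` exceeds `2 * c + 1`.
  have h' := h.resolve_right fun h' => by
    have := bit_le_one (Active N (level N sink S) S)
    omega
  refine ⟨h'.1, h'.2, ?_⟩
  have hSL : SourcesIn N S (low N (level N sink S)) := fun a ha hSa =>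
    mem_low.2 ⟨ha, by_contra fun h0 => h'.1 ⟨a, ha, hSa, h0⟩⟩
  have hcut := hc _ admissible_low hSL
  rw [cut_low_level, cut_low] at hcut
  omega

end Flow

/-! ### Programs for the search -/

namespace RAM
open VMC
variable {Γ Δ Θ : Type}

namespace View

/-- The context `u` extends the context `v`. -/
structure Ext (u : View Δ) (v : View Γ) (ρ : Δ → Γ) : Prop where
  rel : ∀ δ s, u.rel δ s → v.rel (ρ δ) s
  fr : v.fr ≤ u.fr
  scale : ∀ δ, v.scale (ρ δ) = u.scale δ

variable {u : View Δ} {v : View Γ} {ρ : Δ → Γ}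

theorem Ext.refl : v.Ext v fun γ => γ := ⟨fun _ _ h => h, le_rfl, fun _ => rfl⟩

theorem Ext.trans {w : View Θ} {σ : Θ → Δ} (h : w.Ext u σ) (h' : u.Ext v ρ) :
    w.Ext v fun θ => ρ (σ θ) :=
  ⟨fun _ _ hs => h'.rel _ _ (h.rel _ _ hs), h'.fr.trans h.fr,
    fun _ => (h'.scale _).trans (h.scale _)⟩

theorem Ext.num (h : u.Ext v ρ) {r : ℕ} {hr : u.fr ≤ r} :
    (u.num r hr).Ext v fun p => ρ p.1 :=
  ⟨fun _ _ hs => h.rel _ _ hs.1, h.fr.trans (by simp only [View.num]; omega), fun _ => h.scale _⟩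

theorem Ext.arr (h : u.Ext v ρ) {R C : Δ → ℕ} {r : ℕ} {hr : u.fr ≤ r} :
    (u.arr R C r hr).Ext v fun p => ρ p.1 :=
  ⟨fun _ _ hs => h.rel _ _ hs.1, h.fr.trans (by simp only [View.arr]; omega), fun _ => h.scale _⟩

theorem Bd.ext {N : Γ → ℕ} (h : v.Bd N) (e : u.Ext v ρ) : u.Bd fun δ => N (ρ δ) := by
  obtain ⟨c, hc⟩ := h
  exact ⟨c, fun δ s hs => by rw [← e.scale]; exact hc _ s (e.rel _ _ hs)⟩

theorem Comp.ext {f : Γ → ℕ} (h : v.Comp f) (e : u.Ext v ρ) : u.Comp fun δ => f (ρ δ) := by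
  intro fr hfr
  obtain ⟨T, hT, p, hp⟩ := h fr (e.fr.trans hfr)
  exact ⟨_, hT.ext e, p, fun δ s hs => hp _ s (e.rel _ _ hs)⟩

theorem Var.ext {A : Γ → ℕ → ℕ → ℕ} (h : v.Var A) (e : u.Ext v ρ) : u.Var fun δ => A (ρ δ) := by
  obtain ⟨r, h0, h1, R, hR, h2⟩ := h
  exact ⟨r, h0, h1.trans e.fr, _, hR.ext e, fun δ s hs => h2 _ s (e.rel _ _ hs)⟩

theorem Has.ext {π : Γ → Instance} (h : v.Has π) (e : u.Ext v ρ) : u.Has fun δ => π (ρ δ) := by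
  obtain ⟨c, hc⟩ := h.bd
  exact ⟨h.var.ext e, c, fun δ s hs => by rw [← e.scale]; exact hc _ s (e.rel _ _ hs)⟩

/-- In every extension of the context, the predicate is decidable in polynomial time. -/
def Dec₁ (v : View Γ) (p : Γ → ℕ → Prop) : Prop :=
  ∀ (Δ : Type) (u : View Δ) (ρ : Δ → Γ), u.Ext v ρ → ∀ {f : Δ → ℕ}, u.Comp f →
    u.Dec fun δ => p (ρ δ) (f δ)

/-- In every extension of the context, the relation is decidable in polynomial time. -/
def Dec₂ (v : View Γ) (p : Γ → ℕ → ℕ → Prop) : Prop :=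
  ∀ (Δ : Type) (u : View Δ) (ρ : Δ → Γ), u.Ext v ρ → ∀ {f g : Δ → ℕ}, u.Comp f → u.Comp g →
    u.Dec fun δ => p (ρ δ) (f δ) (g δ)

/-- In every extension of the context, the function can be computed in polynomial time. -/
def Comp₂ (v : View Γ) (F : Γ → ℕ → ℕ → ℕ) : Prop :=
  ∀ (Δ : Type) (u : View Δ) (ρ : Δ → Γ), u.Ext v ρ → ∀ {f g : Δ → ℕ}, u.Comp f → u.Comp g →
    u.Comp fun δ => F (ρ δ) (f δ) (g δ)

theorem Dec₁.ext {p : Γ → ℕ → Prop} (h : v.Dec₁ p) (e : u.Ext v ρ) :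
    u.Dec₁ fun δ => p (ρ δ) := fun _ w _ e' _ hf => h _ w _ (e'.trans e) hf

theorem Dec₂.ext {p : Γ → ℕ → ℕ → Prop} (h : v.Dec₂ p) (e : u.Ext v ρ) :
    u.Dec₂ fun δ => p (ρ δ) := fun _ w _ e' _ _ hf hg => h _ w _ (e'.trans e) hf hg

theorem Comp₂.ext {F : Γ → ℕ → ℕ → ℕ} (h : v.Comp₂ F) (e : u.Ext v ρ) :
    u.Comp₂ fun δ => F (ρ δ) := fun _ w _ e' _ _ hf hg => h _ w _ (e'.trans e) hf hg

theorem Tab.ite {p : Γ → Prop} [∀ γ, Decidable (p γ)] {R C : Γ → ℕ} {A B : Γ → ℕ → ℕ → ℕ}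
    (hp : v.Dec p) (hA : v.Tab R C A) (hB : v.Tab R C B) :
    v.Tab R C fun γ => if p γ then A γ else B γ := by
  intro fr hfr
  refine (Does.branch hp hfr (hA fr hfr) (hB fr hfr) ?_ ?_).imp ?_
  · exact fun γ s₀ s s' h h' => ⟨h'.1, h'.2.trans h⟩
  · exact fun γ s₀ s s' h h' => ⟨h'.1, h'.2.trans h⟩
  · intro γ s s' h
    by_cases h0 : p γ
    · simpa only [ne_eq, bit_ne_zero, if_pos h0] using h
    · simpa only [ne_eq, bit_ne_zero, if_neg h0] using h

section Flow

variable {N : Γ → ℕ} {arc push : Γ → ℕ → ℕ → Prop} {sink : Γ → ℕ → Prop} {E S M : Γ → ℕ → ℕ → ℕ}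

theorem Tab.reach (hN : v.Comp N) (bN : v.Bd N) (harc : v.Dec₂ arc) (hsink : v.Dec₁ sink) :
    v.Tab (fun _ => 1) N fun γ => Flow.reach (N γ) (arc γ) (sink γ) := by
  refine Tab.iter (step := fun γ _ => Flow.reachStep (N γ) (arc γ)) (hN.add (.const 1))
    (bN.add (.const 1)) (Tab.tab (f := fun γ _ a => bit (sink γ a)) (.const 1) (.const 1) hN bN
      fun r hr r' hr' => hsink _ _ _ Ext.refl.num.num Comp.last) fun r hr r' hr' => ?_
  have e : ((v.arr (fun _ => 1) N r hr).num r' hr').Ext v fun p => p.1.1 := Ext.refl.arr.num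
  have hE : ((v.arr (fun _ => 1) N r hr).num r' hr').Var fun p => p.1.2 :=
    (Var.last (.const 1)).num
  refine Tab.tab (f := fun p _ a => p.1.2 0 a + bit (p.1.2 0 a ≠ 0 ∨
    ∃ b < N p.1.1, arc p.1.1 a b ∧ p.1.2 0 b ≠ 0)) (.const 1) (.const 1) (hN.ext e) (bN.ext e)
    fun r₁ h₁ r₂ h₂ => ?_
  refine (Comp.read hE.num.num (.const 0) .last).add
    (Dec.or (Comp.read hE.num.num (.const 0) .last).ne_zero
      (Dec.ex (hN.ext e.num.num) (bN.ext e.num.num) fun r₃ h₃ => ?_))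
  exact Dec.and (harc _ _ _ e.num.num.num Comp.last.num Comp.last)
    (Comp.read hE.num.num.num (.const 0) .last).ne_zero

theorem Tab.level (hN : v.Comp N) (bN : v.Bd N) (hsink : v.Dec₁ sink) (hS : v.Var S) :
    v.Tab (fun _ => 1) N fun γ => Flow.level (N γ) (sink γ) (S γ) :=
  Tab.reach (arc := fun γ a b => S γ a b ≠ 0) hN bN
    (fun _ _ _ e _ _ hf hg => (Comp.read (hS.ext e) hf hg).ne_zero) hsink

theorem Comp.next (hN : v.Comp N) (bN : v.Bd N) (hE : v.Var E) (hS : v.Var S) {f : Γ → ℕ}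
    (hf : v.Comp f) : v.Comp fun γ => Flow.next (N γ) (E γ) (S γ) (f γ) :=
  Comp.least (p := fun γ b => S γ (f γ) b ≠ 0 ∧ E γ 0 (f γ) < E γ 0 b) hN bN fun _ _ =>
    Dec.and (Comp.read hS.num hf.num .last).ne_zero
      (Comp.lt (Comp.read hE.num (.const 0) hf.num) (Comp.read hE.num (.const 0) .last))

theorem Tab.pathStep (hN : v.Comp N) (bN : v.Bd N) (hsink : v.Dec₁ sink) (hE : v.Var E)
    (hS : v.Var S) : v.Tab (fun γ => N γ + 2) N fun γ =>
      Flow.pathStep (N γ) (sink γ) (E γ) (S γ) := by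
  classical
  refine Tab.tab (f := fun γ i j =>
    if sink γ (S γ (N γ + 1) 0) then S γ i j else
    if i = N γ + 1 then Flow.next (N γ) (E γ) (S γ) (S γ (N γ + 1) 0) else
    if i = S γ (N γ + 1) 0 ∧ j = Flow.next (N γ) (E γ) (S γ) (S γ (N γ + 1) 0) then
      S γ i j - 1 else
    if i = Flow.next (N γ) (E γ) (S γ) (S γ (N γ + 1) 0) ∧ j = S γ (N γ + 1) 0 then
      S γ i j + 1 else S γ i j) (hN.add (.const 2)) (bN.add (.const 2)) hN bN fun r hr r' hr' => ?_
  have cur : v.Comp fun γ => S γ (N γ + 1) 0 := Comp.read hS (hN.add (.const 1)) (.const 0)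
  have nxt := (Comp.next hN bN hE hS cur).num (hr := hr) |>.num (hr := hr')
  have cell : ((v.num r hr).num r' hr').Comp fun p => S p.1.1 p.1.2 p.2 :=
    Comp.read hS.num.num Comp.last.num .last
  exact Comp.ite (hsink _ _ _ Ext.refl.num.num cur.num.num) cell
    (Comp.ite (Comp.last.num.eq (hN.num.num.add (.const 1))) nxt
      (Comp.ite (Dec.and (Comp.last.num.eq cur.num.num) (Comp.last.eq nxt)) (cell.sub (.const 1))
        (Comp.ite (Dec.and (Comp.last.num.eq nxt) (Comp.last.eq cur.num.num)) (cell.add (.const 1))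
          cell)))

theorem Tab.augment (hN : v.Comp N) (bN : v.Bd N) (hsink : v.Dec₁ sink) (hE : v.Var E)
    (hS : v.Var S) : v.Tab (fun γ => N γ + 2) N fun γ =>
      Flow.augment (N γ) (sink γ) (E γ) (S γ) := by
  refine Tab.iter (step := fun γ _ => Flow.pathStep (N γ) (sink γ) (E γ)) (hN.add (.const 2))
    (bN.add (.const 2)) (Tab.tab (f := fun γ i j => if i = N γ + 1 then
      least (N γ) (fun a => S γ (N γ) a ≠ 0 ∧ E γ 0 a ≠ 0) else S γ i j) (hN.add (.const 2))
      (bN.add (.const 2)) hN bN fun r hr r' hr' => ?_) fun r hr r' hr' => ?_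
  · have h : v.Comp fun γ => least (N γ) (fun a => S γ (N γ) a ≠ 0 ∧ E γ 0 a ≠ 0) :=
      Comp.least (p := fun γ a => S γ (N γ) a ≠ 0 ∧ E γ 0 a ≠ 0) hN bN fun _ _ =>
        Dec.and (Comp.read hS.num hN.num .last).ne_zero
          (Comp.read hE.num (.const 0) .last).ne_zero
    exact Comp.ite (Comp.last.num.eq (hN.num.num.add (.const 1))) h.num.num
      (Comp.read hS.num.num Comp.last.num .last)
  · have e : ((v.arr (fun γ => N γ + 2) N r hr).num r' hr').Ext v fun p => p.1.1 :=
      Ext.refl.arr.num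
    exact Tab.pathStep (N := fun p : (Γ × (ℕ → ℕ → ℕ)) × ℕ => N p.1.1) (sink := fun p => sink p.1.1)
      (E := fun p => E p.1.1) (S := fun p => p.1.2) (hN.ext e) (bN.ext e) (hsink.ext e) (hE.ext e)
      (Var.last (bN.add (.const 2))).num

theorem Tab.advance (hN : v.Comp N) (bN : v.Bd N) (hpush : v.Dec₂ push) (hE : v.Var E)
    (hS : v.Var S) : v.Tab (fun γ => N γ + 2) N fun γ =>
      Flow.advance (N γ) (push γ) (E γ) (S γ) := by
  refine Tab.tab (f := fun γ i j => if i = N γ then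
    bit (E γ 0 j = 0 ∨ ∃ a < N γ, E γ 0 a = 0 ∧ push γ a j) else S γ i j) (hN.add (.const 2))
    (bN.add (.const 2)) hN bN fun r hr r' hr' => ?_
  refine Comp.ite (Comp.last.num.eq hN.num.num) (Dec.or
    ((Comp.read hE.num.num (.const 0) .last).eq (.const 0))
    (Dec.ex hN.num.num bN.num.num fun r₁ h₁ => ?_)) (Comp.read hS.num.num Comp.last.num .last)
  exact Dec.and ((Comp.read hE.num.num.num (.const 0) .last).eq (.const 0))
    (hpush _ _ _ Ext.refl.num.num.num Comp.last Comp.last.num)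

theorem Dec.active (hN : v.Comp N) (bN : v.Bd N) (hE : v.Var E) (hS : v.Var S) :
    v.Dec fun γ => Flow.Active (N γ) (E γ) (S γ) :=
  Dec.ex (p := fun γ a => S γ (N γ) a ≠ 0 ∧ E γ 0 a ≠ 0) hN bN fun _ _ =>
    Dec.and (Comp.read hS.num hN.num .last).ne_zero (Comp.read hE.num (.const 0) .last).ne_zero

theorem Tab.flowStep (hN : v.Comp N) (bN : v.Bd N) (hsink : v.Dec₁ sink) (hpush : v.Dec₂ push)
    (hS : v.Var S) : v.Tab (fun γ => N γ + 2) N fun γ =>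
      Flow.flowStep (N γ) (sink γ) (push γ) (S γ) := by
  classical
  refine Tab.let (B := fun γ E => if Flow.Active (N γ) E (S γ) then
    Flow.augment (N γ) (sink γ) E (S γ) else Flow.advance (N γ) (push γ) E (S γ))
    (Tab.level hN bN hsink hS) fun r hr => ?_
  have e : (v.arr (fun _ => 1) N r hr).Ext v fun p => p.1 := Ext.refl.arr
  have hE : (v.arr (fun _ => 1) N r hr).Var fun p => p.2 := Var.last (.const 1)
  exact Tab.ite (Dec.active (hN.ext e) (bN.ext e) hE (hS.ext e))
    (Tab.augment (hN.ext e) (bN.ext e) (hsink.ext e) hE (hS.ext e))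
    (Tab.advance (hN.ext e) (bN.ext e) (hpush.ext e) hE (hS.ext e))

theorem Tab.flow {T s : Γ → ℕ} (hN : v.Comp N) (bN : v.Bd N) (hsink : v.Dec₁ sink)
    (hpush : v.Dec₂ push) (hM : v.Comp₂ M) (hs : v.Comp s) (hT : v.Comp T) (bT : v.Bd T) :
    v.Tab (fun γ => N γ + 2) N fun γ =>
      Flow.flow (N γ) (M γ) (sink γ) (push γ) (s γ) (T γ) := by
  refine Tab.iter (step := fun γ _ => Flow.flowStep (N γ) (sink γ) (push γ)) hT bT
    (Tab.tab (f := fun γ i j => if i < N γ then M γ i j else if i = N γ then bit (j = s γ) else 0)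
      (hN.add (.const 2)) (bN.add (.const 2)) hN bN fun r hr r' hr' => ?_) fun r hr r' hr' => ?_
  · exact Comp.ite (Comp.last.num.lt hN.num.num) (hM _ _ _ Ext.refl.num.num Comp.last.num .last)
      (Comp.ite (Comp.last.num.eq hN.num.num) (Comp.last.eq hs.num.num) (.const 0))
  · have e : ((v.arr (fun γ => N γ + 2) N r hr).num r' hr').Ext v fun p => p.1.1 :=
      Ext.refl.arr.num
    exact Tab.flowStep (N := fun p : (Γ × (ℕ → ℕ → ℕ)) × ℕ => N p.1.1) (sink := fun p => sink p.1.1)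
      (push := fun p => push p.1.1) (S := fun p => p.1.2) (hN.ext e) (bN.ext e) (hsink.ext e)
      (hpush.ext e) (Var.last (bN.add (.const 2))).num

theorem Dec.succeeds {k : Γ → ℕ} (hN : v.Comp N) (bN : v.Bd N) (hpush : v.Dec₂ push)
    (hM : v.Comp₂ M) (hk : v.Comp k) (hE : v.Var E) (hS : v.Var S) :
    v.Dec fun γ => Flow.Succeeds (N γ) (M γ) (push γ) (k γ) (E γ) (S γ) := by
  refine Dec.and (Dec.active hN bN hE hS).not (Dec.and ?_ (Comp.le ?_ hk))
  · refine Dec.all (p := fun γ a => ∀ b < N γ, E γ 0 a = 0 → push γ a b → E γ 0 b = 0) hN bN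
      fun r hr => Dec.all (p := fun x b => E x.1 0 x.2 = 0 → push x.1 x.2 b → E x.1 0 b = 0)
        hN.num bN.num fun r' hr' => ?_
    exact Dec.imp ((Comp.read hE.num.num (.const 0) Comp.last.num).eq (.const 0))
      (Dec.imp (hpush _ _ _ Ext.refl.num.num Comp.last.num Comp.last)
        ((Comp.read hE.num.num (.const 0) .last).eq (.const 0)))
  · refine Comp.sum (f := fun γ a => ∑ b ∈ Finset.range (N γ),
      if E γ 0 a = 0 ∧ E γ 0 b ≠ 0 then M γ a b else 0) hN bN fun r hr => Comp.sum
      (f := fun x b => if E x.1 0 x.2 = 0 ∧ E x.1 0 b ≠ 0 then M x.1 x.2 b else 0) hN.num bN.num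
      fun r' hr' => ?_
    exact Comp.ite (Dec.and ((Comp.read hE.num.num (.const 0) Comp.last.num).eq (.const 0))
      (Comp.read hE.num.num (.const 0) .last).ne_zero)
      (hM _ _ _ Ext.refl.num.num Comp.last.num Comp.last) (.const 0)

theorem Dec.flow_succeeds {s T k : Γ → ℕ} (hN : v.Comp N) (bN : v.Bd N) (hsink : v.Dec₁ sink)
    (hpush : v.Dec₂ push) (hM : v.Comp₂ M) (hs : v.Comp s) (hT : v.Comp T) (bT : v.Bd T)
    (hk : v.Comp k) : v.Dec fun γ => Flow.Succeeds (N γ) (M γ) (push γ) (k γ)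
      (Flow.level (N γ) (sink γ) (Flow.flow (N γ) (M γ) (sink γ) (push γ) (s γ) (T γ)))
      (Flow.flow (N γ) (M γ) (sink γ) (push γ) (s γ) (T γ)) := by
  refine Comp.let (f := fun γ S => bit (Flow.Succeeds (N γ) (M γ) (push γ) (k γ)
    (Flow.level (N γ) (sink γ) S) S)) (Tab.flow hN bN hsink hpush hM hs hT bT) fun r hr => ?_
  have e : (v.arr (fun γ => N γ + 2) N r hr).Ext v fun p => p.1 := Ext.refl.arr
  have hS : (v.arr (fun γ => N γ + 2) N r hr).Var fun p => p.2 := Var.last (bN.add (.const 2))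
  refine Comp.let (f := fun (x : Γ × (ℕ → ℕ → ℕ)) E =>
      bit (Flow.Succeeds (N x.1) (M x.1) (push x.1) (k x.1) E x.2))
    (Tab.level (N := fun x : Γ × (ℕ → ℕ → ℕ) => N x.1) (sink := fun x => sink x.1)
      (S := fun x => x.2) (hN.ext e) (bN.ext e) (hsink.ext e) hS) fun r' hr' => ?_
  have e' : ((v.arr (fun γ => N γ + 2) N r hr).arr (fun _ => 1) (fun x => N x.1) r' hr').Ext v
    fun p => p.1.1 := Ext.refl.arr.arr
  exact Dec.succeeds (hN.ext e') (bN.ext e') (hpush.ext e') (hM.ext e') (hk.ext e')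
    (Var.last (.const 1)) hS.arr

end Flow
end View
end RAM

/-! ### The reduction -/

namespace VMC.Instance
open RAM
variable (I : Instance)

/-- The arcs along which sources are pushed: those of the vertices outside `U`. -/
def push (U : ℕ → Prop) (a b : ℕ) : Prop := a < I.n ∧ b = I.n + a ∧ ¬U a

/-- The final state of the search for an important cut around the vertex `v`. -/
noncomputable def search (U : ℕ → Prop) (v : ℕ) : ℕ → ℕ → ℕ :=
  Flow.flow (2 * I.n) I.cap I.sink (I.push U) (I.n + v) (2 * I.k + 2)

/-- That the boundary of a set of nodes lies in `U` means that the set is closed under the arcs of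
the vertices outside `U`, which is what `push` expresses. -/
theorem covered_iff (U : ℕ → Prop) (v : ℕ) : I.Covered U v ↔ v < I.n ∧
    Flow.Succeeds (2 * I.n) I.cap (I.push U) I.k (Flow.level (2 * I.n) I.sink (I.search U v))
      (I.search U v) := by
  constructor
  · rintro ⟨Q, hQ, hv, hk, hU⟩
    have hv' := (hQ.admissible _ hv).1
    refine ⟨by omega, Flow.succeeds_of_important hv' hQ hv hk ?_⟩
    rintro a ha _ ⟨han, rfl, haU⟩
    by_contra hne
    exact haU (hU a han ha hne)
  · rintro ⟨hv, h⟩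
    obtain ⟨Q, hQ, hvQ, hk, hU⟩ := Flow.exists_important_of_succeeds (by omega)
      (by rintro a _ ⟨ha, rfl, -⟩ -; omega) h
    refine ⟨Q, hQ, hvQ, hk, fun u hu huQ hne => ?_⟩
    by_contra huU
    exact hne (hU u huQ _ ⟨hu, rfl, huU⟩)

variable {I} in
theorem least_inW (hW : I.W.Nonempty) : least I.n I.inW < I.n ∧ I.inW (least I.n I.inW) := by
  obtain ⟨w, hw⟩ := hW
  exact least_spec ⟨w, w.2, inW_iff.2 hw⟩

/-- The instance in which the vertices covered by `U` are bypassed. -/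
noncomputable def bypass (hW : I.W.Nonempty) (U : ℕ → Prop) : Instance :=
  I.torso {v | I.Covered U v} (fun _ h => Covered.notMem h)
    ⟨least I.n I.inW, (least_inW hW).1⟩ (inW_iff.1 (least_inW hW).2)

/-- The instance without vertices. -/
def trivial (k : ℕ) : Instance where
  n := 0
  G := ⊥
  T := ∅
  W := ∅
  k := k
  multicut := by simp [IsMulticut]
  card_le := by simp

/-- The number of pairs of vertices that have to be separated by a colouring. -/
def pairs : ℕ := I.k * (I.k * (I.k + 1))

/-- The number of colours. -/
def colours : ℕ := 4 * I.pairs + 1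

/-- The number of colourings. -/
def colourings : ℕ := I.colours * (Nat.log 2 I.n + 1)

/-- The set of vertices that is given by a colouring and a choice of colours. -/
noncomputable def guess (r τ : ℕ) : ℕ → Prop :=
  Splitter.chosen I.colours I.k (Splitter.colouring I.n I.colourings I.colours) r τ

open Classical in
/-- The instances to which an instance is reduced. -/
noncomputable def reduce : List Instance :=
  if hW : I.W.Nonempty then
    (List.range I.colourings).flatMap fun r =>
      (List.range (I.colours ^ I.k)).map fun τ => I.bypass hW (I.guess r τ)
  else [trivial I.k]

variable {I}

theorem isShadowlessSolution_trivial (k : ℕ) : (trivial k).IsShadowlessSolution ∅ :=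
  ⟨⟨by simp, by simp [IsMulticut, trivial], by simp,
    Finset.disjoint_empty_left _, fun w => w.elim0⟩,
    Set.eq_empty_of_forall_notMem fun v => v.elim0⟩

/-- If `W` is empty, the empty set is a multicut by assumption. -/
theorem isYes_of_not_nonempty (hW : ¬I.W.Nonempty) : I.IsYes := by
  rw [Finset.not_nonempty_iff_eq_empty] at hW
  exact ⟨∅, by simp, hW ▸ I.multicut, by simp, by simp, by simp [hW]⟩

theorem mem_reduce {I' : Instance} : I' ∈ I.reduce ↔
    (∃ hW : I.W.Nonempty, ∃ r < I.colourings, ∃ τ < I.colours ^ I.k,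
      I' = I.bypass hW (I.guess r τ)) ∨ (¬I.W.Nonempty ∧ I' = trivial I.k) := by
  rw [reduce]
  split_ifs with hW <;> simp [hW, eq_comm]

theorem isPartialBranching_reduce : IsPartialBranching reduce := by
  refine ⟨⟨1, fun I I' h => ?_⟩, fun I I' h => ?_, fun I hI I' h => ?_⟩
  · rw [pow_one, size_eq, size_eq]
    rcases mem_reduce.1 h with ⟨hW, r, -, τ, -, rfl⟩ | ⟨-, rfl⟩
    · exact le_rfl
    · simp only [trivial]; omega
  · rcases mem_reduce.1 h with ⟨hW, r, -, τ, -, rfl⟩ | ⟨-, rfl⟩ <;> exact le_rfl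
  · rcases mem_reduce.1 h with ⟨hW, r, -, τ, -, rfl⟩ | ⟨hW, rfl⟩
    · rintro ⟨X, hX⟩
      exact hI ⟨X, hX.of_torso⟩
    · exact (hI (isYes_of_not_nonempty hW)).elim

/-- The hitting sets of the at most `k` boundary vertices have at most `k * (k + 1)` elements
altogether, so `k * (k * (k + 1))` pairs have to be separated. -/
theorem IsExtremal.exists_guess {B : Finset (Fin I.n)} (h : I.IsExtremal B) :
    ∃ r < I.colourings, ∃ τ < I.colours ^ I.k, (∀ x ∈ boundary I.G B, I.guess r τ x) ∧
      ∀ x ∈ boundary I.G B, ¬I.Covered (I.guess r τ) x := by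
  classical
  choose! H hcard hdisj hH using fun x (hx : x ∈ boundary I.G B) => h.exists_hitting hx
  let Y := (boundary I.G B).biUnion H
  have hk := h.isSolution.card_le
  have hY : Y.card ≤ I.k * (I.k + 1) :=
    Finset.card_biUnion_le.trans ((Finset.sum_le_card_nsmul _ _ _ hcard).trans
      (Nat.mul_le_mul_right _ hk))
  obtain ⟨r, hr, τ, hτ, h1, h2⟩ := Splitter.exists_chosen (n := I.n) (k := I.k) (p := I.pairs)
    (m := Nat.log 2 I.n + 1) (H := Splitter.colouring I.n I.colourings I.colours) (by omega)
    (Nat.lt_pow_succ_log_self (by omega) _)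
    (fun r hr v hv => Splitter.isGood_colouring (by omega) hr hv)
    (X := (boundary I.G B).map Fin.valEmbedding) (Y := Y.map Fin.valEmbedding)
    (fun a ha => by
      obtain ⟨x, -, rfl⟩ := Finset.mem_map.1 ha
      exact Finset.mem_range.2 x.2)
    (fun a ha => by
      obtain ⟨x, -, rfl⟩ := Finset.mem_map.1 ha
      exact Finset.mem_range.2 x.2)
    (by
      rw [Finset.disjoint_map]
      exact Finset.disjoint_biUnion_right _ _ _ |>.2 fun x hx => (hdisj x hx).symm)
    (by rwa [Finset.card_map])
    (by
      rw [Finset.card_map, Finset.card_map]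
      exact Nat.mul_le_mul hk hY)
    (by
      rw [Finset.map_eq_empty, Finset.map_eq_empty]
      intro h0
      simp [Y, h0])
  refine ⟨r, hr, τ, hτ, fun x hx => h1 x (Finset.mem_map_of_mem _ hx), fun x hx =>
    hH x hx _ fun y hy => h2 y (Finset.mem_map_of_mem _ (Finset.mem_biUnion.2 ⟨x, hx, hy⟩))⟩

theorem IsYes.exists_mem_reduce (h : I.IsYes) :
    ∃ I' ∈ I.reduce, ∃ X, I'.IsShadowlessSolution X := by
  by_cases hW : I.W.Nonempty
  · obtain ⟨B, hB⟩ := h.exists_isExtremal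
    obtain ⟨r, hr, τ, hτ, h1, h2⟩ := hB.exists_guess
    refine ⟨I.bypass hW (I.guess r τ), mem_reduce.2 (.inl ⟨hW, r, hr, τ, hτ, rfl⟩),
      boundary I.G B, hB.isSolution.torso (fun z hz hzB => h2 z hzB hz) fun v hv => ?_⟩
    obtain ⟨h3, h4⟩ := hB.shadow_subset hv
    exact hB.covered h1 h3 h4
  · exact ⟨trivial I.k, mem_reduce.2 (.inr ⟨hW, rfl⟩), ∅, isShadowlessSolution_trivial _⟩

theorem colours_le (hk : 1 ≤ I.k) : I.colours ≤ max I.k 2 ^ 6 := by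
  rw [colours, pairs]
  generalize hM : max I.k 2 = M
  have h1 : I.k ≤ M := by omega
  have h2 : 2 ≤ M := by omega
  calc 4 * (I.k * (I.k * (I.k + 1))) + 1 ≤ 4 * (M * (M * (M + 1))) + 1 := by gcongr
    _ ≤ M ^ 6 := by
      obtain ⟨a, rfl⟩ := Nat.exists_eq_add_of_le h2
      ring_nf
      nlinarith [Nat.zero_le a, Nat.zero_le (a ^ 2), Nat.zero_le (a ^ 3)]

theorem length_reduce_le (I : Instance) :
    I.reduce.length ≤ max I.k 2 ^ (12 * I.k) * (Nat.log 2 I.n + 1) := by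
  have h0 : 0 < max I.k 2 ^ (12 * I.k) := Nat.pow_pos (by omega)
  rw [reduce]
  split_ifs with hW
  · simp only [List.length_flatMap, List.length_map, List.length_range, List.map_const',
      List.sum_replicate, smul_eq_mul, colourings]
    rw [mul_right_comm]
    refine Nat.mul_le_mul_right _ ?_
    -- For `k = 0` there is a single colour. Otherwise the exponent `k + 1` is at most `2 * k`, and
    -- with `colours_le` this gives `12 * k`.
    rcases Nat.eq_zero_or_pos I.k with hk | hk
    · simp [hk, colours, pairs]
    · calc I.colours * I.colours ^ I.k = I.colours ^ (I.k + 1) := by ring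
        _ ≤ I.colours ^ (2 * I.k) := Nat.pow_le_pow_right (by rw [colours]; omega) (by omega)
        _ ≤ (max I.k 2 ^ 6) ^ (2 * I.k) := Nat.pow_le_pow_left (colours_le hk) _
        _ = _ := by rw [← pow_mul]; congr 1; ring
  · rw [List.length_singleton]
    exact Nat.mul_pos h0 (by omega)

/-! The reduced instances, on numbers -/

variable (I) in
/-- There is a walk from `a` to `b` all of whose vertices but the last one are covered. -/
def thru (U : ℕ → Prop) (a b : ℕ) : Prop :=
  Flow.reach I.n (fun x y => I.Covered U x ∧ I.adj x y) (fun x => x = b) 0 a ≠ 0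

variable (I) in
/-- One of the conditions for the adjacency of two vertices in the reduced instance. -/
def link (U : ℕ → Prop) (u v : ℕ) : Prop :=
  (¬I.Covered U u ∧ ¬I.Covered U v ∧ ∃ a < I.n, I.adj u a ∧ I.thru U a v) ∨
    (I.Covered U u ∧ v = least I.n I.inW)

theorem thru_iff {U : ℕ → Prop} {a b : Fin I.n} :
    I.thru U a b ↔ Thru I.G {v | I.Covered U v} a b := by
  rw [thru, Flow.reach_ne_zero_iff (fun x y h => h.2.choose_spec.choose) a.2]
  constructor
  · rintro ⟨_, -, rfl, h⟩
    have key : ∀ y, Relation.ReflTransGen (fun x y => I.Covered U x ∧ I.adj x y) (a : ℕ) y →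
        ∃ hy : y < I.n, Thru I.G {v | I.Covered U v} a ⟨y, hy⟩ := by
      intro y hy
      induction hy with
      | refl => exact ⟨a.2, .refl⟩
      | tail _ hxy ih =>
        obtain ⟨hx, ih⟩ := ih
        obtain ⟨hc, _, hy, hadj⟩ := hxy
        exact ⟨hy, ih.tail ⟨hc, hadj⟩⟩
    exact (key b h).2
  · intro h
    exact ⟨b, b.2, rfl, h.lift _ fun x y hxy => ⟨hxy.1, adj_iff.2 hxy.2⟩⟩

theorem bypass_adj {hW : I.W.Nonempty} {U : ℕ → Prop} {u v : ℕ} : (I.bypass hW U).adj u v ↔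
    u < I.n ∧ v < I.n ∧ u ≠ v ∧ (I.link U u v ∨ I.link U v u) := by
  have key : ∀ u v : Fin I.n, I.link U u v ↔
      (u ∉ {v : Fin I.n | I.Covered U v} ∧ v ∉ {v : Fin I.n | I.Covered U v} ∧
        ∃ a, I.G.Adj u a ∧ Thru I.G {v | I.Covered U v} a v) ∨
      (u ∈ {v : Fin I.n | I.Covered U v} ∧ v = ⟨least I.n I.inW, (least_inW hW).1⟩) := by
    intro u v
    rw [link]
    refine or_congr (and_congr Iff.rfl (and_congr Iff.rfl ?_)) (and_congr Iff.rfl ?_)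
    · constructor
      · rintro ⟨a, ha, h1, h2⟩
        lift a to Fin I.n using ha
        exact ⟨a, adj_iff.1 h1, thru_iff.1 h2⟩
      · rintro ⟨a, h1, h2⟩
        exact ⟨a, a.2, adj_iff.2 h1, thru_iff.2 h2⟩
    · rw [Fin.ext_iff]
  constructor
  · rintro ⟨hu, hv, h⟩
    have h' := (SimpleGraph.fromRel_adj _ _ _).1 h
    refine ⟨hu, hv, fun huv => h'.1 (Fin.ext huv), h'.2.imp ?_ ?_⟩
    · exact (key ⟨u, hu⟩ ⟨v, hv⟩).2
    · exact (key ⟨v, hv⟩ ⟨u, hu⟩).2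
  · rintro ⟨hu, hv, huv, h⟩
    refine ⟨hu, hv, (SimpleGraph.fromRel_adj _ _ _).2 ⟨fun h => huv (Fin.ext_iff.1 h), h.imp ?_ ?_⟩⟩
    · exact (key ⟨u, hu⟩ ⟨v, hv⟩).1
    · exact (key ⟨v, hv⟩ ⟨u, hu⟩).1

theorem bypass_pair {hW : I.W.Nonempty} {U : ℕ → Prop} {u v : ℕ} : (I.bypass hW U).pair u v ↔
    u < I.n ∧ v < I.n ∧ ¬I.Covered U u ∧ ¬I.Covered U v ∧
      ∃ s < I.n, ∃ t < I.n, I.pair s t ∧ I.thru U s u ∧ I.thru U t v := by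
  constructor
  · rintro ⟨hu, hv, h⟩
    obtain ⟨h1, h2, ⟨s, t⟩, hst, h3, h4⟩ := mem_torsoPairs.1 h
    exact ⟨hu, hv, h1, h2, s, s.2, t, t.2, ⟨s.2, t.2, hst⟩, thru_iff.2 h3, thru_iff.2 h4⟩
  · rintro ⟨hu, hv, h1, h2, s, hs, t, ht, ⟨_, _, hst⟩, h3, h4⟩
    exact ⟨hu, hv, mem_torsoPairs.2 ⟨h1, h2, (⟨s, hs⟩, ⟨t, ht⟩), hst,
      (thru_iff (a := ⟨s, hs⟩) (b := ⟨u, hu⟩)).1 h3,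
      (thru_iff (a := ⟨t, ht⟩) (b := ⟨v, hv⟩)).1 h4⟩⟩

variable (I) in
/-- The encoding of the instance in which the vertices covered by `U` are bypassed. -/
noncomputable def bypassCode (U : ℕ → Prop) : List ℕ := [I.n, I.k] ++
  ((List.range I.n).flatMap fun u => (List.range I.n).flatMap fun v =>
    [bit (u < I.n ∧ v < I.n ∧ u ≠ v ∧ (I.link U u v ∨ I.link U v u))]) ++
  ((List.range I.n).flatMap fun u => (List.range I.n).flatMap fun v =>
    [bit (u < I.n ∧ v < I.n ∧ ¬I.Covered U u ∧ ¬I.Covered U v ∧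
      ∃ s < I.n, ∃ t < I.n, I.pair s t ∧ I.thru U s u ∧ I.thru U t v)]) ++
  (List.range I.n).flatMap fun v => [bit (I.inW v)]

theorem encode_bypass {hW : I.W.Nonempty} {U : ℕ → Prop} :
    (I.bypass hW U).encode = I.bypassCode U := by
  rw [encode_eq, bypassCode]
  simp only [bypass_adj, bypass_pair]
  rfl

end VMC.Instance

/-! ### Programs for the reduction -/

namespace RAM.View
open VMC
variable {Γ Δ : Type} {u : View Δ} {v : View Γ} {ρ : Δ → Γ}

theorem Tab.last {R C : Γ → ℕ} {r : ℕ} {hr : v.fr ≤ r} :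
    (v.arr R C r hr).Tab (fun p => R p.1) (fun p => C p.1) fun p => p.2 := by
  intro fr hfr
  have := v.pos
  simp only [View.arr] at hfr
  refine ⟨_, Bd.const 6, .seq (copy fr r) (.seq (copy (fr + 1) (r + 1)) (copy (fr + 2) (r + 2))),
    fun p s ⟨_, h1, h2, h3⟩ => ⟨2 + (2 + 2), le_rfl, _, (runs_copy (by omega) _).seq
      ((runs_copy (by omega) _).seq (runs_copy (by omega) _)),
      ((Agree.set le_rfl (by omega) _ _).set_right (by omega) (by omega) _).set_right (by omega)
      (by omega) _, ⟨h1.congr ?_ ?_ ?_ ?_ fun _ _ => rfl, ?_, ?_⟩, rfl⟩⟩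
  · simp [State.set_reg]
  · rw [State.set_reg, if_neg (by omega), State.set_reg_same, State.set_reg, if_neg (by omega)]
  · rw [State.set_reg_same, State.set_reg, if_neg (by omega), State.set_reg, if_neg (by omega)]
  · rw [State.set_reg, if_neg (by omega), State.set_reg, if_neg (by omega), State.set_reg,
      if_neg (by omega)]
  · rw [State.set_reg, if_neg (by omega), State.set_reg_same, State.set_reg, if_neg (by omega), h2]
  · rw [State.set_reg_same, State.set_reg, if_neg (by omega), State.set_reg, if_neg (by omega), h3]

theorem Tab.ext {R C : Γ → ℕ} {A : Γ → ℕ → ℕ → ℕ} (h : v.Tab R C A) (e : u.Ext v ρ) :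
    u.Tab (fun δ => R (ρ δ)) (fun δ => C (ρ δ)) fun δ => A (ρ δ) := by
  intro fr hfr
  obtain ⟨T, hT, p, hp⟩ := h fr (e.fr.trans hfr)
  exact ⟨_, hT.ext e, p, fun δ s hs => hp _ s (e.rel _ _ hs)⟩

theorem Emit.congr {f g : Γ → List ℕ} (hf : v.Emit f) (h : ∀ γ, f γ = g γ) : v.Emit g := by
  rwa [← funext h]

theorem Comp.min {f g : Γ → ℕ} (hf : v.Comp f) (hg : v.Comp g) :
    v.Comp fun γ => min (f γ) (g γ) :=
  (hf.sub (hf.sub hg)).congr fun γ => by omega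

theorem Comp.mod {f g : Γ → ℕ} (hf : v.Comp f) (bf : v.Bd f) (hg : v.Comp g) (bg : v.Bd g) :
    v.Comp fun γ => f γ % g γ :=
  (hf.sub (hg.mul bg (hf.div hg bg hf bf))).congr fun γ => by
    rw [min_eq_left (Nat.div_le_self _ _), Nat.mod_eq_sub]

/-- The logarithm counts the `j` with `2 ^ (j + 1) ≤ f γ`. The minimum does nothing within the range
of summation, but bounds the exponent for every value of `j`, as the program for the summand
requires. -/
theorem Comp.log {f : Γ → ℕ} (hf : v.Comp f) (bf : v.Bd f) : v.Comp fun γ => Nat.log 2 (f γ) := by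
  have hmin : ∀ r hr, (v.num r hr).Comp fun p => Min.min p.2 (f p.1) := fun _ _ =>
    Comp.last.min hf.num
  refine (Comp.sum (f := fun γ j => bit (2 ^ (Min.min j (f γ) + 1) ≤ f γ)) hf bf fun r hr =>
    Comp.le (Comp.pow (.const 2) (.const 2) ((hmin r hr).add (.const 1))
      ((bf.num.mono fun _ => min_le_right _ _).add (.const 1))) hf.num).congr fun γ => ?_
  rcases Nat.eq_zero_or_pos (f γ) with h0 | h0
  · simp [h0]
  have hlt : Nat.log 2 (f γ) ≤ f γ := Nat.log_le_self _ _
  calc _ = ∑ j ∈ Finset.range (f γ), if j < Nat.log 2 (f γ) then 1 else 0 := by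
        refine Finset.sum_congr rfl fun j hj => ?_
        rw [min_eq_left (Finset.mem_range.1 hj).le, bit]
        congr 1
        rw [← Nat.le_log_iff_pow_le (by omega) (by omega), Nat.succ_le_iff]
    _ = _ := by
        rw [Finset.sum_boole, show (Finset.range (f γ)).filter (· < Nat.log 2 (f γ)) =
          Finset.range (Nat.log 2 (f γ)) by
            ext; simp only [Finset.mem_filter, Finset.mem_range]; omega]
        simp

/-! ### Programs for the colourings -/

section Splitter
open Splitter

variable {n L q k r a b c τ : Γ → ℕ} {H : Γ → ℕ → ℕ → ℕ}

theorem Comp.collisions (hL : v.Comp L) (bL : v.Bd L) (hH : v.Var H) (hr : v.Comp r)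
    (ha : v.Comp a) (hb : v.Comp b) :
    v.Comp fun γ => Splitter.collisions (L γ) (H γ) (r γ) (a γ) (b γ) :=
  Comp.sum (f := fun γ r' => bit (r' < r γ ∧ H γ r' (a γ) = H γ r' (b γ))) hL bL fun _ _ =>
    Dec.and (Comp.last.lt hr.num)
      ((Comp.read hH.num .last ha.num).eq (Comp.read hH.num .last hb.num))

theorem Bd.collisions (bL : v.Bd L) :
    v.Bd fun γ => Splitter.collisions (L γ) (H γ) (r γ) (a γ) (b γ) :=
  bL.mono fun γ => (Finset.sum_le_card_nsmul _ _ 1 fun _ _ => Flow.bit_le_one _).trans (by simp)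

theorem Comp.cost (hn : v.Comp n) (bn : v.Bd n) (hL : v.Comp L) (bL : v.Bd L) (hH : v.Var H)
    (hr : v.Comp r) (ha : v.Comp a) (hc : v.Comp c) :
    v.Comp fun γ => Splitter.cost (n γ) (L γ) (H γ) (r γ) (a γ) (c γ) :=
  Comp.sum (f := fun γ u => if u < a γ ∧ H γ (r γ) u = c γ then
    2 ^ Splitter.collisions (L γ) (H γ) (r γ) u (a γ) else 0) hn bn fun _ _ =>
    Comp.ite (Dec.and (Comp.last.lt ha.num) ((Comp.read hH.num hr.num .last).eq hc.num))
      (Comp.pow (.const 2) (.const 2) (Comp.collisions hL.num bL.num hH.num hr.num .last ha.num)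
        bL.num.collisions) (.const 0)

theorem Comp.colour (hn : v.Comp n) (bn : v.Bd n) (hL : v.Comp L) (bL : v.Bd L) (hq : v.Comp q)
    (bq : v.Bd q) (hH : v.Var H) (hr : v.Comp r) (ha : v.Comp a) :
    v.Comp fun γ => Splitter.colour (n γ) (L γ) (q γ) (H γ) (r γ) (a γ) :=
  Comp.least (p := fun γ c => ∀ c' < q γ, Splitter.cost (n γ) (L γ) (H γ) (r γ) (a γ) c ≤
      Splitter.cost (n γ) (L γ) (H γ) (r γ) (a γ) c') hq bq fun _ _ =>
    Dec.all (p := fun x c' => Splitter.cost (n x.1) (L x.1) (H x.1) (r x.1) (a x.1) x.2 ≤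
      Splitter.cost (n x.1) (L x.1) (H x.1) (r x.1) (a x.1) c') hq.num bq.num fun _ _ =>
      Comp.le (Comp.cost hn.num.num bn.num.num hL.num.num bL.num.num hH.num.num hr.num.num
          ha.num.num Comp.last.num)
        (Comp.cost hn.num.num bn.num.num hL.num.num bL.num.num hH.num.num hr.num.num ha.num.num
          .last)

theorem Tab.colourStep (hn : v.Comp n) (bn : v.Bd n) (hL : v.Comp L) (bL : v.Bd L) (hq : v.Comp q)
    (bq : v.Bd q) (hH : v.Var H) (hr : v.Comp r) (ha : v.Comp a) :
    v.Tab L n fun γ => Splitter.colourStep (n γ) (L γ) (q γ) (r γ) (a γ) (H γ) :=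
  Tab.tab (f := fun γ i j => if i = r γ ∧ j = a γ then
    Splitter.colour (n γ) (L γ) (q γ) (H γ) (r γ) (a γ) else H γ i j) hL bL hn bn fun _ _ _ _ =>
    Comp.ite (Dec.and (Comp.last.num.eq hr.num.num) (Comp.last.eq ha.num.num))
      (Comp.colour hn bn hL bL hq bq hH hr ha).num.num (Comp.read hH.num.num Comp.last.num .last)

theorem Tab.colouring (hn : v.Comp n) (bn : v.Bd n) (hL : v.Comp L) (bL : v.Bd L) (hq : v.Comp q)
    (bq : v.Bd q) : v.Tab L n fun γ => Splitter.colouring (n γ) (L γ) (q γ) := by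
  refine Tab.iter (step := fun γ r H => RAM.iter (Splitter.colourStep (n γ) (L γ) (q γ) r) H (n γ))
    hL bL (Tab.tab (f := fun _ _ _ => 0) hL bL hn bn fun _ _ _ _ => .const 0) fun x hx y hy => ?_
  have e : ((v.arr L n x hx).num y hy).Ext v fun p => p.1.1 := Ext.refl.arr.num
  refine Tab.iter (step := fun (p : (Γ × (ℕ → ℕ → ℕ)) × ℕ) j H =>
      Splitter.colourStep (n p.1.1) (L p.1.1) (q p.1.1) p.2 j H)
    (hn.ext e) (bn.ext e) (Tab.last.ext Ext.refl.num) fun x' hx' y' hy' => ?_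
  have e' := (e.arr (R := fun p => L p.1.1) (C := fun p => n p.1.1) (hr := hx')).num (hr := hy')
  exact Tab.colourStep (n := fun p : (((Γ × (ℕ → ℕ → ℕ)) × ℕ) × (ℕ → ℕ → ℕ)) × ℕ => n p.1.1.1.1)
    (L := fun p => L p.1.1.1.1) (q := fun p => q p.1.1.1.1) (H := fun p => p.1.2)
    (r := fun p => p.1.1.2) (a := fun p => p.2) (hn.ext e') (bn.ext e') (hL.ext e') (bL.ext e')
    (hq.ext e') (bq.ext e') (Var.last (bL.ext e)).num Comp.last.arr.num Comp.last

/-- A loop variable carries no bound in its context, so `τ` and the exponent are truncated by minima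
to make the loops short. For the values that occur the minima have no effect. -/
theorem Dec.chosen (hq : v.Comp q) (bq : v.Bd q) (hk : v.Comp k) (bk : v.Bd k)
    (bQ : v.Bd fun γ => q γ ^ k γ) (hH : v.Var H) (hr : v.Comp r) (hτ : v.Comp τ)
    (ha : v.Comp a) : v.Dec fun γ =>
      Splitter.chosen (q γ) (k γ) (H γ) (r γ) (min (τ γ) (q γ ^ k γ)) (a γ) := by
  have hQ : v.Comp fun γ => q γ ^ k γ := Comp.pow hq bq hk bk
  refine (Dec.ex (p := fun γ i => H γ (r γ) (a γ) =
    min (min (τ γ) (q γ ^ k γ) / q γ ^ min i (k γ)) (q γ ^ k γ) % q γ) hk bk fun x hx => ?_).congr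
    fun γ => exists_congr fun i => and_congr_right fun hi => ?_
  · have hpow : (v.num x hx).Comp fun p => q p.1 ^ min p.2 (k p.1) :=
      Comp.pow hq.num bq.num (Comp.last.min hk.num) (bk.num.mono fun _ => min_le_right _ _)
    have bpow : (v.num x hx).Bd fun p => q p.1 ^ min p.2 (k p.1) := by
      refine Bd.mono (bQ.num.add (.const 1)) fun p => ?_
      rcases Nat.eq_zero_or_pos (q p.1) with h0 | h0
      · rw [h0]
        exact (Nat.pow_le_pow_left zero_le_one _).trans (by simp)
      · exact (Nat.pow_le_pow_right h0 (min_le_right _ _)).trans (Nat.le_succ _)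
    exact (Comp.read hH.num hr.num ha.num).eq (Comp.mod (((hτ.min hQ).num).div hpow bpow hQ.num
      bQ.num) (bQ.num.mono fun _ => min_le_right _ _) hq.num bq.num)
  · rw [min_eq_left hi.le, min_eq_left ((Nat.div_le_self _ _).trans (min_le_right _ _))]

end Splitter

/-! ### Programs for the reduced instances -/

variable {π : Γ → Instance} {U : Γ → ℕ → Prop} {f g : Γ → ℕ}

theorem Has.cap (h : v.Has π) : v.Comp₂ fun γ => (π γ).cap := by
  classical
  intro _ u ρ e f g hf hg
  have h' := h.ext e
  exact Comp.ite (Dec.and (hf.lt h'.n) (hg.eq (h'.n.add hf))) (.const 1)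
    (Comp.ite (Dec.and (h'.n.le hf) (h'.adj (hf.sub h'.n) hg)) (h'.k.add (.const 1)) (.const 0))

theorem Has.sink (h : v.Has π) : v.Dec₁ fun γ => (π γ).sink := by
  intro _ u ρ e f hf
  have h' := h.ext e
  exact Dec.or (h'.inW hf) (Dec.and (h'.n.le hf) (h'.inW (hf.sub h'.n)))

theorem Has.push (h : v.Has π) (hU : v.Dec₁ U) : v.Dec₂ fun γ => (π γ).push (U γ) := by
  intro _ u ρ e f g hf hg
  have h' := h.ext e
  exact Dec.and (hf.lt h'.n) (Dec.and (hg.eq (h'.n.add hf)) (hU _ u ρ e hf).not)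

theorem Has.covered (h : v.Has π) (hU : v.Dec₁ U) : v.Dec₁ fun γ => (π γ).Covered (U γ) := by
  intro _ u ρ e f hf
  have h' := h.ext e
  refine Dec.congr (Dec.and (hf.lt h'.n) (Dec.flow_succeeds ((Comp.const 2).mul (.const 2) h'.n)
    ((Bd.const 2).mul h'.bd_n) h'.sink (h'.push (hU.ext e)) h'.cap (h'.n.add hf)
    (((Comp.const 2).mul (.const 2) h'.k).add (.const 2))
    (((Bd.const 2).mul h'.bd_k).add (.const 2)) h'.k)) fun δ => ((π (ρ δ)).covered_iff _ _).symm

theorem Has.thru (h : v.Has π) (hU : v.Dec₁ U) : v.Dec₂ fun γ => (π γ).thru (U γ) := by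
  intro _ u ρ e f g hf hg
  have h' := h.ext e
  exact Comp.let (f := fun δ E => bit (E 0 (f δ) ≠ 0)) (Tab.reach
    (arc := fun δ x y => (π (ρ δ)).Covered (U (ρ δ)) x ∧ (π (ρ δ)).adj x y)
    (sink := fun δ x => x = g δ) h'.n h'.bd_n
    (fun _ w σ e' _ _ hx hy => Dec.and (h'.covered (hU.ext e) _ w σ e' hx) ((h'.ext e').adj hx hy))
    fun _ w σ e' _ hx => hx.eq (hg.ext e'))
    fun r hr => (Comp.read (Var.last (.const 1)) (.const 0) hf.arr).ne_zero

theorem Has.link (h : v.Has π) (hU : v.Dec₁ U) : v.Dec₂ fun γ => (π γ).link (U γ) := by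
  intro _ u ρ e f g hf hg
  have h' := h.ext e
  have hc := h.covered hU
  refine Dec.or (Dec.and (hc _ u ρ e hf).not (Dec.and (hc _ u ρ e hg).not
    (Dec.ex h'.n h'.bd_n fun r hr => ?_))) (Dec.and (hc _ u ρ e hf)
      (hg.eq (Comp.least h'.n h'.bd_n fun r hr => h'.num.inW .last)))
  exact Dec.and (h'.num.adj hf.num .last) (h.thru hU _ _ _ e.num .last hg.num)

theorem Has.emit_bypassCode (h : v.Has π) (hU : v.Dec₁ U) :
    v.Emit fun γ => (π γ).bypassCode (U γ) := by
  have hc := h.covered hU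
  refine (((Emit.write h.n).append (Emit.write h.k)).append ?_ |>.append ?_).append ?_
  · refine Emit.for (g := fun γ u => (List.range (π γ).n).flatMap fun v => [bit (u < (π γ).n ∧
      v < (π γ).n ∧ u ≠ v ∧ ((π γ).link (U γ) u v ∨ (π γ).link (U γ) v u))]) h.n h.bd_n
      fun r hr => Emit.for (g := fun x v => [bit (x.2 < (π x.1).n ∧ v < (π x.1).n ∧ x.2 ≠ v ∧
        ((π x.1).link (U x.1) x.2 v ∨ (π x.1).link (U x.1) v x.2))]) h.n.num h.bd_n.num
      fun r' hr' => Emit.write ?_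
    have e : ((v.num r hr).num r' hr').Ext v fun p => p.1.1 := Ext.refl.num.num
    exact Dec.and (Comp.last.num.lt (h.n.ext e)) (Dec.and (Comp.last.lt (h.n.ext e))
      (Dec.and (Comp.last.num.eq .last).not (Dec.or (h.link hU _ _ _ e Comp.last.num .last)
        (h.link hU _ _ _ e .last Comp.last.num))))
  · refine Emit.for (g := fun γ u => (List.range (π γ).n).flatMap fun v => [bit (u < (π γ).n ∧
      v < (π γ).n ∧ ¬(π γ).Covered (U γ) u ∧ ¬(π γ).Covered (U γ) v ∧ ∃ s < (π γ).n,
      ∃ t < (π γ).n, (π γ).pair s t ∧ (π γ).thru (U γ) s u ∧ (π γ).thru (U γ) t v)]) h.n h.bd_n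
      fun r hr => Emit.for (g := fun x v => [bit (x.2 < (π x.1).n ∧ v < (π x.1).n ∧
        ¬(π x.1).Covered (U x.1) x.2 ∧ ¬(π x.1).Covered (U x.1) v ∧ ∃ s < (π x.1).n,
        ∃ t < (π x.1).n, (π x.1).pair s t ∧ (π x.1).thru (U x.1) s x.2 ∧
        (π x.1).thru (U x.1) t v)]) h.n.num h.bd_n.num fun r' hr' => Emit.write ?_
    have e : ((v.num r hr).num r' hr').Ext v fun p => p.1.1 := Ext.refl.num.num
    refine Dec.and (Comp.last.num.lt (h.n.ext e)) (Dec.and (Comp.last.lt (h.n.ext e))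
      (Dec.and (hc _ _ _ e Comp.last.num).not (Dec.and (hc _ _ _ e .last).not
        (Dec.ex (p := fun x s => ∃ t < (π x.1.1).n, (π x.1.1).pair s t ∧
            (π x.1.1).thru (U x.1.1) s x.1.2 ∧ (π x.1.1).thru (U x.1.1) t x.2)
          (h.n.ext e) (h.bd_n.ext e) fun r₁ h₁ =>
          Dec.ex (p := fun y t => (π y.1.1.1).pair y.2 t ∧
            (π y.1.1.1).thru (U y.1.1.1) y.2 y.1.1.2 ∧ (π y.1.1.1).thru (U y.1.1.1) t y.1.2)
          (h.n.ext e.num) (h.bd_n.ext e.num) fun r₂ h₂ => ?_))))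
    exact Dec.and ((h.ext e.num.num).pair Comp.last.num .last)
      (Dec.and (h.thru hU _ _ _ e.num.num Comp.last.num Comp.last.num.num.num)
        (h.thru hU _ _ _ e.num.num .last Comp.last.num.num))
  · exact Emit.for (g := fun γ v => [bit ((π γ).inW v)]) h.n h.bd_n fun r hr =>
      Emit.write (h.num.inW .last)

theorem Has.bd_colours (h : v.Has π) : v.Bd fun γ => (π γ).colours :=
  ((Bd.const 4).mul (h.bd_k.mul (h.bd_k.mul (h.bd_k.add (.const 1))))).add (.const 1)

theorem Has.colours (h : v.Has π) : v.Comp fun γ => (π γ).colours :=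
  ((Comp.const 4).mul (.const 4) (h.k.mul h.bd_k (h.k.mul h.bd_k (h.k.add (.const 1))))).add
    (.const 1)

theorem Has.colourings (h : v.Has π) : v.Comp fun γ => (π γ).colourings :=
  h.colours.mul h.bd_colours ((Comp.log h.n h.bd_n).add (.const 1))

theorem Has.bd_colourings (h : v.Has π) : v.Bd fun γ => (π γ).colourings :=
  h.bd_colours.mul ((h.bd_n.mono fun _ => Nat.log_le_self _ _).add (.const 1))

/-- This is where the factor `max k 2 ^ k` of the scale is used: the number of colours is polynomial
in `k`, and its `k`-th power is a power of that factor. -/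
theorem Has.bd_guesses (h : v.Has π) : v.Bd fun γ => (π γ).colours ^ (π γ).k := by
  refine (h.bd_pow.pow 6).mono fun γ => ?_
  rcases Nat.eq_zero_or_pos (π γ).k with hk | hk
  · simp [hk]
  · rw [pow_right_comm]
    exact Nat.pow_le_pow_left (Instance.colours_le hk) _

theorem emit_reduce : inputView.Emit fun I => I.reduce.flatMap Instance.encode := by
  classical
  have h := has_inputView
  have main : inputView.Emit fun I => if ∃ v < I.n, I.inW v then
      (List.range I.colourings).flatMap fun r => (List.range (I.colours ^ I.k)).flatMap fun τ =>
        I.bypassCode (Splitter.chosen I.colours I.k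
          (Splitter.colouring I.n I.colourings I.colours) r (min τ (I.colours ^ I.k)))
      -- The encoding of `Instance.trivial`, which has empty matrices.
      else [0] ++ [I.k] := by
    refine Emit.ite (Dec.ex h.n h.bd_n fun r hr => h.num.inW .last) ?_
      ((Emit.write (.const 0)).append (Emit.write h.k))
    refine Emit.let (g := fun I H => (List.range I.colourings).flatMap fun r =>
      (List.range (I.colours ^ I.k)).flatMap fun τ =>
        I.bypassCode (Splitter.chosen I.colours I.k H r (min τ (I.colours ^ I.k))))
      (Tab.colouring h.n h.bd_n h.colourings h.bd_colourings h.colours h.bd_colours) fun x hx => ?_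
    refine Emit.for (g := fun (p : Instance × (ℕ → ℕ → ℕ)) r =>
      (List.range (p.1.colours ^ p.1.k)).flatMap fun τ =>
        p.1.bypassCode (Splitter.chosen p.1.colours p.1.k p.2 r (min τ (p.1.colours ^ p.1.k))))
      h.colourings.arr h.bd_colourings.arr fun y hy => ?_
    refine Emit.for (g := fun (p : (Instance × (ℕ → ℕ → ℕ)) × ℕ) τ =>
        p.1.1.bypassCode (Splitter.chosen p.1.1.colours p.1.1.k p.1.2 p.2
          (min τ (p.1.1.colours ^ p.1.1.k))))
      (Comp.pow h.colours h.bd_colours h.k h.bd_k).arr.num h.bd_guesses.arr.num fun z hz => ?_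
    refine Has.emit_bypassCode h.arr.num.num fun _ w σ e f hf => ?_
    have h' := h.arr.num.num.ext e
    exact Dec.chosen h'.colours h'.bd_colours h'.k h'.bd_k h'.bd_guesses
      ((Var.last h.bd_colourings).num.num.ext e) (Comp.last.num.ext e) (Comp.last.ext e) hf
  refine main.congr fun I => ?_
  have hW : (∃ v < I.n, I.inW v) ↔ I.W.Nonempty :=
    ⟨fun ⟨_, _, _, h⟩ => ⟨_, h⟩, fun ⟨w, h⟩ => ⟨w, w.2, Instance.inW_iff.2 h⟩⟩
  rw [Instance.reduce]
  by_cases hne : I.W.Nonempty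
  · rw [if_pos (hW.2 hne), dif_pos hne, List.flatMap_assoc]
    refine List.flatMap_congr fun r _ => ?_
    rw [List.flatMap_map]
    refine List.flatMap_congr fun τ hτ => ?_
    rw [min_eq_left (List.mem_range.1 hτ).le, Instance.encode_bypass]
    rfl
  · rw [if_neg (mt hW.1 hne), dif_neg hne, List.flatMap_singleton]
    simp [Instance.encode_eq, Instance.trivial]

end RAM.View

theorem mainTheorem5 :
    ∃ (A : VMC.Instance → List VMC.Instance) (p : RAM.Program) (c : ℕ),
      VMC.IsPartialBranching A ∧
      (∀ I : VMC.Instance,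
        RAM.OutputsWithin p I.encode ((A I).flatMap VMC.Instance.encode)
          (c * max I.k 2 ^ (c * I.k) * (I.n + 1) ^ c)) ∧
      (∀ I : VMC.Instance,
        (A I).length ≤ c * max I.k 2 ^ (c * I.k) * (Nat.log 2 I.n + 1)) ∧
      (∀ I : VMC.Instance, I.IsYes → ∃ I' ∈ A I, ∃ X, I'.IsShadowlessSolution X) := by
  obtain ⟨p, c, hp⟩ := RAM.exists_program RAM.View.emit_reduce
  have hpow : ∀ (I : VMC.Instance) (d : ℕ), d ≤ c + 12 →
      max I.k 2 ^ (d * I.k) ≤ max I.k 2 ^ ((c + 12) * I.k) := fun I d hd =>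
    Nat.pow_le_pow_right (by omega) (Nat.mul_le_mul_right _ hd)
  -- The constant `c` comes from the program and `12` from `length_reduce_le`.
  refine ⟨VMC.Instance.reduce, p, c + 12, VMC.Instance.isPartialBranching_reduce, fun I => ?_,
    fun I => ?_, fun I hI => hI.exists_mem_reduce⟩
  · obtain ⟨t, ht, s, hs⟩ := hp I
    refine ⟨t,
      ht.trans (Nat.mul_le_mul (Nat.mul_le_mul (by omega) (hpow I c (by omega))) ?_), s, hs⟩
    exact Nat.pow_le_pow_right (by omega) (by omega)
  · refine I.length_reduce_le.trans (Nat.mul_le_mul_right _ ?_)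
    exact (hpow I 12 (by omega)).trans (Nat.le_mul_of_pos_left _ (by omega))
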